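/- Let $\alpha\in[0,1)$ and $k\in\mathbb Z\setminus\{0\}$. On $L^2(\mathbb R^+)$, $\mathbb R^+=(0,\infty)$, let $$A:=A_\alpha(k):=-\frac{d^2}{dx^2}+k^2x^{2\alpha}+\frac{\alpha(2+\alpha)}{4x^2},\qquad \mathcal D(A):=C_c^\infty(\mathbb R^+).$$ Write $\langle x\rangle=\sqrt{1+x^2}$, let $H^n_0(\mathbb R^+)$ be the closure of $C^\infty_c(\mathbb R^+)$ in $H^n(\mathbb R^+)$, and let $I_\nu,K_\nu$ be the modified Bessel functions. Put $$\Phi(x)=\sqrt x\,K_{1/2}\Big(\tfrac{|k|}{1+\alpha}x^{1+\alpha}\Big),\quad F(x)=\sqrt x\,I_{1/2}\Big(\tfrac{|k|}{1+\alpha}x^{1+\alpha}\Big),\quad \Psi(x)=\int_0^\infty G(x,\rho)\Phi(\rho)\,d\rho,$$ where $G(r,\rho)=\frac1{1+\alpha}\Phi(r)F(\rho)$ for $0<\rho<r$ and $G(r,\rho)=\frac1{1+\alpha}F(r)\Phi(\rho)$ for $0<r<\rho$. The sign $\dotplus$ denotes a direct sum of vector spaces. Asymptotics as $x\downarrow0$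 refer to continuous representatives. Then $A$ is densely defined and closable, and: (i) $\mathcal D(\overline A)=H^2_0(\mathbb R^+)\cap L^2(\mathbb R^+,\langle x\rangle^{4\alpha}dx)$. (ii) The adjoint has domain $$\mathcal D(A^*)=\Big\{g\in L^2(\mathbb R^+)\ \Big|\ -g''+k^2x^{2\alpha}g+\tfrac{\alpha(2+\alpha)}{4x^2}g\in L^2(\mathbb R^+)\Big\}=\mathcal D(\overline A)\dotplus\mathrm{span}\{\Psi\}\dotplus\mathrm{span}\{\Phi\}$$ (weak derivatives), and $A^*g=-g''+k^2x^{2\alpha}g+\frac{\alpha(2+\alpha)}{4x^2}g$ there. The functions $\Phi$ and $\Psi$ are smooth on $\mathbb R^+$ and square-integrable, and $\ker A^*=\mathrm{span}\{\Phi\}$. (iii) The operator $A$ is symmetric and non-negative. Its Friedrichs extension $A_F$ has operator domain $$\mathcal D(A_F)=\{g\in\mathcal D(A^*)\mid g(x)=g_1x^{1+\alpha/2}+o(x^{3/2})\text{ as }x\downarrow0,\ g_1\in\mathbb C\}=\mathcal D(\overline A)\dotplus\mathrm{span}\{\Psi\}$$ and form domain $\mathcal D[A_F]=H^1_0(\mathbb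 R^+)\cap L^2(\mathbb R^+,\langle x^{2\alpha}\rangle dx)$. It is the only self-adjoint extension of $A$ whose operator domain is contained in $\mathcal D(x^{-1})=\{g\in L^2(\mathbb R^+)\mid x^{-1}g\in L^2(\mathbb R^+)\}$. (iv) The self-adjoint extensions of $A$ in $L^2(\mathbb R^+)$ are exactly the members of the family $\{A^{[\gamma]}\mid\gamma\in\mathbb R\cup\{\infty\}\}$, where $A^{[\infty]}=A_F$ and, for $\gamma\in\mathbb R$, $A^{[\gamma]}$ is the restriction of $A^*$ to $$\mathcal D(A^{[\gamma]})=\{g\in\mathcal D(A^*)\mid g(x)=g_0x^{-\alpha/2}+\gamma g_0x^{1+\alpha/2}+o(x^{3/2})\text{ as }x\downarrow0,\ g_0\in\mathbb C\}.$$ -/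

import Mathlib

open MeasureTheory Set Filter Topology
open scoped LinearPMap ContDiff Distributions ComplexConjugate

noncomputable section

/-! ### Non-negative symmetric operators, form domain and Friedrichs extension -/

namespace LinearPMap

variable {E : Type*} [NormedAddCommGroup E] [InnerProductSpace ℂ E]

/-- The quadratic form `⟨x, A x⟩` of an operator `A` (real part). -/
def quadForm (A : E →ₗ.[ℂ] E) (x : A.domain) : ℝ := (inner ℂ (x : E) (A x)).re

/-- `A` is symmetric and `⟨x, A x⟩ ≥ 0` on its domain. -/
structure IsNonnegSymm (A : E →ₗ.[ℂ] E) : Prop where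
  symm : ∀ x y : A.domain, inner ℂ (A x) (y : E) = inner ℂ (x : E) (A y)
  nonneg : ∀ x : A.domain, 0 ≤ A.quadForm x

theorem quadForm_smul (A : E →ₗ.[ℂ] E) (c : ℂ) (x : A.domain) :
    A.quadForm (c • x) = ‖c‖ ^ 2 * A.quadForm x := by
  simp only [quadForm, LinearPMap.map_smul, Submodule.coe_smul, inner_smul_left, inner_smul_right]
  rw [← mul_assoc, Complex.mul_conj, Complex.re_ofReal_mul,
    Complex.normSq_eq_norm_sq]

theorem quadForm_add_le {A : E →ₗ.[ℂ] E} (hA : A.IsNonnegSymm) (x y : A.domain) :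
    A.quadForm (x + y) ≤ 2 * A.quadForm x + 2 * A.quadForm y := by
  have h := hA.nonneg (x - y)
  simp only [quadForm, LinearPMap.map_add, LinearPMap.map_sub, Submodule.coe_add,
    AddSubgroupClass.coe_sub, inner_add_left, inner_add_right, inner_sub_left, inner_sub_right,
    Complex.add_re, Complex.sub_re] at h ⊢
  linarith

/-- The form domain of a non-negative symmetric operator `A`: the closure of the domain of `A` in
the form norm `(⟨x, A x⟩ + ‖x‖²)^(1/2)`, i.e. the set of all limits in `E` of sequences in the
domain of `A` which are Cauchy for the form norm. -/
def formDomain (A : E →ₗ.[ℂ] E) (hA : A.IsNonnegSymm) : Submodule ℂ E where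
  carrier := {u | ∃ x : ℕ → A.domain, Tendsto (fun n => (x n : E)) atTop (𝓝 u) ∧
    Tendsto (fun p : ℕ × ℕ => A.quadForm (x p.1 - x p.2)) atTop (𝓝 0)}
  zero_mem' := ⟨fun _ => 0, by simp, by simp [quadForm]⟩
  add_mem' := by
    rintro u v ⟨x, hx, hx'⟩ ⟨y, hy, hy'⟩
    refine ⟨fun n => x n + y n, by simpa using hx.add hy, ?_⟩
    refine squeeze_zero (fun p => hA.nonneg _) (fun p => ?_)
      (by simpa using (hx'.const_mul 2).add (hy'.const_mul 2))
    rw [add_sub_add_comm]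
    exact quadForm_add_le hA _ _
  smul_mem' := by
    rintro c u ⟨x, hx, hx'⟩
    refine ⟨fun n => c • x n, by simpa using hx.const_smul c, ?_⟩
    simp only [← smul_sub, quadForm_smul]
    simpa using hx'.const_mul (‖c‖ ^ 2)

/-- The Friedrichs extension of a (densely defined) non-negative symmetric operator: the
restriction of the adjoint to the vectors of its domain which lie in the form domain. -/
def friedrichs [CompleteSpace E] (A : E →ₗ.[ℂ] E) (hA : A.IsNonnegSymm) : E →ₗ.[ℂ] E :=
  A†.domRestrict (A.formDomain hA)

end LinearPMap

/-! ### Modified Bessel functions -/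

/-- The modified Bessel function of the first kind `I_ν(z)`, `z > 0`. -/
def besselI (ν z : ℝ) : ℝ :=
  ∑' m : ℕ, (z / 2) ^ (2 * (m : ℝ) + ν) / ((m.factorial : ℝ) * Real.Gamma ((m : ℝ) + ν + 1))

/-- The modified Bessel function of the second kind `K_ν(z)`, `z > 0`. -/
def besselK (ν z : ℝ) : ℝ :=
  ∫ t in Ioi (0 : ℝ), Real.exp (-(z * Real.cosh t)) * Real.cosh (ν * t)

namespace HalfLine

/-! ### Function spaces on the open half-line -/

/-- The open half-line `(0, ∞)`. -/
def posReals : TopologicalSpace.Opens ℝ := ⟨Ioi 0, isOpen_Ioi⟩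

/-- Lebesgue measure on the half-line. -/
abbrev leb : Measure ℝ := volume.restrict (Ioi (0 : ℝ))

/-- The Hilbert space `L²(ℝ⁺)`. -/
abbrev L2 : Type := Lp ℂ 2 leb

/-- `⟨x⟩ = √(1 + x²)`. -/
def japaneseBracket (x : ℝ) : ℝ := Real.sqrt (1 + x ^ 2)

/-- The elements of `L²(ℝ⁺)` which also lie in `L²(ℝ⁺, w dx)`. -/
def weightedL2 (w : ℝ → ℝ) : Set L2 := {u | Integrable (fun x => w x * ‖u x‖ ^ 2) leb}

/-- `v` is the `m`-th weak derivative of `u` on the half-line. -/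
def HasWeakDeriv (m : ℕ) (u v : ℝ → ℂ) : Prop :=
  LocallyIntegrableOn u (Ioi 0) ∧ LocallyIntegrableOn v (Ioi 0) ∧
    ∀ φ : 𝓓(posReals, ℂ),
      ∫ x in Ioi (0 : ℝ), u x * iteratedDeriv m φ x = (-1) ^ m * ∫ x in Ioi (0 : ℝ), v x * φ x

/-- The Sobolev space `H^n_0(ℝ⁺)`: those `u` with weak derivatives `v 0, …, v n` in `L²(ℝ⁺)` up to
order `n` that can be approximated in the norm of `H^n` by smooth functions compactly supported
in `(0, ∞)`. -/
def sobolevZero (n : ℕ) : Set L2 :=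
  {u | ∃ v : ℕ → L2, (∀ m ≤ n, HasWeakDeriv m u (v m)) ∧
    ∀ ε : ℝ, 0 < ε → ∃ φ : 𝓓(posReals, ℂ), ∀ m ≤ n,
      eLpNorm (fun x => v m x - iteratedDeriv m φ x) 2 leb < ENNReal.ofReal ε}

/-- The domain of the maximal multiplication operator by `x⁻¹` in `L²(ℝ⁺)`. -/
def domInvX : Set L2 := {u | MemLp (fun x : ℝ => (x : ℂ)⁻¹ * u x) 2 leb}

/-- `u(x) = p(x) + o(x^(3/2))` as `x ↓ 0`, for the continuous representative of `u`. -/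
def AsympZero (u : L2) (p : ℝ → ℂ) : Prop :=
  ∃ f : ℝ → ℂ, u =ᵐ[leb] f ∧ ContinuousOn f (Ioi 0) ∧
    (fun x => f x - p x) =o[𝓝[>] (0 : ℝ)] fun x : ℝ => x ^ (3 / 2 : ℝ)

/-! ### The operator `A_α(k)` -/

/-- The potential `k² x^(2α) + α (2 + α) / (4 x²)`. -/
def potential (α : ℝ) (k : ℤ) (x : ℝ) : ℝ :=
  (k : ℝ) ^ 2 * x ^ (2 * α) + α * (2 + α) / (4 * x ^ 2)

/-- The classical action `-φ'' + k² x^(2α) φ + α (2 + α) / (4 x²) φ`. -/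
def diffOp (α : ℝ) (k : ℤ) (φ : ℝ → ℂ) (x : ℝ) : ℂ :=
  -iteratedDeriv 2 φ x + (potential α k x : ℂ) * φ x

/-- `-u'' + k² x^(2α) u + α (2 + α) / (4 x²) u = h` on the half-line, with the weak second
derivative. -/
def WeakDiffOp (α : ℝ) (k : ℤ) (u h : L2) : Prop :=
  ∃ w : ℝ → ℂ, HasWeakDeriv 2 u w ∧
    h =ᵐ[leb] fun x => -w x + (potential α k x : ℂ) * u x

theorem potential_nonneg {α : ℝ} (hα : 0 ≤ α) (k : ℤ) {x : ℝ} (hx : 0 < x) :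
    0 ≤ potential α k x := by
  unfold potential; positivity

theorem continuousOn_potential (α : ℝ) (k : ℤ) : ContinuousOn (potential α k) (Ioi 0) := by
  unfold potential
  refine ContinuousOn.add (continuousOn_const.mul ?_) (continuousOn_const.div (by fun_prop) ?_)
  · exact continuousOn_id.rpow_const fun x hx => Or.inl (ne_of_gt hx)
  · intro x hx
    have : (0 : ℝ) < x := hx
    positivity

/-- A continuous function on the half-line times a test function is continuous on the line. -/
theorem continuous_mul_test {f : ℝ → ℂ} (hf : ContinuousOn f (Ioi 0)) (φ : 𝓓(posReals, ℂ)) :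
    Continuous fun x => f x * φ x := by
  rw [continuous_iff_continuousAt]
  intro x
  by_cases hx : x ∈ tsupport φ
  · have : x ∈ Ioi (0 : ℝ) := φ.tsupport_subset hx
    exact (hf.continuousAt (isOpen_Ioi.mem_nhds this)).mul φ.continuous.continuousAt
  · have h0 : (fun y => f y * φ y) =ᶠ[𝓝 x] fun _ => 0 := by
      filter_upwards [notMem_tsupport_iff_eventuallyEq.1 hx] with y hy
      simp [hy]
    exact continuousAt_const.congr h0.symm

theorem continuous_iteratedDeriv (φ : 𝓓(posReals, ℂ)) (m : ℕ) :
    Continuous (iteratedDeriv m φ) :=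
  φ.contDiff.continuous_iteratedDeriv m (by exact_mod_cast le_top)

theorem support_iteratedDeriv (φ : 𝓓(posReals, ℂ)) (m : ℕ) :
    Function.support (iteratedDeriv m φ) ⊆ tsupport φ := by
  intro x hx
  by_contra h
  apply hx
  have := (notMem_tsupport_iff_eventuallyEq.1 h).iteratedDeriv_eq m
  rw [this]
  change iteratedDeriv m (fun _ => (0 : ℂ)) x = 0
  simp

theorem continuous_diffOp (α : ℝ) (k : ℤ) (φ : 𝓓(posReals, ℂ)) : Continuous (diffOp α k φ) := by
  unfold diffOp
  exact (continuous_iteratedDeriv φ 2).neg.add (continuous_mul_test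
    (Complex.continuous_ofReal.comp_continuousOn (continuousOn_potential α k)) φ)

theorem hasCompactSupport_diffOp (α : ℝ) (k : ℤ) (φ : 𝓓(posReals, ℂ)) :
    HasCompactSupport (diffOp α k φ) := by
  refine HasCompactSupport.intro φ.hasCompactSupport fun x hx => ?_
  have h1 : iteratedDeriv 2 φ x = 0 := by
    by_contra h
    exact hx (support_iteratedDeriv φ 2 h)
  simp [diffOp, h1, image_eq_zero_of_notMem_tsupport hx]

theorem memLp_test (φ : 𝓓(posReals, ℂ)) : MemLp φ 2 leb :=
  φ.continuous.memLp_of_hasCompactSupport φ.hasCompactSupport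

theorem memLp_diffOp (α : ℝ) (k : ℤ) (φ : 𝓓(posReals, ℂ)) : MemLp (diffOp α k φ) 2 leb :=
  (continuous_diffOp α k φ).memLp_of_hasCompactSupport (hasCompactSupport_diffOp α k φ)

/-- The inclusion of the test functions on the half-line in `L²(ℝ⁺)`. -/
def testToL2 : 𝓓(posReals, ℂ) →ₗ[ℂ] L2 where
  toFun φ := (memLp_test φ).toLp φ
  map_add' _ _ := rfl
  map_smul' _ _ := rfl

theorem diffOp_add (α : ℝ) (k : ℤ) (φ ψ : 𝓓(posReals, ℂ)) :
    diffOp α k (φ + ψ : 𝓓(posReals, ℂ)) = diffOp α k φ + diffOp α k ψ := by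
  ext x
  have h : iteratedDeriv 2 (⇑φ + ⇑ψ) x = iteratedDeriv 2 φ x + iteratedDeriv 2 ψ x :=
    iteratedDeriv_add (φ.contDiff.contDiffAt.of_le (WithTop.coe_le_coe.2 le_top))
      (ψ.contDiff.contDiffAt.of_le (WithTop.coe_le_coe.2 le_top))
  have h' : ⇑(φ + ψ) = ⇑φ + ⇑ψ := rfl
  simp only [diffOp, h', h, Pi.add_apply]
  ring

theorem diffOp_smul (α : ℝ) (k : ℤ) (c : ℂ) (φ : 𝓓(posReals, ℂ)) :
    diffOp α k (c • φ : 𝓓(posReals, ℂ)) = c • diffOp α k φ := by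
  ext x
  have h : iteratedDeriv 2 (c • ⇑φ) x = c • iteratedDeriv 2 φ x :=
    iteratedDeriv_const_smul (φ.contDiff.contDiffAt.of_le (WithTop.coe_le_coe.2 le_top)) c
  have h' : ⇑(c • φ) = c • ⇑φ := rfl
  simp only [diffOp, h', h, Pi.smul_apply, smul_eq_mul]
  ring

/-- The differential expression as a linear map from the test functions to `L²(ℝ⁺)`. -/
def diffOpToL2 (α : ℝ) (k : ℤ) : 𝓓(posReals, ℂ) →ₗ[ℂ] L2 where
  toFun φ := (memLp_diffOp α k φ).toLp (diffOp α k φ)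
  map_add' φ ψ := by
    rw [← MemLp.toLp_add]
    exact MemLp.toLp_congr _ _ (by rw [diffOp_add])
  map_smul' c φ := by
    rw [RingHom.id_apply, ← MemLp.toLp_const_smul]
    exact MemLp.toLp_congr _ _ (by rw [diffOp_smul])

theorem testToL2_injective : Function.Injective testToL2 := by
  intro φ ψ h
  have h1 : φ =ᵐ[leb] ψ := (MemLp.toLp_eq_toLp_iff (memLp_test φ) (memLp_test ψ)).1 h
  have h2 : EqOn φ ψ (Ioi 0) :=
    Measure.eqOn_open_of_ae_eq h1 isOpen_Ioi φ.continuous.continuousOn ψ.continuous.continuousOn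
  ext x
  by_cases hx : x ∈ Ioi (0 : ℝ)
  · exact h2 hx
  · rw [image_eq_zero_of_notMem_tsupport fun hx' => hx (φ.tsupport_subset hx'),
      image_eq_zero_of_notMem_tsupport fun hx' => hx (ψ.tsupport_subset hx')]

/-- The operator `A_α(k) = -d²/dx² + k² x^(2α) + α (2 + α) / (4 x²)` in `L²(ℝ⁺)` with domain
`C_c^∞(ℝ⁺)`. -/
def op (α : ℝ) (k : ℤ) : L2 →ₗ.[ℂ] L2 where
  domain := LinearMap.range testToL2
  toFun := diffOpToL2 α k ∘ₗ (LinearEquiv.ofInjective testToL2 testToL2_injective).symm.toLinearMap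

theorem op_apply (α : ℝ) (k : ℤ) (φ : 𝓓(posReals, ℂ)) (h : testToL2 φ ∈ (op α k).domain) :
    op α k ⟨testToL2 φ, h⟩ = diffOpToL2 α k φ := by
  exact congrArg (diffOpToL2 α k)
    ((LinearEquiv.ofInjective testToL2 testToL2_injective).symm_apply_apply φ)

theorem exists_test_of_mem (α : ℝ) (k : ℤ) (x : (op α k).domain) :
    ∃ (φ : 𝓓(posReals, ℂ)) (h : testToL2 φ ∈ (op α k).domain), x = ⟨testToL2 φ, h⟩ := by
  obtain ⟨φ, hφ⟩ := x.2
  exact ⟨φ, ⟨φ, rfl⟩, Subtype.ext hφ.symm⟩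

theorem deriv_eq_zero_of_notMem (φ : 𝓓(posReals, ℂ)) {x : ℝ} (hx : x ∉ Ioi (0 : ℝ)) (m : ℕ) :
    iteratedDeriv m φ x = 0 := by
  by_contra h
  exact hx (φ.tsupport_subset (support_iteratedDeriv φ m h))

theorem hasDerivAt_iteratedDeriv (φ : 𝓓(posReals, ℂ)) (m : ℕ) (x : ℝ) :
    HasDerivAt (iteratedDeriv m φ) (iteratedDeriv (m + 1) φ x) x := by
  rw [iteratedDeriv_succ]
  have : Differentiable ℝ (iteratedDeriv m φ) :=
    φ.contDiff.differentiable_iteratedDeriv m (by exact_mod_cast WithTop.coe_lt_top m)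
  exact (this x).hasDerivAt

theorem hasCompactSupport_iteratedDeriv (φ : 𝓓(posReals, ℂ)) (m : ℕ) :
    HasCompactSupport (iteratedDeriv m φ) :=
  HasCompactSupport.intro φ.hasCompactSupport fun _ hx => by
    by_contra h
    exact hx (support_iteratedDeriv φ m h)

/-- The sesquilinear form of the operator, after integration by parts. -/
theorem inner_diffOp (α : ℝ) (k : ℤ) (φ ψ : 𝓓(posReals, ℂ)) :
    inner ℂ (testToL2 φ) (diffOpToL2 α k ψ) =
      ∫ x in Ioi (0 : ℝ), (conj (iteratedDeriv 1 φ x) * iteratedDeriv 1 ψ x +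
        (potential α k x : ℂ) * (conj (φ x) * ψ x)) := by
  have e1 : inner ℂ (testToL2 φ) (diffOpToL2 α k ψ) =
      ∫ x in Ioi (0 : ℝ), conj (φ x) * diffOp α k ψ x := by
    rw [L2.inner_def]
    refine integral_congr_ae ?_
    filter_upwards [(memLp_test φ).coeFn_toLp, (memLp_diffOp α k ψ).coeFn_toLp] with x h1 h2
    change inner ℂ (((memLp_test φ).toLp φ : L2) x)
      (((memLp_diffOp α k ψ).toLp (diffOp α k ψ) : L2) x) = _
    rw [h1, h2, RCLike.inner_apply, mul_comm]
  have c0 : Continuous fun x => conj (φ x) := Complex.continuous_conj.comp φ.continuous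
  have c1 : Continuous fun x => conj (iteratedDeriv 1 φ x) :=
    Complex.continuous_conj.comp (continuous_iteratedDeriv φ 1)
  have cV : Continuous fun x => (potential α k x : ℂ) * ψ x := continuous_mul_test
    (Complex.continuous_ofReal.comp_continuousOn (continuousOn_potential α k)) ψ
  have i0 : Integrable fun x => conj (φ x) * iteratedDeriv 1 ψ x :=
    (c0.mul (continuous_iteratedDeriv ψ 1)).integrable_of_hasCompactSupport
      (hasCompactSupport_iteratedDeriv ψ 1).mul_left
  have i1 : Integrable fun x => conj (φ x) * iteratedDeriv 2 ψ x :=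
    (c0.mul (continuous_iteratedDeriv ψ 2)).integrable_of_hasCompactSupport
      (hasCompactSupport_iteratedDeriv ψ 2).mul_left
  have i2 : Integrable fun x => conj (iteratedDeriv 1 φ x) * iteratedDeriv 1 ψ x :=
    (c1.mul (continuous_iteratedDeriv ψ 1)).integrable_of_hasCompactSupport
      (hasCompactSupport_iteratedDeriv ψ 1).mul_left
  have i3 : Integrable fun x => conj (φ x) * ((potential α k x : ℂ) * ψ x) :=
    (c0.mul cV).integrable_of_hasCompactSupport ψ.hasCompactSupport.mul_left.mul_left
  have ibp : ∫ x, conj (φ x) * iteratedDeriv 2 ψ x =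
      -∫ x, conj (iteratedDeriv 1 φ x) * iteratedDeriv 1 ψ x := by
    refine integral_mul_deriv_eq_deriv_mul_of_integrable (fun x _ => ?_)
      (fun x _ => hasDerivAt_iteratedDeriv ψ 1 x) i1 i2 i0
    have := (hasDerivAt_iteratedDeriv φ 0 x).star
    simpa using this
  rw [e1, setIntegral_eq_integral_of_forall_compl_eq_zero,
    setIntegral_eq_integral_of_forall_compl_eq_zero]
  · have a1 : (fun x => conj (φ x) * diffOp α k ψ x) =
        fun x => -(conj (φ x) * iteratedDeriv 2 ψ x) +
          conj (φ x) * ((potential α k x : ℂ) * ψ x) := by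
      ext x; simp only [diffOp]; ring
    have a2 : (fun x => conj (iteratedDeriv 1 φ x) * iteratedDeriv 1 ψ x +
        (potential α k x : ℂ) * (conj (φ x) * ψ x)) =
        fun x => conj (iteratedDeriv 1 φ x) * iteratedDeriv 1 ψ x +
          conj (φ x) * ((potential α k x : ℂ) * ψ x) := by
      ext x; ring
    have n1 : Integrable fun x => -(conj (φ x) * iteratedDeriv 2 ψ x) := i1.neg
    rw [a1, a2, integral_add n1 i3, integral_add i2 i3, integral_neg, ibp, neg_neg]
  · intro x hx
    have h0 : ψ x = 0 := by simpa using deriv_eq_zero_of_notMem ψ hx 0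
    rw [deriv_eq_zero_of_notMem ψ hx 1, h0]
    simp
  · intro x hx
    have h0 : φ x = 0 := by simpa using deriv_eq_zero_of_notMem φ hx 0
    simp [h0]

theorem op_isNonnegSymm {α : ℝ} (hα : 0 ≤ α) (k : ℤ) : (op α k).IsNonnegSymm where
  symm := by
    intro x y
    obtain ⟨φ, hφ, rfl⟩ := exists_test_of_mem α k x
    obtain ⟨ψ, hψ, rfl⟩ := exists_test_of_mem α k y
    rw [op_apply, op_apply, ← inner_conj_symm, inner_diffOp, inner_diffOp, ← integral_conj]
    refine integral_congr_ae (ae_of_all _ fun x => ?_)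
    simp only [map_add, map_mul, Complex.conj_conj, Complex.conj_ofReal]
    ring
  nonneg := by
    intro x
    obtain ⟨φ, hφ, rfl⟩ := exists_test_of_mem α k x
    rw [LinearPMap.quadForm, op_apply, inner_diffOp]
    have h : ∀ x : ℝ, conj (iteratedDeriv 1 φ x) * iteratedDeriv 1 φ x +
        (potential α k x : ℂ) * (conj (φ x) * φ x) =
        ((‖iteratedDeriv 1 φ x‖ ^ 2 + potential α k x * ‖φ x‖ ^ 2 : ℝ) : ℂ) := by
      intro x
      rw [Complex.conj_mul', Complex.conj_mul']
      push_cast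
      ring
    simp only [h]
    rw [integral_complex_ofReal, Complex.ofReal_re]
    refine setIntegral_nonneg measurableSet_Ioi fun x hx => ?_
    have := potential_nonneg hα k hx
    positivity

/-- The Friedrichs extension `A_{α,F}(k)` of `A_α(k)`. -/
def opF {α : ℝ} (hα : 0 ≤ α) (k : ℤ) : L2 →ₗ.[ℂ] L2 := (op α k).friedrichs (op_isNonnegSymm hα k)

/-! ### The functions `Φ_{α,k}` and `Ψ_{α,k}` -/

/-- `Φ_{α,k}(x) = √x K_{1/2}(|k| x^(1+α) / (1+α))`. -/
def Phi (α : ℝ) (k : ℤ) (x : ℝ) : ℝ :=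
  Real.sqrt x * besselK (1 / 2) (|(k : ℝ)| / (1 + α) * x ^ (1 + α))

/-- `F_{α,k}(x) = √x I_{1/2}(|k| x^(1+α) / (1+α))`. -/
def Fsol (α : ℝ) (k : ℤ) (x : ℝ) : ℝ :=
  Real.sqrt x * besselI (1 / 2) (|(k : ℝ)| / (1 + α) * x ^ (1 + α))

/-- The Green function; `1 + α` is the (constant) Wronskian `Φ F' - Φ' F`. -/
def green (α : ℝ) (k : ℤ) (r ρ : ℝ) : ℝ :=
  1 / (1 + α) * if ρ < r then Phi α k r * Fsol α k ρ else Fsol α k r * Phi α k ρ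

/-- `Ψ_{α,k}(x) = ∫₀^∞ G_{α,k}(x, ρ) Φ_{α,k}(ρ) dρ`. -/
def Psi (α : ℝ) (k : ℤ) (x : ℝ) : ℝ := ∫ ρ in Ioi (0 : ℝ), green α k x ρ * Phi α k ρ

/-! ### Boundary conditions at the origin -/

theorem AsympZero.add {u v : L2} {p q : ℝ → ℂ} (hu : AsympZero u p) (hv : AsympZero v q) :
    AsympZero (u + v) (fun x => p x + q x) := by
  obtain ⟨f, hf, hf', hf''⟩ := hu
  obtain ⟨g, hg, hg', hg''⟩ := hv
  refine ⟨fun x => f x + g x, (Lp.coeFn_add u v).trans (hf.add hg), hf'.add hg', ?_⟩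
  refine (hf''.add hg'').congr_left fun x => ?_
  ring

theorem AsympZero.smul {u : L2} {p : ℝ → ℂ} (hu : AsympZero u p) (c : ℂ) :
    AsympZero (c • u) (fun x => c * p x) := by
  obtain ⟨f, hf, hf', hf''⟩ := hu
  refine ⟨fun x => c * f x, (Lp.coeFn_smul c u).trans (hf.const_smul c), continuousOn_const.mul hf',
    ?_⟩
  refine (hf''.const_mul_left c).congr_left fun x => ?_
  ring

theorem AsympZero.zero : AsympZero 0 (fun _ => 0) :=
  ⟨fun _ => 0, Lp.coeFn_zero _ _ _, continuousOn_const, by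
    simpa only [sub_self] using Asymptotics.isLittleO_zero (E' := ℂ) (fun x : ℝ => x ^ (3 / 2 : ℝ)) (𝓝[>] 0)⟩

/-- The `g ∈ L²(ℝ⁺)` with `g(x) = g₀ x^(-α/2) + γ g₀ x^(1+α/2) + o(x^(3/2))` as `x ↓ 0`, for some
`g₀ ∈ ℂ`. -/
def boundaryCond (α γ : ℝ) : Submodule ℂ L2 where
  carrier := {g | ∃ g₀ : ℂ, AsympZero g fun x =>
    g₀ * (x ^ (-α / 2) : ℝ) + γ * g₀ * (x ^ (1 + α / 2) : ℝ)}
  zero_mem' := ⟨0, by simpa using AsympZero.zero⟩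
  add_mem' := by
    rintro u v ⟨a, ha⟩ ⟨b, hb⟩
    refine ⟨a + b, ?_⟩
    convert ha.add hb using 2
    ring
  smul_mem' := by
    rintro c u ⟨a, ha⟩
    refine ⟨c * a, ?_⟩
    convert ha.smul c using 2
    ring

/-- The extension `A_α^{[γ]}(k)`, `γ ∈ ℝ`: the restriction of `A_α(k)^*` to the elements of its
domain satisfying the boundary condition with parameter `γ`. -/
def opBC (α : ℝ) (k : ℤ) (γ : ℝ) : L2 →ₗ.[ℂ] L2 := (op α k)†.domRestrict (boundaryCond α γ)

end HalfLine

end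

noncomputable section

/-! ### Closures and adjoints of densely defined symmetric operators. -/

namespace LinearPMap

variable {E : Type*} [NormedAddCommGroup E] [InnerProductSpace ℂ E]

/-! Write V for the potential. Its coupling constant is the one for which -u'' + V u = 0 has
elementary solutions: `recSol`, equal to x^(-α/2) exp(-phase), and `domSol`, equal to x^(-α/2)
sinh(phase)/|k|, with Wronskian 1. Since K_{1/2} and I_{1/2} are elementary (`besselK_half`,
`besselI_half`), Φ and F are constant multiples of these two, and Ψ is a multiple of `greenSol`, the
Green operator applied to `recSol`.

For h in L² every distributional solution g of -g'' + V g = h is a variation-of-parameters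
expression `repSol` with two constants a, b (`isSol_repSol`, `exists_ae_eq_repSol`). Both integrals
in it may start at 0 because α < 1 makes both homogeneous solutions square-integrable there. At the
origin g(x) = a x^(-α/2) + (b - a|k|)/(1+α) x^(1+α/2) + o(x^(3/2)) (`repSol_asymp`), and the two
powers are independent modulo the remainder, so a and b are linear functionals on the domain of the
adjoint. At infinity, square-integrability of g fixes b as the integral of `recSol` times h, so
nothing survives there in Green's identity, which reads ⟨A*f, g⟩ - ⟨f, A*g⟩ = conj(b_f) a_g -
conj(a_f) b_g (`green_identity`).

Thus (a, b) is a boundary pair (`isBoundaryPair`) and the extension theory becomes linear algebra in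
ℂ²: the closure is the common kernel of a and b, and the self-adjoint extensions are the real lines
a = 0 and b = t a. The line b = t a is the boundary condition with γ = (t - |k|)/(1+α). The direct
sums come from the boundary values of Φ, with a ≠ 0, and of Ψ, with a = 0 and b ≠ 0.

The identification of function spaces is analytic. Integrating |Aφ|² by parts and applying Hardy's
inequality twice leaves the factor (3/4 - c)², where c = α(2+α)/4 < 3/4; hence the graph norm
controls the H² norm and the weight (`exists_graph_estimate`). Conversely, Hardy makes x^(-4)|u|²
integrable for u in H²_0, which is incompatible with a nonzero a or b
(`coeff_eq_zero_of_integrable`).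

For the Friedrichs extension, Hardy places the form domain inside the domain of x⁻¹, which forces a
= 0; conversely a cutoff argument puts `greenSol`, hence the whole kernel of a, in the form domain
(`mem_formDomain_iff`). The same estimate a = 0 gives uniqueness among extensions with domain in
that of x⁻¹. The form domain itself is found by damping with exp(-t x), under which multiplication
by x^α becomes bounded (`mem_formDomain`). -/

theorem domRestrict_apply_mk {T : E →ₗ.[ℂ] E} {D : Submodule ℂ E} (x : (T.domRestrict D).domain) :
    T.domRestrict D x = T ⟨x, x.2.2⟩ :=
  domRestrict_apply rfl

/-- Elements of the domain of the closure are limits in the graph norm. -/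
theorem exists_seq_of_mem_closure {T : E →ₗ.[ℂ] E} (hc : T.IsClosable) (x : T.closure.domain) :
    ∃ u : ℕ → T.domain, Tendsto (fun n => (u n : E)) atTop (𝓝 (x : E)) ∧
      Tendsto (fun n => T (u n)) atTop (𝓝 (T.closure x)) := by
  have hx : ((x : E), T.closure x) ∈ T.graph.topologicalClosure := by
    rw [hc.graph_closure_eq_closure_graph]
    exact mem_graph _ x
  obtain ⟨v, hv, hv'⟩ := mem_closure_iff_seq_limit.1 hx
  choose u hu using fun n => (mem_graph_iff _).1 (hv n)
  refine ⟨u, ?_, ?_⟩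
  · simp only [fun n => (hu n).1]
    exact (continuous_fst.tendsto _).comp hv'
  · simp only [fun n => (hu n).2]
    exact (continuous_snd.tendsto _).comp hv'

/-- The vector (-q, p) spans the line p a + q b = 0; vanishing of the boundary form against it puts
(A, B) on the same line. -/
theorem eq_zero_of_conj_form {A B : ℂ} {p q : ℝ} (h : conj B * -(q : ℂ) - conj A * (p : ℂ) = 0) :
    p * A + q * B = 0 := by
  have e3 := congrArg conj h
  simp only [_root_.map_zero, _root_.map_sub, map_mul, Complex.conj_conj, _root_.map_neg,
    Complex.conj_ofReal] at e3
  linear_combination -e3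

/-- Real lines are isotropic: since p and q are real, conjugating the first relation keeps its
coefficients, and one of them can be cancelled. -/
theorem conj_form_eq_zero {A B A' B' : ℂ} {p q : ℝ} (hpq : p ≠ 0 ∨ q ≠ 0)
    (hx : p * A + q * B = 0) (hy : p * A' + q * B' = 0) : conj B * A' - conj A * B' = 0 := by
  have hx' := congrArg conj hx
  simp only [_root_.map_zero, _root_.map_add, map_mul, Complex.conj_ofReal] at hx'
  rcases hpq with hp | hq
  · have hp' : (p : ℂ) ≠ 0 := by exact_mod_cast hp
    refine mul_left_cancel₀ hp' ?_
    linear_combination conj B * hy - B' * hx'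
  · have hq' : (q : ℂ) ≠ 0 := by exact_mod_cast hq
    refine mul_left_cancel₀ hq' ?_
    linear_combination A' * hx' - conj A * hy

section Adjoint

variable [CompleteSpace E] {T : E →ₗ.[ℂ] E}

theorem inner_adjoint_apply (hT : Dense (T.domain : Set E)) (y : T†.domain) (x : T.domain) :
    inner ℂ (T† y) (x : E) = inner ℂ (y : E) (T x) :=
  adjoint_isFormalAdjoint hT y x

/-- The adjoint reverses inclusions. -/
theorem adjoint_anti {S : E →ₗ.[ℂ] E} (hT : Dense (T.domain : Set E)) (h : T ≤ S) : S† ≤ T† := by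
  have hS : Dense (S.domain : Set E) := hT.mono h.1
  refine IsFormalAdjoint.le_adjoint hT fun x y => ?_
  have h1 := inner_adjoint_apply hS y ⟨x, h.1 x.2⟩
  have h2 : T x = S ⟨x, h.1 x.2⟩ := h.2 rfl
  rw [h2, ← inner_conj_symm, ← h1, inner_conj_symm]

theorem le_adjoint_of_symm (hT : Dense (T.domain : Set E)) (hs : T.IsFormalAdjoint T) : T ≤ T† :=
  IsFormalAdjoint.le_adjoint hT hs

/-- The adjoint is a closed extension. -/
theorem isClosable_of_symm (hT : Dense (T.domain : Set E)) (hs : T.IsFormalAdjoint T) :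
    T.IsClosable :=
  (adjoint_isClosed hT).isClosable.leIsClosable (le_adjoint_of_symm hT hs)

theorem closure_le_adjoint (hT : Dense (T.domain : Set E)) (hs : T.IsFormalAdjoint T) :
    T.closure ≤ T† := by
  have hc := isClosable_of_symm hT hs
  refine le_of_le_graph ?_
  rw [← hc.graph_closure_eq_closure_graph]
  exact Submodule.topologicalClosure_minimal _ (le_graph_of_le (le_adjoint_of_symm hT hs))
    (adjoint_isClosed hT)

/-- A vector `x` with a `z` such that `⟨T† y, x⟩ = ⟨y, z⟩` for all `y` lies in the domain of the
closure. -/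
theorem mem_closure_of_forall_inner (hT : Dense (T.domain : Set E)) (hc : T.IsClosable) {x z : E}
    (h : ∀ y : T†.domain, inner ℂ (T† y) x = inner ℂ (y : E) z) : x ∈ T.closure.domain := by
  -- The graph is moved to the Hilbert-space product, where the double orthogonal complement of a
  -- subspace is its closure.
  let e : (E × E) ≃L[ℂ] WithLp 2 (E × E) := (WithLp.prodContinuousLinearEquiv 2 ℂ E E).symm
  let K : Submodule ℂ (WithLp 2 (E × E)) := T.graph.map e.toLinearEquiv.toLinearMap
  have h1 : e (x, z) ∈ Kᗮᗮ := by
    rw [Submodule.mem_orthogonal]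
    intro w hw
    have hw' : ∀ v : T.domain, inner ℂ w.fst (v : E) + inner ℂ w.snd (T v) = 0 := by
      intro v
      have hm : e ((v : E), T v) ∈ K := ⟨((v : E), T v), mem_graph T v, rfl⟩
      have := (Submodule.mem_orthogonal' K w).1 hw _ hm
      rwa [WithLp.prod_inner_apply] at this
    -- A vector orthogonal to the graph of `T` has the form (-T†y, y), so the hypothesis on x and z
    -- is exactly orthogonality of (x, z) to all such vectors.
    have hd : w.snd ∈ T†.domain := by
      refine mem_adjoint_domain_of_exists _ ⟨-w.fst, fun v => ?_⟩
      rw [inner_neg_left, neg_eq_iff_add_eq_zero, hw' v]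
    have ha : T† ⟨w.snd, hd⟩ = -w.fst := by
      refine adjoint_apply_eq hT _ fun v => ?_
      rw [inner_neg_left, neg_eq_iff_add_eq_zero, hw' v]
    have := h ⟨w.snd, hd⟩
    rw [ha, inner_neg_left] at this
    rw [WithLp.prod_inner_apply]
    change inner ℂ w.fst x + inner ℂ w.snd z = 0
    rw [← this]
    simp
  rw [Submodule.orthogonal_orthogonal_eq_closure] at h1
  have h2 : (x, z) ∈ T.graph.topologicalClosure := by
    have h3 : e (x, z) ∈ _root_.closure (e '' (T.graph : Set (E × E))) := h1
    have h4 := map_mem_closure e.symm.continuous h3 (t := (T.graph : Set (E × E))) (by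
      rintro _ ⟨w, hw, rfl⟩
      simpa using hw)
    rwa [e.symm_apply_apply] at h4
  rw [hc.graph_closure_eq_closure_graph] at h2
  exact mem_domain_of_mem_graph h2

end Adjoint

/-! ### Boundary values -/

/-- Boundary values for the adjoint of a densely defined symmetric operator with deficiency indices
`(1, 1)`: two jointly surjective functionals satisfying Green's identity. -/
structure IsBoundaryPair [CompleteSpace E] (T : E →ₗ.[ℂ] E) (a b : T†.domain →ₗ[ℂ] ℂ) : Prop where
  dense : Dense (T.domain : Set E)
  symm : T.IsFormalAdjoint T
  surj : ∀ p q : ℂ, ∃ f, a f = p ∧ b f = q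
  green : ∀ f g : T†.domain, inner ℂ (T† f) (g : E) - inner ℂ (f : E) (T† g) =
    conj (b f) * a g - conj (a f) * b g

namespace IsBoundaryPair

variable [CompleteSpace E] {T : E →ₗ.[ℂ] E} {a b : T†.domain →ₗ[ℂ] ℂ}

/-- Nondegeneracy of the boundary form: by joint surjectivity it can be tested against the boundary
values (1, 0) and (0, 1). -/
theorem eq_zero_of_forall (h : IsBoundaryPair T a b) {f : T†.domain}
    (hf : ∀ g, conj (b f) * a g - conj (a f) * b g = 0) : a f = 0 ∧ b f = 0 := by
  obtain ⟨g, hg1, hg2⟩ := h.surj 1 0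
  obtain ⟨g', hg1', hg2'⟩ := h.surj 0 1
  have e1 := hf g
  have e2 := hf g'
  simp only [hg1, hg2, hg1', hg2', mul_one, mul_zero, sub_zero, zero_sub, neg_eq_zero,
    map_eq_zero] at e1 e2
  exact ⟨e2, e1⟩

/-- Membership in the closure amounts to ⟨T†f, g⟩ = ⟨f, T†g⟩ for all g, that is, to the boundary
form vanishing against everything; nondegeneracy then kills both values. -/
theorem mem_closure_domain_iff (h : IsBoundaryPair T a b) (f : T†.domain) :
    (f : E) ∈ T.closure.domain ↔ a f = 0 ∧ b f = 0 := by
  have hc := isClosable_of_symm h.dense h.symm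
  constructor
  · intro hf
    have e : T.closure ⟨f, hf⟩ = T† f := (closure_le_adjoint h.dense h.symm).2 rfl
    obtain ⟨u, hu, hu'⟩ := exists_seq_of_mem_closure hc ⟨f, hf⟩
    rw [e] at hu'
    refine h.eq_zero_of_forall fun g => ?_
    have hle := le_adjoint_of_symm h.dense h.symm
    rw [← h.green, sub_eq_zero]
    refine tendsto_nhds_unique (hu'.inner tendsto_const_nhds) ?_
    refine (hu.inner (tendsto_const_nhds (x := T† g))).congr fun n => ?_
    rw [← inner_conj_symm, inner_adjoint_apply h.dense, inner_conj_symm]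
  · rintro ⟨h1, h2⟩
    refine mem_closure_of_forall_inner h.dense hc (z := T† f) fun y => ?_
    have := h.green y f
    rwa [h1, h2, mul_zero, mul_zero, sub_zero, sub_eq_zero] at this

theorem le_domRestrict (h : IsBoundaryPair T a b) {D : Submodule ℂ E} (p q : ℂ)
    (hD : ∀ f : T†.domain, (f : E) ∈ D ↔ p * a f + q * b f = 0) : T ≤ T†.domRestrict D := by
  have hle := le_adjoint_of_symm h.dense h.symm
  refine ⟨fun x hx => ⟨?_, hle.1 hx⟩, fun x y hxy => ?_⟩
  · have := (h.mem_closure_domain_iff ⟨x, hle.1 hx⟩).1 (T.le_closure.1 hx)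
    refine (hD ⟨x, hle.1 hx⟩).2 ?_
    rw [this.1, this.2]
    simp
  · rw [domRestrict_apply_mk]
    exact hle.2 hxy

/-- The restriction of the adjoint to a real boundary condition is self-adjoint. -/
theorem isSelfAdjoint_domRestrict (h : IsBoundaryPair T a b) {D : Submodule ℂ E} (p q : ℝ)
    (hpq : p ≠ 0 ∨ q ≠ 0) (hD : ∀ f : T†.domain, (f : E) ∈ D ↔ p * a f + q * b f = 0) :
    IsSelfAdjoint (T†.domRestrict D) := by
  have hTS := h.le_domRestrict _ _ hD
  have hS : Dense ((T†.domRestrict D).domain : Set E) := h.dense.mono hTS.1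
  rw [isSelfAdjoint_def]
  refine le_antisymm ?_ ?_
  · have hle := adjoint_anti h.dense hTS
    refine ⟨fun y hy => ⟨?_, hle.1 hy⟩, fun x y hxy => ?_⟩
    · have hy' := hle.1 hy
      -- A single test vector suffices: its boundary values span the line that defines `D`.
      obtain ⟨x, hx1, hx2⟩ := h.surj (-q) p
      have hxD : (x : E) ∈ D := (hD x).2 (by rw [hx1, hx2]; ring)
      have e1 := inner_adjoint_apply hS ⟨y, hy⟩ ⟨x, hxD, x.2⟩
      rw [domRestrict_apply_mk, hle.2 (y := ⟨y, hy'⟩) rfl] at e1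
      have e2 := h.green ⟨y, hy'⟩ x
      rw [e1, sub_self, hx1, hx2] at e2
      refine (hD ⟨y, hy'⟩).2 ?_
      exact eq_zero_of_conj_form e2.symm
    · rw [domRestrict_apply_mk]
      exact hle.2 hxy
  · refine IsFormalAdjoint.le_adjoint hS fun x y => ?_
    rw [domRestrict_apply_mk, domRestrict_apply_mk]
    obtain ⟨x, hxD, hxT⟩ := x
    obtain ⟨y, hyD, hyT⟩ := y
    have hx := (hD ⟨x, hxT⟩).1 hxD
    have hy := (hD ⟨y, hyT⟩).1 hyD
    have e2 := h.green ⟨x, hxT⟩ ⟨y, hyT⟩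
    rw [← sub_eq_zero, e2]
    exact conj_form_eq_zero hpq hx hy

/-- Self-adjoint operators are maximal, because taking adjoints reverses the inclusion. In the
classification it is therefore enough to prove one inclusion. -/
theorem eq_of_le_of_isSelfAdjoint {A B : E →ₗ.[ℂ] E} (hA : IsSelfAdjoint A) (hB : IsSelfAdjoint B)
    (hAB : A ≤ B) : A = B := by
  refine le_antisymm hAB ?_
  have := adjoint_anti hA.dense_domain hAB
  rwa [isSelfAdjoint_def.1 hA, isSelfAdjoint_def.1 hB] at this

theorem le_adjoint_of_isSelfAdjoint (h : IsBoundaryPair T a b) {B : E →ₗ.[ℂ] E} (hTB : T ≤ B)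
    (hB : IsSelfAdjoint B) : B ≤ T† := by
  have := adjoint_anti h.dense hTB
  rwa [isSelfAdjoint_def.1 hB] at this

theorem eq_domRestrict_of_forall (h : IsBoundaryPair T a b) {B : E →ₗ.[ℂ] E} (hTB : T ≤ B)
    (hB : IsSelfAdjoint B) {D : Submodule ℂ E} (p q : ℝ) (hpq : p ≠ 0 ∨ q ≠ 0)
    (hD : ∀ f : T†.domain, (f : E) ∈ D ↔ p * a f + q * b f = 0)
    (hBD : ∀ f : T†.domain, (f : E) ∈ B.domain → p * a f + q * b f = 0) :
    B = T†.domRestrict D := by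
  have hle := h.le_adjoint_of_isSelfAdjoint hTB hB
  refine eq_of_le_of_isSelfAdjoint hB (h.isSelfAdjoint_domRestrict p q hpq hD)
    ⟨fun x hx => ⟨(hD ⟨x, hle.1 hx⟩).2 (hBD ⟨x, hle.1 hx⟩ hx), hle.1 hx⟩, fun x y hxy => ?_⟩
  rw [domRestrict_apply_mk]
  exact hle.2 hxy

/-- Every self-adjoint extension satisfies `a = 0` or a condition `b = t a` with real `t`. -/
theorem boundary_condition_of_isSelfAdjoint (h : IsBoundaryPair T a b) {B : E →ₗ.[ℂ] E}
    (hTB : T ≤ B) (hB : IsSelfAdjoint B) :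
    (∀ f : T†.domain, (f : E) ∈ B.domain → a f = 0) ∨
      ∃ t : ℝ, ∀ f : T†.domain, (f : E) ∈ B.domain → b f = t * a f := by
  have hle := h.le_adjoint_of_isSelfAdjoint hTB hB
  have key : ∀ f g : T†.domain, (f : E) ∈ B.domain → (g : E) ∈ B.domain →
      conj (b f) * a g - conj (a f) * b g = 0 := by
    intro f g hf hg
    rw [← h.green, ← hle.2 (x := ⟨f, hf⟩) rfl, ← hle.2 (x := ⟨g, hg⟩) rfl, sub_eq_zero]
    have hfa : B.IsFormalAdjoint B := by
      have := adjoint_isFormalAdjoint hB.dense_domain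
      rwa [isSelfAdjoint_def.1 hB] at this
    exact hfa ⟨f, hf⟩ ⟨g, hg⟩
  by_cases h0 : ∀ f : T†.domain, (f : E) ∈ B.domain → a f = 0
  · exact Or.inl h0
  · push Not at h0
    obtain ⟨f, hf, hf0⟩ := h0
    have e1 := key f f hf hf
    have hc : conj (a f) ≠ 0 := by simpa using hf0
    -- The boundary form of f with itself vanishes, so the ratio b/a is real; pairing f with any
    -- other g then shows that g has the same ratio.
    have e3 : conj (b f / a f) = b f / a f := by
      rw [map_div₀, div_eq_div_iff hc hf0]
      linear_combination e1
    refine Or.inr ⟨(b f / a f).re, fun g hg => ?_⟩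
    rw [Complex.conj_eq_iff_re.1 e3, ← e3, map_div₀, div_mul_eq_mul_div, eq_div_iff hc]
    linear_combination -(key f g hf hg)

end IsBoundaryPair

end LinearPMap

/-! ### The form norm and the Friedrichs extension. -/

namespace LinearPMap

variable {E : Type*} [NormedAddCommGroup E] [InnerProductSpace ℂ E] {A : E →ₗ.[ℂ] E}

theorem tendsto_fst_atTop : Tendsto (Prod.fst : ℕ × ℕ → ℕ) atTop atTop := by
  rw [← prod_atTop_atTop_eq]; exact tendsto_fst

theorem tendsto_snd_atTop : Tendsto (Prod.snd : ℕ × ℕ → ℕ) atTop atTop := by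
  rw [← prod_atTop_atTop_eq]; exact tendsto_snd

/-- Nonnegativity of the form at x + y and at x - y; this serves as the Cauchy-Schwarz inequality
for the form. -/
theorem two_mul_abs_re_inner_le (hA : A.IsNonnegSymm) (x y : A.domain) :
    2 * |(inner ℂ (x : E) (A y)).re| ≤ A.quadForm x + A.quadForm y := by
  have h1 := hA.nonneg (x - y)
  have h2 := hA.nonneg (x + y)
  have h3 : (inner ℂ (y : E) (A x)).re = (inner ℂ (x : E) (A y)).re := by
    rw [← hA.symm, ← inner_conj_symm, Complex.conj_re]
  simp only [quadForm, LinearPMap.map_add, LinearPMap.map_sub, Submodule.coe_add,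
    AddSubgroupClass.coe_sub, inner_add_left, inner_add_right, inner_sub_left, inner_sub_right,
    Complex.add_re, Complex.sub_re, h3] at h1 h2 ⊢
  rcases abs_cases (inner ℂ (x : E) (A y)).re with h | h <;> linarith

/-- Along a sequence converging in the graph norm, both entries of ⟨u_m - u_n, A(u_m - u_n)⟩ tend to
zero. -/
theorem closure_domain_le_formDomain (hA : A.IsNonnegSymm) (hc : A.IsClosable) :
    A.closure.domain ≤ A.formDomain hA := by
  intro x hx
  obtain ⟨u, hu, hu'⟩ := exists_seq_of_mem_closure hc ⟨x, hx⟩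
  refine ⟨u, hu, ?_⟩
  have h1 : Tendsto (fun p : ℕ × ℕ => ((u p.1 : E) - u p.2)) atTop (𝓝 (x - x)) :=
    (hu.comp tendsto_fst_atTop).sub (hu.comp tendsto_snd_atTop)
  have h2 : Tendsto (fun p : ℕ × ℕ => A (u p.1) - A (u p.2)) atTop
      (𝓝 (A.closure ⟨x, hx⟩ - A.closure ⟨x, hx⟩)) :=
    (hu'.comp tendsto_fst_atTop).sub (hu'.comp tendsto_snd_atTop)
  have h3 := (Complex.continuous_re.tendsto _).comp (h1.inner h2)
  simp only [sub_self, inner_zero_left, Complex.zero_re] at h3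
  refine h3.congr fun p => ?_
  rw [quadForm, LinearPMap.map_sub]
  rfl

theorem domain_le_formDomain (hA : A.IsNonnegSymm) : A.domain ≤ A.formDomain hA := fun x hx =>
  ⟨fun _ => ⟨x, hx⟩, tendsto_const_nhds, by simp [quadForm]⟩

variable [CompleteSpace E]

/-- The quantity is the form of y - u_n, although y need not lie in the domain of A. Replacing y by
u_l in the first slot, moving the operator onto u_l - u_n and then replacing the remaining y by u_m
turns it into a mixed form of u_l - u_n and u_m - u_n, which is small uniformly in l and m. -/
theorem tendsto_re_inner_sub (hA : A.IsNonnegSymm) (hd : Dense (A.domain : Set E)) (y : A†.domain)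
    {u : ℕ → A.domain} (hu : Tendsto (fun n => (u n : E)) atTop (𝓝 (y : E)))
    (hq : Tendsto (fun p : ℕ × ℕ => A.quadForm (u p.1 - u p.2)) atTop (𝓝 0)) :
    Tendsto (fun n => (inner ℂ ((y : E) - u n) (A† y - A (u n))).re) atTop (𝓝 0) := by
  rw [Metric.tendsto_atTop]
  intro ε hε
  obtain ⟨⟨N, M⟩, hN⟩ := (Metric.tendsto_atTop.1 hq) (ε / 2) (by positivity)
  have hN' : ∀ n m, max N M ≤ n → max N M ≤ m → A.quadForm (u n - u m) ≤ ε / 2 := by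
    intro n m hn hm
    have := hN (n, m) ⟨(le_max_left N M).trans hn, (le_max_right N M).trans hm⟩
    rw [Real.dist_eq, sub_zero] at this
    exact (le_abs_self _).trans this.le
  refine ⟨max N M, fun n hn => ?_⟩
  rw [Real.dist_eq, sub_zero]
  refine lt_of_le_of_lt (b := ε / 2) ?_ (by linarith)
  have t1 : Tendsto (fun l => |(inner ℂ ((u l : E) - u n) (A† y - A (u n))).re|) atTop
      (𝓝 |(inner ℂ ((y : E) - u n) (A† y - A (u n))).re|) :=
    (Complex.continuous_re.abs.tendsto _).comp ((hu.sub tendsto_const_nhds).inner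
      tendsto_const_nhds)
  refine le_of_tendsto t1 ?_
  filter_upwards [eventually_ge_atTop (max N M)] with l hl
  have e1 : inner ℂ ((u l : E) - u n) (A† y - A (u n)) =
      inner ℂ (A (u l - u n)) ((y : E) - u n) := by
    have h1 := inner_adjoint_apply hd y (u l - u n)
    have h2 := hA.symm (u l - u n) (u n)
    rw [inner_sub_right, inner_sub_right, h2, ← inner_conj_symm (A _) (y : E), ← h1,
      inner_conj_symm]
    rfl
  rw [e1]
  have t2 : Tendsto (fun m => |(inner ℂ (A (u l - u n)) ((u m : E) - u n)).re|) atTop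
      (𝓝 |(inner ℂ (A (u l - u n)) ((y : E) - u n)).re|) :=
    (Complex.continuous_re.abs.tendsto _).comp (tendsto_const_nhds.inner
      (hu.sub tendsto_const_nhds))
  refine le_of_tendsto t2 ?_
  filter_upwards [eventually_ge_atTop (max N M)] with m hm
  have h4 := two_mul_abs_re_inner_le hA (u m - u n) (u l - u n)
  have h5 : inner ℂ (A (u l - u n)) ((u m : E) - u n) =
      inner ℂ (A (u l - u n)) ((u m - u n : A.domain) : E) := rfl
  rw [h5, ← inner_conj_symm, Complex.conj_re]
  linarith [hN' m n hm hn, hN' l n hl hn]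

/-- Expanding the form of y - u_n from `tendsto_re_inner_sub` shows that ⟨u_n, A u_n⟩ converges to
⟨y, A†y⟩. -/
theorem re_inner_adjoint_nonneg (hA : A.IsNonnegSymm) (hd : Dense (A.domain : Set E))
    (y : A†.domain) (hy : (y : E) ∈ A.formDomain hA) :
    0 ≤ (inner ℂ (y : E) (A† y)).re := by
  obtain ⟨u, hu, hq⟩ := hy
  have h1 := tendsto_re_inner_sub hA hd y hu hq
  have h2 : Tendsto (fun n => (inner ℂ (u n : E) (A† y)).re) atTop
      (𝓝 (inner ℂ (y : E) (A† y)).re) :=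
    (Complex.continuous_re.tendsto _).comp (hu.inner tendsto_const_nhds)
  have h3 : Tendsto (fun n => A.quadForm (u n)) atTop (𝓝 (inner ℂ (y : E) (A† y)).re) := by
    have := (h1.sub tendsto_const_nhds).add (h2.const_mul 2)
      (f := fun n => (inner ℂ ((y : E) - u n) (A† y - A (u n))).re - (inner ℂ (y : E) (A† y)).re)
    rw [zero_sub] at this
    convert this using 1
    · ext n
      have e : (inner ℂ (y : E) (A (u n))).re = (inner ℂ (u n : E) (A† y)).re := by
        rw [← inner_adjoint_apply hd, ← inner_conj_symm, Complex.conj_re]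
      simp only [quadForm, inner_sub_left, inner_sub_right, Complex.sub_re, e]
      ring
    · congr 1
      ring
  exact ge_of_tendsto' h3 fun n => hA.nonneg _

theorem friedrichs_le_adjoint (hA : A.IsNonnegSymm) : A.friedrichs hA ≤ A† := domRestrict_le

theorem le_friedrichs (hA : A.IsNonnegSymm) (hd : Dense (A.domain : Set E)) :
    A ≤ A.friedrichs hA := by
  have hle := le_adjoint_of_symm hd hA.symm
  refine ⟨fun x hx => ⟨domain_le_formDomain hA hx, hle.1 hx⟩, fun x y hxy => ?_⟩
  exact (hle.2 (y := ⟨y, y.2.2⟩) hxy).trans (domRestrict_apply rfl).symm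

theorem friedrichs_isNonnegSymm (hA : A.IsNonnegSymm) (hd : Dense (A.domain : Set E))
    (hs : IsSelfAdjoint (A.friedrichs hA)) : (A.friedrichs hA).IsNonnegSymm where
  symm := by
    have := adjoint_isFormalAdjoint (hd.mono (le_friedrichs hA hd).1)
    rwa [isSelfAdjoint_def.1 hs] at this
  nonneg x := by
    have h := re_inner_adjoint_nonneg hA hd ⟨x, x.2.2⟩ x.2.1
    rwa [← (friedrichs_le_adjoint hA).2 (x := x) rfl] at h

/-- Closing the form twice gives nothing new: each vector of the Friedrichs domain is within
1/(n+1), in norm and in form, of a vector of the original domain, so an approximating sequence can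
be replaced term by term. -/
theorem formDomain_friedrichs (hA : A.IsNonnegSymm) (hd : Dense (A.domain : Set E))
    (hF : (A.friedrichs hA).IsNonnegSymm) :
    (A.friedrichs hA).formDomain hF = A.formDomain hA := by
  have hle := le_friedrichs hA hd
  refine le_antisymm ?_ ?_
  · rintro u ⟨x, hx, hq⟩
    have key : ∀ n, ∃ w : A.domain, dist (w : E) (x n) < 1 / ((n : ℝ) + 1) ∧
        (A.friedrichs hA).quadForm (x n - ⟨w, hle.1 w.2⟩) < 1 / ((n : ℝ) + 1) := by
      intro n
      have hpos : (0 : ℝ) < 1 / ((n : ℝ) + 1) := by positivity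
      have hx2 : (x n : E) ∈ A†.domain := (x n).2.2
      obtain ⟨w, hw, hw'⟩ := (x n).2.1
      have h1 := tendsto_re_inner_sub hA hd ⟨x n, hx2⟩ hw hw'
      obtain ⟨m, hm, hm'⟩ := ((Metric.tendsto_nhds.1 hw _ hpos).and
        (h1.eventually (gt_mem_nhds hpos))).exists
      refine ⟨w m, hm, ?_⟩
      have e1 : (A.friedrichs hA) (x n) = A† ⟨x n, hx2⟩ :=
        (friedrichs_le_adjoint hA).2 rfl
      have e2 : (A.friedrichs hA) ⟨w m, hle.1 (w m).2⟩ = A (w m) := (hle.2 rfl).symm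
      rw [quadForm, LinearPMap.map_sub, e1, e2]
      exact hm'
    choose w hw hw' using key
    have hz : Tendsto (fun n : ℕ => 1 / ((n : ℝ) + 1)) atTop (𝓝 0) :=
      tendsto_one_div_add_atTop_nhds_zero_nat
    refine ⟨w, ?_, ?_⟩
    · refine (tendsto_iff_of_dist (f₂ := fun n => (x n : E)) ?_).2 hx
      exact squeeze_zero (fun _ => dist_nonneg) (fun n => (hw n).le) hz
    · have hb : ∀ p : ℕ × ℕ, A.quadForm (w p.1 - w p.2) ≤
          2 * (2 * (1 / ((p.1 : ℝ) + 1)) + 2 * (1 / ((p.2 : ℝ) + 1))) +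
            2 * (A.friedrichs hA).quadForm (x p.1 - x p.2) := by
        intro p
        let v : ℕ → (A.friedrichs hA).domain := fun n => ⟨w n, hle.1 (w n).2⟩
        have e1 : A.quadForm (w p.1 - w p.2) = (A.friedrichs hA).quadForm (v p.1 - v p.2) := by
          rw [quadForm, quadForm, hle.2 (x := w p.1 - w p.2) (y := v p.1 - v p.2) rfl]
          rfl
        -- The first difference carries the scalar -1 so that only `quadForm_smul` and two uses of
        -- the parallelogram bound are needed; these produce the constants in `hb`.
        have e2 : v p.1 - v p.2 = ((-1 : ℂ) • (x p.1 - v p.1) + (x p.2 - v p.2)) +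
            (x p.1 - x p.2) := by
          rw [neg_one_smul]; abel
        rw [e1, e2]
        refine (quadForm_add_le hF _ _).trans ?_
        have h1 := quadForm_add_le hF ((-1 : ℂ) • (x p.1 - v p.1)) (x p.2 - v p.2)
        rw [quadForm_smul] at h1
        simp only [norm_neg, norm_one, one_pow, one_mul] at h1
        have h2 := hw' p.1
        have h3 := hw' p.2
        change (A.friedrichs hA).quadForm (x p.1 - v p.1) < _ at h2
        change (A.friedrichs hA).quadForm (x p.2 - v p.2) < _ at h3
        linarith
      refine squeeze_zero (fun p => hA.nonneg _) hb ?_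
      have := ((((hz.comp tendsto_fst_atTop).const_mul 2).add
        ((hz.comp tendsto_snd_atTop).const_mul 2)).const_mul 2).add (hq.const_mul 2)
        (f := fun p : ℕ × ℕ => 2 * (2 * (1 / ((p.1 : ℝ) + 1)) + 2 * (1 / ((p.2 : ℝ) + 1))))
      simpa using this
  · rintro u ⟨x, hx, hq⟩
    refine ⟨fun n => ⟨x n, hle.1 (x n).2⟩, hx, hq.congr fun p => ?_⟩
    rw [quadForm, quadForm, hle.2 (x := x p.1 - x p.2)
      (y := ⟨x p.1, hle.1 (x p.1).2⟩ - ⟨x p.2, hle.1 (x p.2).2⟩) rfl]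
    rfl

end LinearPMap

namespace HalfLine

/-! ### The fundamental system of the differential equation -/

/-- The exponent `|k| x^(1+α) / (1+α)`. -/
def phase (α : ℝ) (k : ℤ) (x : ℝ) : ℝ := |(k : ℝ)| / (1 + α) * x ^ (1 + α)

/-- The solution `x^(-α/2) exp (-phase)` of the homogeneous equation, decaying at infinity. -/
def recSol (α : ℝ) (k : ℤ) (x : ℝ) : ℝ := x ^ (-α / 2) * Real.exp (-phase α k x)

/-- The solution `x^(-α/2) sinh (phase) / |k|` of the homogeneous equation, small at the origin. -/
def domSol (α : ℝ) (k : ℤ) (x : ℝ) : ℝ := x ^ (-α / 2) * Real.sinh (phase α k x) / |(k : ℝ)|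

/-- The derivative of `recSol`. -/
def recSolDeriv (α : ℝ) (k : ℤ) (x : ℝ) : ℝ := -(α / 2 * x⁻¹ + |(k : ℝ)| * x ^ α) * recSol α k x

/-- The derivative of `domSol`. -/
def domSolDeriv (α : ℝ) (k : ℤ) (x : ℝ) : ℝ :=
  x ^ (-α / 2) * x ^ α * Real.cosh (phase α k x) - α / 2 * x⁻¹ * domSol α k x

variable {α : ℝ} {k : ℤ} {x : ℝ}

/-- The derivative is written with x⁻¹ and the original power so that later identities stay rational
in x⁻¹ and a fixed set of powers. -/
theorem hasDerivAt_rpow_mul_inv (p : ℝ) (hx : 0 < x) :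
    HasDerivAt (fun y : ℝ => y ^ p) (p * x⁻¹ * x ^ p) x := by
  convert Real.hasDerivAt_rpow_const (p := p) (Or.inl hx.ne') using 1
  rw [Real.rpow_sub_one hx.ne']
  ring

theorem hasDerivAt_phase (hα0 : 0 ≤ α) (hx : 0 < x) :
    HasDerivAt (phase α k) (|(k : ℝ)| * x ^ α) x := by
  have h := (Real.hasDerivAt_rpow_const (p := 1 + α) (Or.inl hx.ne')).const_mul (|(k : ℝ)| / (1 + α))
  refine h.congr_deriv ?_
  have : 1 + α ≠ 0 := by positivity
  rw [add_sub_cancel_left]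
  field_simp

theorem hasDerivAt_recSol (hα0 : 0 ≤ α) (hx : 0 < x) :
    HasDerivAt (recSol α k) (recSolDeriv α k x) x := by
  have h := (hasDerivAt_rpow_mul_inv (-α / 2) hx).mul (hasDerivAt_phase (k := k) hα0 hx).neg.exp
  refine h.congr_deriv ?_
  simp only [recSolDeriv, recSol, Pi.neg_apply]
  ring

theorem hasDerivAt_domSol (hα0 : 0 ≤ α) (hk : k ≠ 0) (hx : 0 < x) :
    HasDerivAt (domSol α k) (domSolDeriv α k x) x := by
  have h := ((hasDerivAt_rpow_mul_inv (-α / 2) hx).mul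
    (hasDerivAt_phase (k := k) hα0 hx).sinh).div_const |(k : ℝ)|
  refine h.congr_deriv ?_
  have : |(k : ℝ)| ≠ 0 := by simpa using hk
  simp only [domSolDeriv, domSol]
  field_simp
  ring

theorem rpow_two_mul (hx : 0 < x) : x ^ (2 * α) = x ^ α * x ^ α := by
  rw [two_mul, Real.rpow_add hx]

/-- With w = α/(2x) + |k| x^α the logarithmic derivative is -w, and V = w² - w'. This Riccati
identity is what singles out the coupling α(2+α)/4. -/
theorem hasDerivAt_recSolDeriv (hα0 : 0 ≤ α) (hx : 0 < x) :
    HasDerivAt (recSolDeriv α k) (potential α k x * recSol α k x) x := by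
  have h := ((((hasDerivAt_inv hx.ne').const_mul (α / 2)).add
    ((hasDerivAt_rpow_mul_inv α hx).const_mul |(k : ℝ)|)).neg).mul (hasDerivAt_recSol (k := k) hα0 hx)
  refine h.congr_deriv ?_
  simp only [recSolDeriv, potential, Pi.neg_apply, Pi.add_apply]
  rw [rpow_two_mul hx, ← sq_abs (k : ℝ)]
  field_simp
  ring

theorem hasDerivAt_domSolDeriv (hα0 : 0 ≤ α) (hk : k ≠ 0) (hx : 0 < x) :
    HasDerivAt (domSolDeriv α k) (potential α k x * domSol α k x) x := by
  have h := (((hasDerivAt_rpow_mul_inv (-α / 2) hx).mul (hasDerivAt_rpow_mul_inv α hx)).mul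
    (hasDerivAt_phase (k := k) hα0 hx).cosh).sub
    (((hasDerivAt_inv hx.ne').const_mul (α / 2)).mul (hasDerivAt_domSol hα0 hk hx))
  refine h.congr_deriv ?_
  have : |(k : ℝ)| ≠ 0 := by simpa using hk
  simp only [domSolDeriv, domSol, potential, Pi.mul_apply]
  rw [rpow_two_mul hx, ← sq_abs (k : ℝ)]
  field_simp
  ring

/-- The powers of x cancel, since -α/2 - α/2 + α = 0, and exp(-s)(cosh s + sinh s) = 1. -/
theorem wronskian (hk : k ≠ 0) (hx : 0 < x) :
    recSol α k x * domSolDeriv α k x - recSolDeriv α k x * domSol α k x = 1 := by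
  have h0 : |(k : ℝ)| ≠ 0 := by simpa using hk
  have h1 : x ^ (-α / 2) * x ^ (-α / 2) * x ^ α = 1 := by
    rw [← Real.rpow_add hx, ← Real.rpow_add hx, show -α / 2 + -α / 2 + α = 0 by ring,
      Real.rpow_zero]
  have h2 : Real.exp (-phase α k x) * (Real.cosh (phase α k x) + Real.sinh (phase α k x)) = 1 := by
    rw [Real.cosh_add_sinh, ← Real.exp_add, neg_add_cancel, Real.exp_zero]
  have h3 : |(k : ℝ)| * |(k : ℝ)|⁻¹ = 1 := mul_inv_cancel₀ h0
  simp only [domSolDeriv, recSolDeriv, recSol, domSol]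
  linear_combination (Real.exp (-phase α k x) * (Real.cosh (phase α k x) +
    Real.sinh (phase α k x))) * h1 + h2 + x ^ (-α / 2) * x ^ (-α / 2) * x ^ α *
    Real.exp (-phase α k x) * Real.sinh (phase α k x) * h3

theorem contDiffOn_rpow (p : ℝ) : ContDiffOn ℝ ∞ (fun y : ℝ => y ^ p) (Ioi 0) := fun _ hy =>
  (Real.contDiffAt_rpow_const_of_ne (ne_of_gt hy)).contDiffWithinAt

theorem contDiffOn_phase : ContDiffOn ℝ ∞ (phase α k) (Ioi 0) :=
  contDiffOn_const.mul (contDiffOn_rpow _)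

theorem contDiffOn_recSol : ContDiffOn ℝ ∞ (recSol α k) (Ioi 0) :=
  (contDiffOn_rpow _).mul contDiffOn_phase.neg.exp

theorem contDiffOn_domSol : ContDiffOn ℝ ∞ (domSol α k) (Ioi 0) :=
  ((contDiffOn_rpow _).mul (Real.contDiff_sinh.comp_contDiffOn contDiffOn_phase)).div_const _

theorem continuousOn_recSol : ContinuousOn (recSol α k) (Ioi 0) := contDiffOn_recSol.continuousOn

theorem continuousOn_domSol : ContinuousOn (domSol α k) (Ioi 0) := contDiffOn_domSol.continuousOn

/-! ### Bounds -/

theorem phase_nonneg (hα0 : 0 ≤ α) (hx : 0 < x) : 0 ≤ phase α k x := by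
  unfold phase; positivity

theorem phase_mono (hα0 : 0 ≤ α) {y : ℝ} (hx : 0 < x) (hxy : x ≤ y) :
    phase α k x ≤ phase α k y := by
  unfold phase; gcongr

theorem recSol_pos (hx : 0 < x) : 0 < recSol α k x := by
  unfold recSol; positivity

theorem recSol_le (hα0 : 0 ≤ α) (hx : 0 < x) : recSol α k x ≤ x ^ (-α / 2) := by
  unfold recSol
  refine mul_le_of_le_one_right (by positivity) ?_
  rw [Real.exp_le_one_iff]
  linarith [phase_nonneg (k := k) hα0 hx]

theorem domSol_nonneg (hα0 : 0 ≤ α) (hx : 0 < x) : 0 ≤ domSol α k x := by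
  have := Real.sinh_nonneg_iff.2 (phase_nonneg (k := k) hα0 hx)
  unfold domSol; positivity

/-- The first-order term in the phase: this is where the exponent 1 + α/2 comes from. -/
theorem rpow_neg_half_mul_phase (hx : 0 < x) :
    x ^ (-α / 2) * phase α k x = |(k : ℝ)| / (1 + α) * x ^ (1 + α / 2) := by
  rw [phase, mul_left_comm, ← Real.rpow_add hx]
  ring_nf

/-- Writing 2 sinh s = exp(s)(1 - exp(-2s)) reduces this to 1 + t ≤ exp(t) at t = -2s. -/
theorem sinh_le_mul_exp (s : ℝ) : Real.sinh s ≤ s * Real.exp s := by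
  rw [Real.sinh_eq]
  have h1 := Real.add_one_le_exp (-(2 * s))
  have h2 : Real.exp (-s) = Real.exp (-(2 * s)) * Real.exp s := by
    rw [← Real.exp_add]; ring_nf
  rw [h2]
  nlinarith [Real.exp_pos s]

theorem domSol_le (hα0 : 0 ≤ α) (hk : k ≠ 0) (hx : 0 < x) :
    domSol α k x ≤ x ^ (1 + α / 2) * Real.exp (phase α k x) := by
  have h0 : 0 < |(k : ℝ)| := by simpa using hk
  rw [domSol, div_le_iff₀ h0]
  calc x ^ (-α / 2) * Real.sinh (phase α k x)
      ≤ x ^ (-α / 2) * (phase α k x * Real.exp (phase α k x)) := by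
        gcongr; exact sinh_le_mul_exp _
    _ = |(k : ℝ)| / (1 + α) * x ^ (1 + α / 2) * Real.exp (phase α k x) := by
        rw [← mul_assoc, rpow_neg_half_mul_phase hx]
    _ ≤ |(k : ℝ)| * x ^ (1 + α / 2) * Real.exp (phase α k x) := by
        gcongr
        exact div_le_self h0.le (by linarith)
    _ = _ := by ring

/-- For large x this is sharper than `domSol_le`: the power is -α/2 instead of 1 + α/2. -/
theorem domSol_le_exp (hx : 0 < x) :
    domSol α k x ≤ x ^ (-α / 2) * Real.exp (phase α k x) / |(k : ℝ)| := by
  unfold domSol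
  gcongr
  rw [Real.sinh_eq]
  have h1 := Real.exp_pos (phase α k x)
  have h2 := Real.exp_pos (-phase α k x)
  linarith

theorem sq_recSol (hx : 0 < x) : recSol α k x ^ 2 = x ^ (-α) * Real.exp (-(2 * phase α k x)) := by
  rw [recSol, mul_pow, ← Real.rpow_natCast, ← Real.rpow_mul hx.le, ← Real.exp_nat_mul]
  congr 2 <;> push_cast <;> ring

/-- The square is x^(-α) exp(-2 phase): the exponential handles infinity, and α < 1 handles the
origin. Both homogeneous solutions are thus square-integrable near 0. -/
theorem integrableOn_sq_recSol (hα0 : 0 ≤ α) (hα1 : α < 1) (hk : k ≠ 0) :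
    IntegrableOn (fun x => recSol α k x ^ 2) (Ioi 0) := by
  have h0 : 0 < |(k : ℝ)| := by simpa using hk
  have h := integrableOn_rpow_mul_exp_neg_mul_rpow (s := -α) (p := 1 + α)
    (b := 2 * (|(k : ℝ)| / (1 + α))) (by linarith) (by linarith) (by positivity)
  refine h.congr_fun (fun x hx => ?_) measurableSet_Ioi
  simp only [sq_recSol hx, phase]
  ring_nf

theorem memLp_ofReal {f : ℝ → ℝ} {s : Set ℝ} (hs : MeasurableSet s) (hf : ContinuousOn f s)
    (hi : IntegrableOn (fun x => f x ^ 2) s) :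
    MemLp (fun x => (f x : ℂ)) 2 (volume.restrict s) := by
  have hm : AEStronglyMeasurable f (volume.restrict s) := hf.aestronglyMeasurable hs
  exact ((memLp_two_iff_integrable_sq hm).2 hi).ofReal

theorem memLp_recSol (hα0 : 0 ≤ α) (hα1 : α < 1) (hk : k ≠ 0) :
    MemLp (fun x => (recSol α k x : ℂ)) 2 leb :=
  memLp_ofReal measurableSet_Ioi continuousOn_recSol (integrableOn_sq_recSol hα0 hα1 hk)

theorem integral_sq_recSol_le (hα0 : 0 ≤ α) (hα1 : α < 1) (hk : k ≠ 0) (hx : 0 < x) :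
    ∫ y in Ioc 0 x, recSol α k y ^ 2 ≤ x ^ (1 - α) / (1 - α) := by
  have h1 : IntervalIntegrable (fun y : ℝ => y ^ (-α)) volume 0 x :=
    intervalIntegral.intervalIntegrable_rpow' (by linarith)
  have h2 : ∫ y in Ioc 0 x, y ^ (-α) = x ^ (1 - α) / (1 - α) := by
    rw [← intervalIntegral.integral_of_le hx.le, integral_rpow (Or.inl (by linarith)),
      Real.zero_rpow (by linarith)]
    ring_nf
  rw [← h2]
  refine setIntegral_mono_on ((integrableOn_sq_recSol hα0 hα1 hk).mono_set Ioc_subset_Ioi_self)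
    ((intervalIntegrable_iff_integrableOn_Ioc_of_le hx.le).1 h1) measurableSet_Ioc fun y hy => ?_
  rw [sq_recSol hy.1]
  refine mul_le_of_le_one_right (Real.rpow_nonneg hy.1.le _) ?_
  rw [Real.exp_le_one_iff]
  linarith [phase_nonneg (k := k) hα0 hy.1]

theorem sq_domSol_le (hα0 : 0 ≤ α) (hk : k ≠ 0) {y : ℝ} (hx : 0 < x) (hxy : x ≤ y) :
    domSol α k x ^ 2 ≤ Real.exp (2 * phase α k y) * x ^ (2 + α) := by
  have h1 := domSol_le hα0 hk hx
  have h2 := pow_le_pow_left₀ (domSol_nonneg hα0 hx) h1 2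
  refine h2.trans ?_
  have h3 : (x ^ (1 + α / 2)) ^ 2 = x ^ (2 + α) := by
    rw [← Real.rpow_natCast, ← Real.rpow_mul hx.le]
    push_cast
    ring_nf
  rw [mul_pow, h3, ← Real.exp_nat_mul, mul_comm]
  push_cast
  gcongr
  exact phase_mono hα0 hx hxy

theorem integrableOn_sq_domSol (hα0 : 0 ≤ α) (hk : k ≠ 0) (hx : 0 < x) :
    IntegrableOn (fun x => domSol α k x ^ 2) (Ioc 0 x) := by
  have h1 : IntervalIntegrable (fun y : ℝ => y ^ (2 + α)) volume 0 x :=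
    intervalIntegral.intervalIntegrable_rpow' (by linarith)
  have h2 := ((intervalIntegrable_iff_integrableOn_Ioc_of_le hx.le).1 h1).const_mul
    (Real.exp (2 * phase α k x))
  refine Integrable.mono' h2 ?_ ?_
  · exact ((continuousOn_domSol.pow 2).mono Ioc_subset_Ioi_self).aestronglyMeasurable
      measurableSet_Ioc
  · refine (ae_restrict_mem measurableSet_Ioc).mono fun y hy => ?_
    rw [Real.norm_of_nonneg (sq_nonneg _)]
    exact sq_domSol_le hα0 hk hy.1 hy.2

theorem memLp_domSol (hα0 : 0 ≤ α) (hk : k ≠ 0) (hx : 0 < x) :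
    MemLp (fun x => (domSol α k x : ℂ)) 2 (volume.restrict (Ioc 0 x)) :=
  memLp_ofReal measurableSet_Ioc (continuousOn_domSol.mono Ioc_subset_Ioi_self)
    (integrableOn_sq_domSol hα0 hk hx)

theorem integral_sq_domSol_le (hα0 : 0 ≤ α) (hk : k ≠ 0) (hx : 0 < x) :
    ∫ y in Ioc 0 x, domSol α k y ^ 2 ≤ Real.exp (2 * phase α k x) * x ^ (3 + α) := by
  have h1 : IntervalIntegrable (fun y : ℝ => y ^ (2 + α)) volume 0 x :=
    intervalIntegral.intervalIntegrable_rpow' (by linarith)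
  have h2 : ∫ y in Ioc 0 x, y ^ (2 + α) = x ^ (3 + α) / (3 + α) := by
    rw [← intervalIntegral.integral_of_le hx.le, integral_rpow (Or.inl (by linarith)),
      Real.zero_rpow (by linarith)]
    ring_nf
  calc ∫ y in Ioc 0 x, domSol α k y ^ 2
      ≤ ∫ y in Ioc 0 x, Real.exp (2 * phase α k x) * y ^ (2 + α) :=
        setIntegral_mono_on (integrableOn_sq_domSol hα0 hk hx)
          (((intervalIntegrable_iff_integrableOn_Ioc_of_le hx.le).1 h1).const_mul _)
          measurableSet_Ioc fun y hy => sq_domSol_le hα0 hk hy.1 hy.2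
    _ = Real.exp (2 * phase α k x) * (x ^ (3 + α) / (3 + α)) := by
        rw [integral_const_mul, h2]
    _ ≤ _ := by
        gcongr
        exact div_le_self (by positivity) (by linarith)


/-! ### Growth and decay of the homogeneous solutions at infinity. -/

variable {α : ℝ} {k : ℤ} {x : ℝ}

theorem tendsto_phase_atTop (hα0 : 0 ≤ α) (hk : k ≠ 0) : Tendsto (phase α k) atTop atTop := by
  have h0 : 0 < |(k : ℝ)| := by simpa using hk
  exact (tendsto_rpow_atTop (by linarith)).const_mul_atTop (by positivity)

/-- The weight x^α makes exp(c phase) exactly integrable; for x ≥ 1 the weight x^(-α) in the squares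
of the solutions is enlarged to x^α for this purpose. -/
theorem hasDerivAt_exp_phase (hα0 : 0 ≤ α) (hk : k ≠ 0) (c : ℝ) (hc : c ≠ 0) (hx : 0 < x) :
    HasDerivAt (fun y => Real.exp (c * phase α k y) / (c * |(k : ℝ)|))
      (x ^ α * Real.exp (c * phase α k x)) x := by
  have h0 : |(k : ℝ)| ≠ 0 := by simpa using hk
  refine (((hasDerivAt_phase (k := k) hα0 hx).const_mul c).exp.div_const _).congr_deriv ?_
  field_simp

theorem rpow_neg_le_rpow (hα0 : 0 ≤ α) (hx : 1 ≤ x) : x ^ (-α) ≤ x ^ α :=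
  Real.rpow_le_rpow_of_exponent_le hx (by linarith)

theorem integral_sq_recSol_Ioi_le (hα0 : 0 ≤ α) (hα1 : α < 1) (hk : k ≠ 0) (hx : 1 ≤ x) :
    ∫ y in Ioi x, recSol α k y ^ 2 ≤ Real.exp (-2 * phase α k x) / (2 * |(k : ℝ)|) := by
  have h0 : 0 < |(k : ℝ)| := by simpa using hk
  have hd : ∀ y ∈ Ici x, HasDerivAt (fun y => Real.exp (-2 * phase α k y) / (-2 * |(k : ℝ)|))
      (y ^ α * Real.exp (-2 * phase α k y)) y := fun y hy =>
    hasDerivAt_exp_phase hα0 hk (-2) (by norm_num) (by linarith [mem_Ici.1 hy])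
  have hp : ∀ y ∈ Ioi x, 0 ≤ y ^ α * Real.exp (-2 * phase α k y) := by
    intro y hy
    have : 0 ≤ y := by linarith [mem_Ioi.1 hy]
    positivity
  have ht : Tendsto (fun y => Real.exp (-2 * phase α k y) / (-2 * |(k : ℝ)|)) atTop (𝓝 0) := by
    have := (Real.tendsto_exp_atBot.comp ((tendsto_phase_atTop hα0 hk).const_mul_atTop_of_neg
      (show (-2 : ℝ) < 0 by norm_num))).div_const (-2 * |(k : ℝ)|)
    simpa using this
  have h1 := integral_Ioi_of_hasDerivAt_of_nonneg' hd hp ht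
  have h2 := integrableOn_Ioi_deriv_of_nonneg' hd hp ht
  refine (setIntegral_mono_on ((integrableOn_sq_recSol hα0 hα1 hk).mono_set
    (Ioi_subset_Ioi (by linarith))) h2 measurableSet_Ioi fun y hy => ?_).trans (le_of_eq ?_)
  · have hy' : 1 ≤ y := by linarith [mem_Ioi.1 hy]
    rw [sq_recSol (by linarith), neg_mul]
    gcongr ?_ * _
    exact rpow_neg_le_rpow hα0 hy'
  · rw [h1]
    field_simp
    ring

theorem sq_domSol_le_exp (hα0 : 0 ≤ α) (hx : 1 ≤ x) :
    domSol α k x ^ 2 ≤ x ^ α * Real.exp (2 * phase α k x) / |(k : ℝ)| ^ 2 := by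
  have hx0 : 0 < x := by linarith
  have h2 := pow_le_pow_left₀ (domSol_nonneg (k := k) hα0 hx0) (domSol_le_exp hx0) 2
  refine h2.trans ?_
  rw [div_pow, mul_pow, ← Real.exp_nat_mul, ← Real.rpow_natCast (x ^ (-α / 2)),
    ← Real.rpow_mul hx0.le]
  push_cast
  rw [show -α / 2 * 2 = -α by ring]
  gcongr ?_ * _ / _
  exact rpow_neg_le_rpow hα0 hx

/-- The part over (0, 1] is a constant, absorbed because exp(2 phase) ≥ 1, and the part over (1, x]
is bounded by an exact integral. -/
theorem exists_integral_sq_domSol_le (hα0 : 0 ≤ α) (hk : k ≠ 0) :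
    ∃ C : ℝ, 0 ≤ C ∧ ∀ x, 1 ≤ x →
      ∫ y in Ioc 0 x, domSol α k y ^ 2 ≤ C * Real.exp (2 * phase α k x) := by
  have h0 : 0 < |(k : ℝ)| := by simpa using hk
  have hI : 0 ≤ ∫ y in Ioc 0 1, domSol α k y ^ 2 :=
    setIntegral_nonneg measurableSet_Ioc fun _ _ => sq_nonneg _
  refine ⟨(∫ y in Ioc 0 1, domSol α k y ^ 2) + 1 / (2 * |(k : ℝ)|) / |(k : ℝ)| ^ 2,
    by positivity, fun x hx => ?_⟩
  have hx0 : 0 < x := by linarith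
  have hi := integrableOn_sq_domSol hα0 hk hx0
  rw [← Ioc_union_Ioc_eq_Ioc zero_le_one hx, setIntegral_union (Ioc_disjoint_Ioc_of_le le_rfl)
    measurableSet_Ioc (hi.mono_set (Ioc_subset_Ioc_right hx))
    (hi.mono_set (Ioc_subset_Ioc_left zero_le_one)), add_mul]
  refine add_le_add (le_mul_of_one_le_right hI ?_) ?_
  · rw [Real.one_le_exp_iff]
    linarith [phase_nonneg (k := k) hα0 hx0]
  · have hd : ∀ y ∈ uIcc 1 x, HasDerivAt (fun y => Real.exp (2 * phase α k y) / (2 * |(k : ℝ)|))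
        (y ^ α * Real.exp (2 * phase α k y)) y := fun y hy =>
      hasDerivAt_exp_phase hα0 hk 2 (by norm_num) (by
        rw [uIcc_of_le hx] at hy; linarith [hy.1])
    have hc : ContinuousOn (fun y => y ^ α * Real.exp (2 * phase α k y)) (Icc 1 x) :=
      ((contDiffOn_rpow α).continuousOn.mul
        ((contDiffOn_phase.continuousOn.const_mul 2).rexp)).mono fun y hy => by
          have := hy.1; exact mem_Ioi.2 (by linarith)
    have hii : IntervalIntegrable (fun y => y ^ α * Real.exp (2 * phase α k y)) volume 1 x :=
      ContinuousOn.intervalIntegrable (by rwa [uIcc_of_le hx])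
    have h1 := intervalIntegral.integral_eq_sub_of_hasDerivAt hd hii
    rw [intervalIntegral.integral_of_le hx] at h1
    have hii' := (intervalIntegrable_iff_integrableOn_Ioc_of_le hx).1 hii
    calc ∫ y in Ioc 1 x, domSol α k y ^ 2
        ≤ ∫ y in Ioc 1 x, y ^ α * Real.exp (2 * phase α k y) / |(k : ℝ)| ^ 2 :=
          setIntegral_mono_on (hi.mono_set (Ioc_subset_Ioc_left zero_le_one))
            (hii'.div_const _) measurableSet_Ioc fun y hy => sq_domSol_le_exp hα0 hy.1.le
      _ = (Real.exp (2 * phase α k x) / (2 * |(k : ℝ)|) -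
            Real.exp (2 * phase α k 1) / (2 * |(k : ℝ)|)) / |(k : ℝ)| ^ 2 := by
          rw [integral_div, h1]
      _ ≤ (Real.exp (2 * phase α k x) / (2 * |(k : ℝ)|)) / |(k : ℝ)| ^ 2 := by
          gcongr
          exact sub_le_self _ (by positivity)
      _ = _ := by ring

/-! ### Cauchy-Schwarz -/

theorem norm_integral_mul_le {μ : Measure ℝ} {f g : ℝ → ℂ} (hf : MemLp f 2 μ) (hg : MemLp g 2 μ) :
    ‖∫ x, f x * g x ∂μ‖ ≤ √(∫ x, ‖f x‖ ^ 2 ∂μ) * √(∫ x, ‖g x‖ ^ 2 ∂μ) := by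
  have h := integral_mul_le_Lp_mul_Lq_of_nonneg (μ := μ) (f := fun x => ‖f x‖)
    (g := fun x => ‖g x‖) Real.HolderConjugate.two_two (ae_of_all _ fun _ => norm_nonneg _)
    (ae_of_all _ fun _ => norm_nonneg _) (by simpa using hf.norm) (by simpa using hg.norm)
  refine (norm_integral_le_integral_norm _).trans ?_
  simp only [norm_mul]
  simpa [Real.sqrt_eq_rpow] using h

theorem norm_integral_ofReal_mul_le {μ : Measure ℝ} {f : ℝ → ℝ} {g : ℝ → ℂ}
    (hf : MemLp (fun x => (f x : ℂ)) 2 μ) (hg : MemLp g 2 μ) :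
    ‖∫ x, f x * g x ∂μ‖ ≤ √(∫ x, f x ^ 2 ∂μ) * √(∫ x, ‖g x‖ ^ 2 ∂μ) := by
  refine (norm_integral_mul_le hf hg).trans (le_of_eq ?_)
  simp

/-! ### Behaviour at the origin -/

theorem isLittleO_rpow {p q : ℝ} (h : q < p) :
    (fun x : ℝ => x ^ p) =o[𝓝[>] 0] fun x : ℝ => x ^ q := by
  refine Asymptotics.isLittleO_of_tendsto' ?_ ?_
  · filter_upwards [self_mem_nhdsWithin] with x hx h0
    exact absurd h0 (Real.rpow_pos_of_pos hx _).ne'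
  · have h1 : Tendsto (fun x : ℝ => x ^ (p - q)) (𝓝[>] 0) (𝓝 0) := by
      have := (Real.continuousAt_rpow_const 0 (p - q) (Or.inr (by linarith))).tendsto
      rw [Real.zero_rpow (by linarith)] at this
      exact this.mono_left nhdsWithin_le_nhds
    refine h1.congr' ?_
    filter_upwards [self_mem_nhdsWithin] with x hx
    rw [Real.rpow_sub hx]

theorem eventually_phase_le (hα0 : 0 ≤ α) : ∀ᶠ x in 𝓝[>] (0 : ℝ), phase α k x ≤ 1 := by
  have h1 : Tendsto (phase α k) (𝓝[>] 0) (𝓝 0) := by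
    have := ((Real.continuousAt_rpow_const 0 (1 + α) (Or.inr (by linarith))).tendsto).const_mul
      (|(k : ℝ)| / (1 + α))
    rw [Real.zero_rpow (by linarith), mul_zero] at this
    exact this.mono_left nhdsWithin_le_nhds
  exact (h1.eventually (gt_mem_nhds zero_lt_one)).mono fun _ => le_of_lt

theorem abs_sinh_sub_le {s : ℝ} (hs : |s| ≤ 1) : |Real.sinh s - s| ≤ s ^ 2 := by
  have h1 := Real.abs_exp_sub_one_sub_id_le hs
  have h2 := Real.abs_exp_sub_one_sub_id_le (x := -s) (by rwa [abs_neg])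
  rw [Real.sinh_eq, abs_le] at *
  constructor <;> nlinarith

/-- The power is -α/2 + 2(1 + α) = 2 + 3α/2, which exceeds 3/2. It bounds the error of both
expansions below. -/
theorem isBigO_rpow_mul_phase_sq (hα0 : 0 ≤ α) :
    (fun x => x ^ (-α / 2) * phase α k x ^ 2) =o[𝓝[>] 0] fun x : ℝ => x ^ (3 / 2 : ℝ) := by
  have h := (isLittleO_rpow (p := 2 + 3 * α / 2) (q := 3 / 2) (by linarith)).const_mul_left
    ((|(k : ℝ)| / (1 + α)) ^ 2)
  refine h.congr' ?_ EventuallyEq.rfl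
  filter_upwards [self_mem_nhdsWithin] with x hx
  rw [phase, mul_pow, mul_left_comm, ← Real.rpow_natCast (x ^ (1 + α)), ← Real.rpow_mul (le_of_lt hx),
    ← Real.rpow_add hx]
  push_cast
  ring_nf

theorem recSol_asymp (hα0 : 0 ≤ α) :
    (fun x => recSol α k x - (x ^ (-α / 2) - |(k : ℝ)| / (1 + α) * x ^ (1 + α / 2)))
      =o[𝓝[>] 0] fun x : ℝ => x ^ (3 / 2 : ℝ) := by
  refine Asymptotics.IsBigO.trans_isLittleO ?_ (isBigO_rpow_mul_phase_sq (k := k) hα0)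
  refine Asymptotics.IsBigO.of_bound 1 ?_
  filter_upwards [self_mem_nhdsWithin, eventually_phase_le (k := k) hα0] with x hx h1
  have hx : 0 < x := hx
  have hp := phase_nonneg (k := k) hα0 hx
  rw [← rpow_neg_half_mul_phase hx, recSol, one_mul, ← mul_one_sub, ← mul_sub, norm_mul, norm_mul]
  gcongr
  have := Real.abs_exp_sub_one_sub_id_le (x := -phase α k x) (by rwa [abs_neg, abs_of_nonneg hp])
  rw [Real.norm_eq_abs, Real.norm_of_nonneg (sq_nonneg _)]
  rwa [neg_sq, sub_neg_eq_add, sub_add] at this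

theorem domSol_asymp (hα0 : 0 ≤ α) (hk : k ≠ 0) :
    (fun x => domSol α k x - 1 / (1 + α) * x ^ (1 + α / 2))
      =o[𝓝[>] 0] fun x : ℝ => x ^ (3 / 2 : ℝ) := by
  have h0 : 0 < |(k : ℝ)| := by simpa using hk
  refine Asymptotics.IsBigO.trans_isLittleO ?_ (isBigO_rpow_mul_phase_sq (k := k) hα0)
  refine Asymptotics.IsBigO.of_bound (1 / |(k : ℝ)|) ?_
  filter_upwards [self_mem_nhdsWithin, eventually_phase_le (k := k) hα0] with x hx h1
  have hx : 0 < x := hx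
  have hp := phase_nonneg (k := k) hα0 hx
  have e : domSol α k x - 1 / (1 + α) * x ^ (1 + α / 2) =
      1 / |(k : ℝ)| * (x ^ (-α / 2) * (Real.sinh (phase α k x) - phase α k x)) := by
    rw [mul_sub, rpow_neg_half_mul_phase hx, domSol]
    field_simp
  rw [e, norm_mul, norm_mul, norm_mul, Real.norm_of_nonneg (by positivity : 0 ≤ 1 / |(k : ℝ)|)]
  gcongr
  rw [Real.norm_eq_abs, Real.norm_of_nonneg (sq_nonneg _)]
  exact abs_sinh_sub_le (by rwa [abs_of_nonneg hp])

/-- The functions `x^(-α/2)` and `x^(1+α/2)` are linearly independent modulo `o(x^(3/2))`. -/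
theorem eq_zero_of_isLittleO (hα0 : 0 ≤ α) (hα1 : α < 1) {p q : ℂ}
    (h : (fun x : ℝ => p * (x ^ (-α / 2) : ℝ) + q * (x ^ (1 + α / 2) : ℝ)) =o[𝓝[>] (0 : ℝ)]
      fun x : ℝ => x ^ (3 / 2 : ℝ)) : p = 0 ∧ q = 0 := by
  have aux : ∀ (c : ℂ) (r : ℝ), r < 3 / 2 →
      (fun x : ℝ => c * (x ^ r : ℝ)) =o[𝓝[>] (0 : ℝ)] (fun x : ℝ => x ^ r) → c = 0 := by
    intro c r hr hc
    by_contra hc0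
    have h1 : (fun x : ℝ => x ^ r) =O[𝓝[>] (0 : ℝ)] fun x : ℝ => c * (x ^ r : ℝ) := by
      refine Asymptotics.IsBigO.of_bound ‖c‖⁻¹ (Eventually.of_forall fun x => ?_)
      rw [norm_mul, Complex.norm_real, inv_mul_cancel_left₀ (norm_ne_zero_iff.2 hc0)]
    have h2 := (h1.trans_isLittleO hc)
    have h3 : (fun x : ℝ => x ^ r) =ᶠ[𝓝[>] (0 : ℝ)] fun _ => 0 := by
      filter_upwards [h2.bound (show (0 : ℝ) < 1 / 2 by norm_num)] with x hx
      have := norm_nonneg (x ^ r)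
      exact norm_eq_zero.1 (by linarith)
    obtain ⟨x, hx, hx'⟩ := (h3.and self_mem_nhdsWithin).exists
    exact (Real.rpow_pos_of_pos hx' r).ne' hx
  have cast : ∀ {r s : ℝ} (c : ℂ), s < r →
      (fun x : ℝ => c * (x ^ r : ℝ)) =o[𝓝[>] (0 : ℝ)] (fun x : ℝ => x ^ s) := by
    intro r s c hrs
    refine Asymptotics.IsLittleO.const_mul_left ?_ c
    refine (isLittleO_rpow hrs).norm_left.congr_left (f₁ := fun x : ℝ => ‖x ^ r‖) (fun x => ?_)
      |>.of_norm_left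
    rw [Complex.norm_real]
  -- The exponents satisfy -α/2 < 1 + α/2 < 3/2, the last inequality because α < 1, so the
  -- coefficients can be peeled off in this order.
  have hp : p = 0 := by
    refine aux p (-α / 2) (by linarith) ?_
    have h1 := (h.trans (isLittleO_rpow (p := 3 / 2) (q := -α / 2) (by linarith))).sub
      (cast (r := 1 + α / 2) (s := -α / 2) q (by linarith))
    refine h1.congr_left fun x => ?_
    ring
  refine ⟨hp, aux q (1 + α / 2) (by linarith) ?_⟩
  have h1 := h.trans (isLittleO_rpow (p := 3 / 2) (q := 1 + α / 2) (by linarith))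
  refine h1.congr_left fun x => ?_
  rw [hp]
  ring

end HalfLine

/-! ### Products of indefinite integrals -/

theorem AbsolutelyContinuousOnInterval.complex_ofReal {f : ℝ → ℝ} {a b : ℝ}
    (hf : AbsolutelyContinuousOnInterval f a b) :
    AbsolutelyContinuousOnInterval (fun x => (f x : ℂ)) a b := by
  unfold AbsolutelyContinuousOnInterval at *
  simpa only [Complex.dist_eq, ← Complex.ofReal_sub, Complex.norm_real, dist_eq_norm] using hf

/-- Real and imaginary parts are indefinite integrals of real functions, and they recombine
linearly. -/
theorem AbsolutelyContinuousOnInterval.complex_integral {f : ℝ → ℂ} {a b : ℝ}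
    (h : IntervalIntegrable f volume a b) :
    AbsolutelyContinuousOnInterval (fun x => ∫ t in a..x, f t) a b := by
  have hre : IntervalIntegrable (fun x => (f x).re) volume a b := ⟨h.1.re, h.2.re⟩
  have him : IntervalIntegrable (fun x => (f x).im) volume a b := ⟨h.1.im, h.2.im⟩
  have h1 := (hre.absolutelyContinuousOnInterval_intervalIntegral (c := a) left_mem_uIcc)
  have h2 := (him.absolutelyContinuousOnInterval_intervalIntegral (c := a) left_mem_uIcc)
  have h3 := h1.complex_ofReal.add (h2.complex_ofReal.const_smul Complex.I)
  have key : ∀ x ∈ uIcc a b, ∫ t in a..x, f t =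
      ((∫ t in a..x, (f t).re : ℝ) : ℂ) + Complex.I • ((∫ t in a..x, (f t).im : ℝ) : ℂ) := by
    intro x hx
    have hs : uIcc a x ⊆ uIcc a b := uIcc_subset_uIcc_left hx
    have i1 : IntervalIntegrable (fun x => ((f x).re : ℂ)) volume a x :=
      ⟨(hre.mono_set hs).1.ofReal, (hre.mono_set hs).2.ofReal⟩
    have i2 : IntervalIntegrable (fun x => ((f x).im : ℂ)) volume a x :=
      ⟨(him.mono_set hs).1.ofReal, (him.mono_set hs).2.ofReal⟩
    rw [← intervalIntegral.integral_ofReal, ← intervalIntegral.integral_ofReal, smul_eq_mul,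
      ← intervalIntegral.integral_const_mul, ← intervalIntegral.integral_add i1 (i2.const_mul _)]
    refine intervalIntegral.integral_congr fun t _ => ?_
    rw [mul_comm]
    exact (Complex.re_add_im (f t)).symm
  rw [absolutelyContinuousOnInterval_iff] at h3 ⊢
  intro ε hε
  obtain ⟨δ, hδ, hh⟩ := h3 ε hε
  refine ⟨δ, hδ, fun E hE hE' => lt_of_le_of_lt (le_of_eq ?_) (hh E hE hE')⟩
  refine Finset.sum_congr rfl fun i hi => ?_
  rw [key _ (hE.1 i hi).1, key _ (hE.1 i hi).2]
  rfl

/-- Integration by parts for merely integrable densities: the product of the two primitives minus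
the indefinite integral of the integrand is absolutely continuous with derivative zero almost
everywhere, hence constant. This allows right-hand sides h that are only in L². -/
theorem integral_mul_add_mul_eq {p q : ℝ → ℂ} {a b : ℝ} (A B : ℂ)
    (hp : IntervalIntegrable p volume a b) (hq : IntervalIntegrable q volume a b) :
    ∫ x in a..b, (p x * (B + ∫ t in a..x, q t) + (A + ∫ t in a..x, p t) * q x) =
      (A + ∫ t in a..b, p t) * (B + ∫ t in a..b, q t) - A * B := by
  have acc : ∀ c : ℂ, AbsolutelyContinuousOnInterval (fun _ : ℝ => c) a b := fun c =>
    contDiffOn_const.absolutelyContinuousOnInterval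
  have hP := (acc A).add (AbsolutelyContinuousOnInterval.complex_integral hp)
  have hQ := (acc B).add (AbsolutelyContinuousOnInterval.complex_integral hq)
  have hI : IntervalIntegrable (fun x => p x * (B + ∫ t in a..x, q t) +
      (A + ∫ t in a..x, p t) * q x) volume a b :=
    (hp.mul_continuousOn hQ.continuousOn).add (hq.continuousOn_mul hP.continuousOn)
  have hF := (hP.smul hQ).sub (AbsolutelyContinuousOnInterval.complex_integral hI)
  have hd : ∀ᵐ x, x ∈ uIcc a b → HasDerivAt
      ((((fun _ : ℝ => A) + fun x => ∫ t in a..x, p t) • ((fun _ : ℝ => B) +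
        fun x => ∫ t in a..x, q t)) - fun x => ∫ t in a..x, (p t * (B + ∫ s in a..t, q s) +
      (A + ∫ s in a..t, p s) * q t)) 0 x := by
    filter_upwards [hp.ae_hasDerivAt_integral, hq.ae_hasDerivAt_integral,
      hI.ae_hasDerivAt_integral] with x h1 h2 h3 hx
    have e1 := ((h1 hx a left_mem_uIcc).const_add A).mul ((h2 hx a left_mem_uIcc).const_add B)
    have e2 := e1.sub (h3 hx a left_mem_uIcc)
    rw [sub_self] at e2
    exact e2
  obtain ⟨C, hC⟩ := hF.const_of_ae_hasDerivAt_zero hd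
  have ha := hC a left_mem_uIcc
  have hb := hC b right_mem_uIcc
  simp only [Pi.sub_apply, smul_eq_mul, Pi.mul_apply, Pi.add_apply,
    intervalIntegral.integral_same, add_zero, sub_zero] at ha hb
  rw [ha]
  linear_combination -hb

namespace HalfLine

variable {α : ℝ} {k : ℤ}

/-! ### Test functions -/

theorem exists_tsupport_subset_Icc (φ : 𝓓(posReals, ℂ)) :
    ∃ ε R : ℝ, 0 < ε ∧ ε < R ∧ tsupport φ ⊆ Icc ε R := by
  have hc : IsCompact (tsupport φ) := φ.hasCompactSupport
  rcases (tsupport φ).eq_empty_or_nonempty with h | h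
  · exact ⟨1, 2, one_pos, one_lt_two, by simp [h]⟩
  · obtain ⟨a, ha, ha'⟩ := hc.exists_isLeast h
    obtain ⟨b, hb, hb'⟩ := hc.exists_isGreatest h
    have ha0 : 0 < a := φ.tsupport_subset ha
    exact ⟨a, b + 1, ha0, by linarith [ha' hb], fun x hx => ⟨ha' hx, by linarith [hb' hx]⟩⟩

theorem eq_zero_of_tsupport_subset {φ : 𝓓(posReals, ℂ)} {s : Set ℝ} (h : tsupport φ ⊆ s) {x : ℝ}
    (hx : x ∉ s) : φ x = 0 :=
  image_eq_zero_of_notMem_tsupport fun h' => hx (h h')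

theorem support_diffOp (φ : 𝓓(posReals, ℂ)) : Function.support (diffOp α k φ) ⊆ tsupport φ := by
  intro x hx
  by_contra h
  apply hx
  have h1 : iteratedDeriv 2 φ x = 0 := by
    by_contra h'
    exact h (support_iteratedDeriv φ 2 h')
  simp [diffOp, h1, image_eq_zero_of_notMem_tsupport h]

theorem eventuallyEq_zero_of_nonpos (φ : 𝓓(posReals, ℂ)) {x : ℝ} (hx : x ≤ 0) :
    φ =ᶠ[𝓝 x] 0 :=
  notMem_tsupport_iff_eventuallyEq.1 fun h => not_lt.2 hx (φ.tsupport_subset h)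

/-- The product of a function that is smooth on the half-line with a test function. -/
def mulTest (f : ℝ → ℂ) (hf : ContDiffOn ℝ ∞ f (Ioi 0)) (φ : 𝓓(posReals, ℂ)) : 𝓓(posReals, ℂ) where
  toFun x := f x * φ x
  contDiff' := by
    rw [contDiff_iff_contDiffAt]
    intro x
    rcases lt_or_ge 0 x with hx | hx
    · exact (hf.contDiffAt (isOpen_Ioi.mem_nhds hx)).mul φ.contDiff.contDiffAt
    · refine (contDiffAt_const (c := (0 : ℂ))).congr_of_eventuallyEq ?_
      filter_upwards [eventuallyEq_zero_of_nonpos φ hx] with y hy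
      rw [hy, Pi.zero_apply, mul_zero]
  hasCompactSupport' := φ.hasCompactSupport.mul_left
  tsupport_subset' := (tsupport_mul_subset_right).trans φ.tsupport_subset

/-- The complex conjugate of a test function. -/
def conjTest (φ : 𝓓(posReals, ℂ)) : 𝓓(posReals, ℂ) where
  toFun x := conj (φ x)
  contDiff' := Complex.conjCLE.contDiff.comp φ.contDiff
  hasCompactSupport' := φ.hasCompactSupport.comp_left (map_zero _)
  tsupport_subset' := (closure_mono fun x hx => by
    simpa using hx).trans φ.tsupport_subset

theorem conjTest_apply (φ : 𝓓(posReals, ℂ)) (x : ℝ) : conjTest φ x = conj (φ x) := rfl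

theorem conjTest_conjTest (φ : 𝓓(posReals, ℂ)) : conjTest (conjTest φ) = φ := by
  ext x; simp [conjTest_apply]

theorem diffOp_conjTest (φ : 𝓓(posReals, ℂ)) (x : ℝ) :
    diffOp α k (conjTest φ) x = conj (diffOp α k φ x) := by
  have h : iteratedDeriv 2 (conjTest φ) x = conj (iteratedDeriv 2 φ x) := by
    have h1 : (conjTest φ : ℝ → ℂ) = fun x => star (φ x) := rfl
    have h2 : deriv (fun x => star (φ x)) = fun x => star (deriv φ x) := by
      ext y; exact deriv.star
    rw [iteratedDeriv_succ, iteratedDeriv_one, iteratedDeriv_succ, iteratedDeriv_one, h1, h2]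
    exact deriv.star
  simp only [diffOp, h, conjTest_apply, map_add, map_neg, map_mul, Complex.conj_ofReal]

theorem locallyIntegrableOn_L2 (u : L2) : LocallyIntegrableOn u (Ioi 0) :=
  locallyIntegrableOn_of_locallyIntegrable_restrict
    ((Lp.memLp u).locallyIntegrable (by norm_num))

theorem integrable_mul_of_support {g c : ℝ → ℂ} (hg : LocallyIntegrableOn g (Ioi 0))
    (hc : Continuous c) (φ : 𝓓(posReals, ℂ)) (hs : Function.support c ⊆ tsupport φ) :
    Integrable (fun x => g x * c x) := by
  have hK : IsCompact (tsupport φ) := φ.hasCompactSupport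
  have h1 := (hg.integrableOn_compact_subset φ.tsupport_subset hK).mul_continuousOn
    hc.continuousOn hK
  refine (integrableOn_iff_integrable_of_support_subset ?_).1 h1
  exact (Function.support_mul_subset_right _ _).trans hs

theorem integrable_mul_test {g : ℝ → ℂ} (hg : LocallyIntegrableOn g (Ioi 0))
    (φ : 𝓓(posReals, ℂ)) : Integrable (fun x => g x * φ x) :=
  integrable_mul_of_support hg φ.continuous φ (subset_tsupport _)

theorem integrable_mul_iteratedDeriv {g : ℝ → ℂ} (hg : LocallyIntegrableOn g (Ioi 0))
    (φ : 𝓓(posReals, ℂ)) (m : ℕ) : Integrable (fun x => g x * iteratedDeriv m φ x) :=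
  integrable_mul_of_support hg (continuous_iteratedDeriv φ m) φ (support_iteratedDeriv φ m)

theorem integrable_mul_diffOp {g : ℝ → ℂ} (hg : LocallyIntegrableOn g (Ioi 0))
    (φ : 𝓓(posReals, ℂ)) : Integrable (fun x => g x * diffOp α k φ x) :=
  integrable_mul_of_support hg (continuous_diffOp α k φ) φ (support_diffOp φ)

/-- A locally integrable function whose integral against all test functions vanishes is zero. -/
theorem ae_eq_zero_of_forall_test {v : ℝ → ℂ} (hv : LocallyIntegrableOn v (Ioi 0))
    (h : ∀ φ : 𝓓(posReals, ℂ), ∫ x in Ioi 0, v x * φ x = 0) : v =ᵐ[leb] 0 := by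
  have := isOpen_Ioi.ae_eq_zero_of_integral_contDiff_smul_eq_zero hv fun g hg hg' hg'' => by
    let φ : 𝓓(posReals, ℂ) := ⟨fun x => (g x : ℂ), Complex.ofRealCLM.contDiff.comp hg,
      hg'.comp_left (g := fun x : ℝ => (x : ℂ)) Complex.ofReal_zero,
      (closure_mono fun x hx => by simpa using hx).trans hg''⟩
    have h1 := h φ
    rw [setIntegral_eq_integral_of_forall_compl_eq_zero] at h1
    · rw [← h1]
      refine integral_congr_ae (ae_of_all _ fun x => ?_)
      change g x • v x = v x * (g x : ℂ)
      rw [Complex.real_smul, mul_comm]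
    · intro x hx
      rw [image_eq_zero_of_notMem_tsupport fun h' => hx (φ.tsupport_subset h'), mul_zero]
  exact (ae_restrict_iff' measurableSet_Ioi).2 this

/-! ### The adjoint and weak solutions -/

/-- `g` solves `-g'' + V g = h` in the sense of distributions. -/
def IsSol (α : ℝ) (k : ℤ) (g h : ℝ → ℂ) : Prop :=
  ∀ φ : 𝓓(posReals, ℂ), ∫ x in Ioi (0 : ℝ), g x * diffOp α k φ x = ∫ x in Ioi (0 : ℝ), h x * φ x

theorem inner_toLp_right (u : L2) {f : ℝ → ℂ} (hf : MemLp f 2 leb) :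
    inner ℂ u (hf.toLp f) = conj (∫ x in Ioi (0 : ℝ), u x * conj (f x)) := by
  rw [L2.inner_def, ← integral_conj]
  refine integral_congr_ae ?_
  filter_upwards [hf.coeFn_toLp] with x hx
  rw [hx, RCLike.inner_apply, map_mul, Complex.conj_conj, mul_comm]

/-- A vector orthogonal to all test functions is zero by the fundamental lemma; conjugating the test
function makes the inner product a bilinear integral. -/
theorem op_domain_dense (α : ℝ) (k : ℤ) : Dense ((op α k).domain : Set L2) := by
  rw [Submodule.dense_iff_topologicalClosure_eq_top, Submodule.topologicalClosure_eq_top_iff,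
    Submodule.eq_bot_iff]
  intro u hu
  rw [Lp.eq_zero_iff_ae_eq_zero]
  refine ae_eq_zero_of_forall_test (locallyIntegrableOn_L2 u) fun φ => ?_
  have h1 := (Submodule.mem_orthogonal' _ u).1 hu (testToL2 (conjTest φ)) ⟨_, rfl⟩
  change inner ℂ u ((memLp_test (conjTest φ)).toLp _) = 0 at h1
  rw [inner_toLp_right, map_eq_zero] at h1
  simpa only [conjTest_apply, Complex.conj_conj] using h1

/-- The potential is real, so the expression commutes with conjugation of test functions, and the
sesquilinear and bilinear pairings carry the same information. -/
theorem isSol_iff_forall_inner (g h : L2) :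
    IsSol α k g h ↔ ∀ x : (op α k).domain, inner ℂ h (x : L2) = inner ℂ g (op α k x) := by
  have key : ∀ φ : 𝓓(posReals, ℂ), inner ℂ h (testToL2 φ) = inner ℂ g (diffOpToL2 α k φ) ↔
      ∫ x in Ioi (0 : ℝ), g x * diffOp α k (conjTest φ) x =
        ∫ x in Ioi (0 : ℝ), h x * conjTest φ x := by
    intro φ
    change inner ℂ h ((memLp_test φ).toLp _) = inner ℂ g ((memLp_diffOp α k φ).toLp _) ↔ _
    rw [inner_toLp_right, inner_toLp_right, (starRingEnd ℂ).injective.eq_iff, eq_comm]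
    simp only [diffOp_conjTest, conjTest_apply]
  constructor
  · intro hs x
    obtain ⟨φ, hφ, rfl⟩ := exists_test_of_mem α k x
    rw [op_apply]
    exact (key φ).2 (hs _)
  · intro hs φ
    have hm : testToL2 (conjTest φ) ∈ (op α k).domain := ⟨_, rfl⟩
    have := hs ⟨testToL2 (conjTest φ), hm⟩
    rw [op_apply, key, conjTest_conjTest] at this
    exact this

theorem isSol_adjoint (g : (op α k)†.domain) : IsSol α k (g : L2) ((op α k)† g) :=
  (isSol_iff_forall_inner _ _).2 fun x =>
    LinearPMap.inner_adjoint_apply (op_domain_dense α k) g x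

theorem mem_adjoint_domain_of_isSol {g h : L2} (hs : IsSol α k g h) : g ∈ (op α k)†.domain :=
  LinearPMap.mem_adjoint_domain_of_exists _ ⟨h, (isSol_iff_forall_inner g h).1 hs⟩

theorem adjoint_eq_of_isSol {g h : L2} (hs : IsSol α k g h) (hg : g ∈ (op α k)†.domain) :
    (op α k)† ⟨g, hg⟩ = h :=
  LinearPMap.adjoint_apply_eq (op_domain_dense α k) _ ((isSol_iff_forall_inner g h).1 hs)

theorem locallyIntegrableOn_potential_mul {g : ℝ → ℂ} (hg : LocallyIntegrableOn g (Ioi 0)) :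
    LocallyIntegrableOn (fun x => (potential α k x : ℂ) * g x) (Ioi 0) :=
  hg.continuousOn_mul (Complex.continuous_ofReal.comp_continuousOn (continuousOn_potential α k))
    isOpen_Ioi.isLocallyClosed

theorem integral_mul_diffOp {g : ℝ → ℂ} (hg : LocallyIntegrableOn g (Ioi 0)) (φ : 𝓓(posReals, ℂ)) :
    ∫ x in Ioi (0 : ℝ), g x * diffOp α k φ x = -(∫ x in Ioi (0 : ℝ), g x * iteratedDeriv 2 φ x) +
      ∫ x in Ioi (0 : ℝ), (potential α k x : ℂ) * g x * φ x := by
  have hn : Integrable (fun x => -(g x * iteratedDeriv 2 φ x)) :=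
    (integrable_mul_iteratedDeriv hg φ 2).neg
  rw [← integral_neg, ← integral_add hn.integrableOn
    (integrable_mul_test (locallyIntegrableOn_potential_mul hg) φ).integrableOn]
  refine integral_congr_ae (ae_of_all _ fun x => ?_)
  simp only [diffOp]
  ring

/-- The weak second derivative must be V g - h, and this is locally integrable because V is
continuous on the open half-line. -/
theorem weakDiffOp_iff_isSol (g h : L2) : WeakDiffOp α k g h ↔ IsSol α k g h := by
  have hg := locallyIntegrableOn_L2 g
  constructor
  · rintro ⟨w, ⟨_, hw, hw'⟩, hh⟩ φ
    have e := hw' φ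
    rw [neg_one_sq, one_mul] at e
    have hn : Integrable (fun x => -(w x * φ x)) := (integrable_mul_test hw φ).neg
    rw [integral_mul_diffOp hg, e, ← integral_neg, ← integral_add hn.integrableOn
      (integrable_mul_test (locallyIntegrableOn_potential_mul hg) φ).integrableOn]
    refine integral_congr_ae ?_
    filter_upwards [hh] with x hx
    rw [hx]
    ring
  · intro hs
    have hV := locallyIntegrableOn_potential_mul (α := α) (k := k) hg
    have hh := locallyIntegrableOn_L2 h
    refine ⟨fun x => (potential α k x : ℂ) * g x - h x, ⟨hg, hV.sub hh, fun φ => ?_⟩,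
      ae_of_all _ fun x => by ring⟩
    have h1 := hs φ
    rw [integral_mul_diffOp hg] at h1
    have h2 : ∫ x in Ioi (0 : ℝ), ((potential α k x : ℂ) * g x - h x) * φ x =
        (∫ x in Ioi (0 : ℝ), (potential α k x : ℂ) * g x * φ x) - ∫ x in Ioi (0 : ℝ), h x * φ x := by
      rw [← integral_sub (integrable_mul_test hV φ).integrableOn
        (integrable_mul_test hh φ).integrableOn]
      refine integral_congr_ae (ae_of_all _ fun x => ?_)
      ring
    rw [neg_one_sq, one_mul, h2, ← h1]
    ring


/-! ### Variation of parameters. -/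

variable {α : ℝ} {k : ℤ} {h : ℝ → ℂ} {x : ℝ}

theorem memLp_Ioc (hh : MemLp h 2 leb) (x : ℝ) : MemLp h 2 (volume.restrict (Ioc 0 x)) :=
  hh.mono_measure (Measure.restrict_mono Ioc_subset_Ioi_self le_rfl)

theorem integrableOn_recSol_mul (hα0 : 0 ≤ α) (hα1 : α < 1) (hk : k ≠ 0) (hh : MemLp h 2 leb) :
    IntegrableOn (fun t => (recSol α k t : ℂ) * h t) (Ioi 0) :=
  (memLp_recSol hα0 hα1 hk).integrable_mul hh

theorem intervalIntegrable_recSol_mul (hα0 : 0 ≤ α) (hα1 : α < 1) (hk : k ≠ 0)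
    (hh : MemLp h 2 leb) (hx : 0 ≤ x) :
    IntervalIntegrable (fun t => (recSol α k t : ℂ) * h t) volume 0 x :=
  (intervalIntegrable_iff_integrableOn_Ioc_of_le hx).2
    ((integrableOn_recSol_mul hα0 hα1 hk hh).mono_set Ioc_subset_Ioi_self)

theorem intervalIntegrable_domSol_mul (hα0 : 0 ≤ α) (hk : k ≠ 0)
    (hh : MemLp h 2 leb) (hx : 0 < x) :
    IntervalIntegrable (fun t => (domSol α k t : ℂ) * h t) volume 0 x :=
  (intervalIntegrable_iff_integrableOn_Ioc_of_le hx.le).2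
    ((memLp_domSol hα0 hk hx).integrable_mul (memLp_Ioc hh x))

/-- Variation of parameters: the solution of `-g'' + V g = h` with coefficients `a`, `b` at the
origin. -/
def repSol (α : ℝ) (k : ℤ) (h : ℝ → ℂ) (a b : ℂ) (x : ℝ) : ℂ :=
  (a + ∫ t in (0 : ℝ)..x, (domSol α k t : ℂ) * h t) * recSol α k x +
    (b + ∫ t in (0 : ℝ)..x, -((recSol α k t : ℂ) * h t)) * domSol α k x

theorem continuousOn_intervalIntegral {f : ℝ → ℂ}
    (hf : ∀ x, 0 < x → IntervalIntegrable f volume 0 x) :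
    ContinuousOn (fun x => ∫ t in (0 : ℝ)..x, f t) (Ioi 0) := by
  intro x hx
  have hx0 : 0 < x := hx
  have h1 := intervalIntegral.continuousOn_primitive_interval'
    (hf (x + 1) (by linarith)) left_mem_uIcc
  have h2 : ContinuousAt (fun x => ∫ t in (0 : ℝ)..x, f t) x := h1.continuousAt (by
    rw [uIcc_of_le (by linarith)]
    exact Icc_mem_nhds hx0 (by linarith))
  exact h2.continuousWithinAt

theorem continuousOn_repSol (hα0 : 0 ≤ α) (hα1 : α < 1) (hk : k ≠ 0) (hh : MemLp h 2 leb)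
    (a b : ℂ) : ContinuousOn (repSol α k h a b) (Ioi 0) :=
  ((continuousOn_const.add (continuousOn_intervalIntegral fun _ hx =>
    intervalIntegrable_domSol_mul hα0 hk hh hx)).mul
      (Complex.continuous_ofReal.comp_continuousOn continuousOn_recSol)).add
  ((continuousOn_const.add (continuousOn_intervalIntegral fun _ hx =>
    (intervalIntegrable_recSol_mul hα0 hα1 hk hh (le_of_lt hx)).neg)).mul
      (Complex.continuous_ofReal.comp_continuousOn continuousOn_domSol))

/-- For a homogeneous solution u, (u φ' - u' φ)' = u φ'' - u'' φ and u'' = V u. The formula holds on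
all of ℝ because φ vanishes near every nonpositive point, whatever the values of u there. -/
theorem hasDerivAt_wronskian {u u' : ℝ → ℝ} (hu : ∀ x, 0 < x → HasDerivAt u (u' x) x)
    (hu' : ∀ x, 0 < x → HasDerivAt u' (potential α k x * u x) x) (φ : 𝓓(posReals, ℂ)) (x : ℝ) :
    HasDerivAt (fun x => (u x : ℂ) * iteratedDeriv 1 φ x - (u' x : ℂ) * φ x)
      (-((u x : ℂ) * diffOp α k φ x)) x := by
  rcases lt_or_ge 0 x with hx | hx
  · have h0 := hasDerivAt_iteratedDeriv φ 0 x
    simp only [iteratedDeriv_zero] at h0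
    have h1 := ((hu x hx).ofReal_comp.mul (hasDerivAt_iteratedDeriv φ 1 x)).sub
      ((hu' x hx).ofReal_comp.mul h0)
    refine h1.congr_deriv ?_
    simp only [diffOp]
    push_cast
    ring
  · have hz := eventuallyEq_zero_of_nonpos φ hx
    have hz1 := hz.iteratedDeriv_eq 1
    have hd : diffOp α k φ x = 0 := by
      by_contra hne
      exact not_lt.2 hx (φ.tsupport_subset (support_diffOp φ hne))
    rw [hd, mul_zero, neg_zero]
    refine (hasDerivAt_const x (0 : ℂ)).congr_of_eventuallyEq ?_
    filter_upwards [hz, hz.eventuallyEq_nhds] with y hy hy'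
    rw [hy, hy'.iteratedDeriv_eq 1]
    simp

/-- This is integration by parts for the product of the coefficient A + ∫ p with the Wronskian of u
and φ; the Wronskian vanishes at both ends of [0, R]. -/
theorem integral_mul_diffOp_eq {u u' : ℝ → ℝ} (hu : ∀ x, 0 < x → HasDerivAt u (u' x) x)
    (hu' : ∀ x, 0 < x → HasDerivAt u' (potential α k x * u x) x) (φ : 𝓓(posReals, ℂ)) {R : ℝ}
    (hφ : tsupport φ ⊆ Iio R) (A : ℂ) {p : ℝ → ℂ}
    (hp : IntervalIntegrable p volume 0 R) :
    IntervalIntegrable (fun x => p x * ((u x : ℂ) * iteratedDeriv 1 φ x - (u' x : ℂ) * φ x) -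
      (A + ∫ t in (0 : ℝ)..x, p t) * ((u x : ℂ) * diffOp α k φ x)) volume 0 R ∧
    ∫ x in (0 : ℝ)..R, (p x * ((u x : ℂ) * iteratedDeriv 1 φ x - (u' x : ℂ) * φ x) -
      (A + ∫ t in (0 : ℝ)..x, p t) * ((u x : ℂ) * diffOp α k φ x)) = 0 := by
  have hc : Continuous fun x => -((u x : ℂ) * diffOp α k φ x) := by
    rw [continuous_iff_continuousAt]
    intro x
    rcases lt_or_ge 0 x with hx | hx
    · exact ((Complex.continuous_ofReal.continuousAt.comp (hu x hx).continuousAt).mul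
        (continuous_diffOp α k φ).continuousAt).neg
    · have hz : diffOp α k φ =ᶠ[𝓝 x] 0 := by
        have := notMem_tsupport_iff_eventuallyEq.1 fun h : x ∈ tsupport (diffOp α k φ) =>
          not_lt.2 hx (φ.tsupport_subset (closure_minimal (support_diffOp φ)
            (isClosed_tsupport φ) h))
        exact this
      refine (continuousAt_const (y := (0 : ℂ))).congr ?_
      filter_upwards [hz] with y hy
      rw [hy]
      simp
  have hω : ∀ x : ℝ, ((u x : ℂ) * iteratedDeriv 1 φ x - (u' x : ℂ) * φ x) =
      0 + ∫ t in (0 : ℝ)..x, -((u t : ℂ) * diffOp α k φ t) := by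
    intro x
    rw [intervalIntegral.integral_eq_sub_of_hasDerivAt
      (fun y _ => hasDerivAt_wronskian hu hu' φ y) (hc.intervalIntegrable _ _),
      deriv_eq_zero_of_notMem φ (x := 0) (by simp) 1]
    have : φ 0 = 0 := by simpa using deriv_eq_zero_of_notMem φ (x := 0) (by simp) 0
    rw [this]
    simp
  have hωR : ((u R : ℂ) * iteratedDeriv 1 φ R - (u' R : ℂ) * φ R) = 0 := by
    have h1 : R ∉ tsupport φ := fun h => lt_irrefl R (hφ h)
    have h2 : iteratedDeriv 1 φ R = 0 := by
      by_contra hne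
      exact h1 (support_iteratedDeriv φ 1 hne)
    rw [h2, image_eq_zero_of_notMem_tsupport h1]
    simp
  have key := integral_mul_add_mul_eq A 0 hp (hc.intervalIntegrable 0 R)
  rw [← hω R, hωR, mul_zero, mul_zero, sub_zero] at key
  refine ⟨?_, ?_⟩
  · have hcω : Continuous fun x => (u x : ℂ) * iteratedDeriv 1 φ x - (u' x : ℂ) * φ x :=
      continuous_iff_continuousAt.2 fun x => (hasDerivAt_wronskian hu hu' φ x).continuousAt
    have h1 := hp.mul_continuousOn hcω.continuousOn
    have h2 : ContinuousOn (fun x => A + ∫ t in (0 : ℝ)..x, p t) (uIcc 0 R) :=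
      continuousOn_const.add (intervalIntegral.continuousOn_primitive_interval' hp left_mem_uIcc)
    have hc' : Continuous fun x => (u x : ℂ) * diffOp α k φ x := by
      simpa only [neg_neg] using hc.fun_neg
    have h3 := h2.mul hc'.continuousOn
    exact h1.sub h3.intervalIntegrable
  rw [← key]
  refine intervalIntegral.integral_congr fun x _ => ?_
  simp only [← hω x]
  ring

theorem integral_Ioi_eq_intervalIntegral {f : ℝ → ℂ} (φ : 𝓓(posReals, ℂ)) {R : ℝ} (hR : 0 < R)
    (hφ : tsupport φ ⊆ Iio R) (hf : Function.support f ⊆ tsupport φ) :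
    ∫ x in Ioi 0, f x = ∫ x in (0 : ℝ)..R, f x := by
  rw [intervalIntegral.integral_of_le hR.le]
  refine setIntegral_eq_of_subset_of_forall_sdiff_eq_zero measurableSet_Ioi Ioc_subset_Ioi_self
    fun x hx => ?_
  by_contra hne
  exact hx.2 ⟨hx.1, le_of_lt (hφ (hf hne))⟩

/-- Add `integral_mul_diffOp_eq` for the two homogeneous solutions. The φ' terms cancel, and the φ
terms combine to h φ times the Wronskian, which is 1. The solution itself is never differentiated.
-/
theorem isSol_repSol (hα0 : 0 ≤ α) (hα1 : α < 1) (hk : k ≠ 0) (hh : MemLp h 2 leb) (a b : ℂ) :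
    IsSol α k (repSol α k h a b) h := by
  intro φ
  obtain ⟨ε, R, hε, hεR, hφ⟩ := exists_tsupport_subset_Icc φ
  have hR : 0 < R + 1 := by linarith
  have hφ' : tsupport φ ⊆ Iio (R + 1) := fun x hx => by
    have := (hφ hx).2
    exact mem_Iio.2 (by linarith)
  have i1 := intervalIntegrable_domSol_mul (k := k) hα0 hk hh hR
  have i2 := (intervalIntegrable_recSol_mul (k := k) hα0 hα1 hk hh hR.le).neg
  have e1 := integral_mul_diffOp_eq (fun x hx => hasDerivAt_recSol (k := k) hα0 hx)
    (fun x hx => hasDerivAt_recSolDeriv hα0 hx) φ hφ' a i1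
  have e2 := integral_mul_diffOp_eq (fun x hx => hasDerivAt_domSol (k := k) hα0 hk hx)
    (fun x hx => hasDerivAt_domSolDeriv hα0 hk hx) φ hφ' b i2
  rw [integral_Ioi_eq_intervalIntegral φ hR hφ'
      ((Function.support_mul_subset_right _ _).trans (support_diffOp φ)),
    integral_Ioi_eq_intervalIntegral φ hR hφ'
      ((Function.support_mul_subset_right _ _).trans (subset_tsupport φ))]
  have hl := locallyIntegrableOn_of_locallyIntegrable_restrict (hh.locallyIntegrable (by norm_num))
  have j1 : IntervalIntegrable (fun x => h x * φ x) volume 0 (R + 1) :=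
    (integrable_mul_test hl φ).intervalIntegrable
  have j2 : IntervalIntegrable (fun x => repSol α k h a b x * diffOp α k φ x) volume 0 (R + 1) :=
    (integrable_mul_diffOp ((continuousOn_repSol hα0 hα1 hk hh a b).locallyIntegrableOn
      measurableSet_Ioi) φ).intervalIntegrable
  have e := intervalIntegral.integral_add e1.1 e2.1
  rw [e1.2, e2.2, add_zero] at e
  rw [eq_comm, ← sub_eq_zero, ← intervalIntegral.integral_sub j1 j2, ← e]
  refine intervalIntegral.integral_congr_ae (ae_of_all _ fun x hx => ?_)
  rw [uIoc_of_le hR.le] at hx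
  have hw : (recSol α k x : ℂ) * domSolDeriv α k x - recSolDeriv α k x * domSol α k x = 1 := by
    exact_mod_cast wronskian (α := α) hk hx.1
  simp only [repSol]
  simp only [Pi.neg_apply]
  linear_combination -(h x * φ x) * hw

/-! ### Homogeneous solutions -/

theorem contDiff_infty_of_hasDerivAt {F f : ℝ → ℂ} (hF : ∀ x, HasDerivAt F (f x) x)
    (hf : ContDiff ℝ ∞ f) : ContDiff ℝ ∞ F := by
  refine contDiff_infty_iff_deriv.2 ⟨fun x => (hF x).differentiableAt, ?_⟩
  rwa [show deriv F = f from funext fun x => (hF x).deriv]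

/-- A test function orthogonal to the two homogeneous solutions is in the range of the differential
expression. -/
theorem exists_diffOp_eq (hα0 : 0 ≤ α) (hk : k ≠ 0) (ψ : 𝓓(posReals, ℂ))
    (h1 : ∫ x in Ioi (0 : ℝ), (recSol α k x : ℂ) * ψ x = 0)
    (h2 : ∫ x in Ioi (0 : ℝ), (domSol α k x : ℂ) * ψ x = 0) :
    ∃ φ : 𝓓(posReals, ℂ), ∀ x, diffOp α k φ x = ψ x := by
  have c1 : ContDiffOn ℝ ∞ (fun x => (recSol α k x : ℂ)) (Ioi 0) :=
    Complex.ofRealCLM.contDiff.comp_contDiffOn contDiffOn_recSol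
  have c2 : ContDiffOn ℝ ∞ (fun x => (domSol α k x : ℂ)) (Ioi 0) :=
    Complex.ofRealCLM.contDiff.comp_contDiffOn contDiffOn_domSol
  let q1 := mulTest _ c1 ψ
  let q2 := mulTest _ c2 ψ
  let Q1 : ℝ → ℂ := fun x => ∫ t in (0 : ℝ)..x, q1 t
  let Q2 : ℝ → ℂ := fun x => ∫ t in (0 : ℝ)..x, q2 t
  have dQ : ∀ (q : 𝓓(posReals, ℂ)) (x : ℝ), HasDerivAt (fun x => ∫ t in (0 : ℝ)..x, q t) (q x) x :=
    fun q x => q.continuous.integral_hasStrictDerivAt 0 x |>.hasDerivAt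
  have cQ1 : ContDiff ℝ ∞ Q1 := contDiff_infty_of_hasDerivAt (dQ q1) q1.contDiff
  have cQ2 : ContDiff ℝ ∞ Q2 := contDiff_infty_of_hasDerivAt (dQ q2) q2.contDiff
  obtain ⟨ε, R, hε, hεR, hψ⟩ := exists_tsupport_subset_Icc ψ
  have hq : ∀ {u : ℝ → ℂ} (hu : ContDiffOn ℝ ∞ u (Ioi 0)) (x : ℝ), x ∉ Icc ε R →
      mulTest u hu ψ x = 0 := fun hu x hx => by
    change _ * ψ x = 0
    rw [eq_zero_of_tsupport_subset hψ hx, mul_zero]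
  have hlow : ∀ {u : ℝ → ℂ} (hu : ContDiffOn ℝ ∞ u (Ioi 0)) (x : ℝ), x < ε →
      ∫ t in (0 : ℝ)..x, mulTest u hu ψ t = 0 := fun hu x hx => by
    refine intervalIntegral.integral_zero_ae (ae_of_all _ fun t ht => hq hu t fun ht' => ?_)
    have : t ≤ max 0 x := (uIoc_subset_uIcc ht).2
    exact not_lt.2 ht'.1 (this.trans_lt (max_lt hε hx))
  have hhigh : ∀ {u : ℝ → ℂ} (hu : ContDiffOn ℝ ∞ u (Ioi 0)) (x : ℝ), R < x →
      ∫ t in Ioi (0 : ℝ), u t * ψ t = 0 → ∫ t in (0 : ℝ)..x, mulTest u hu ψ t = 0 :=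
    fun hu x hx h0 => by
    rw [← h0, integral_Ioi_eq_intervalIntegral ψ (by linarith : 0 < x)
      (fun t ht => (hψ ht).2.trans_lt hx)
      ((Function.support_mul_subset_right _ _).trans (subset_tsupport ψ))]
    rfl
  -- The variation-of-parameters solution with zero data at the origin. It vanishes to the left of
  -- the support of ψ, and also to the right of it because the two orthogonality conditions make
  -- both integrals zero there.
  let f : ℝ → ℂ := fun x => (recSol α k x : ℂ) * Q2 x - (domSol α k x : ℂ) * Q1 x
  have fz : ∀ x, x ∉ Icc ε R → f x = 0 := by
    intro x hx
    rcases lt_or_ge x ε with hx' | hx'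
    · simp only [f, Q1, Q2, q1, q2, hlow _ x hx', mul_zero, sub_zero]
    · have hx'' : R < x := lt_of_not_ge fun h => hx ⟨hx', h⟩
      simp only [f, Q1, Q2, q1, q2, hhigh c1 x hx'' h1, hhigh c2 x hx'' h2, mul_zero, sub_zero]
  have fsupp : tsupport f ⊆ Icc ε R := closure_minimal (fun x hx => by
    by_contra h
    exact hx (fz x h)) isClosed_Icc
  have cf : ContDiff ℝ ∞ f := by
    rw [contDiff_iff_contDiffAt]
    intro x
    rcases lt_or_ge 0 x with hx | hx
    · exact ((c1.contDiffAt (isOpen_Ioi.mem_nhds hx)).mul cQ2.contDiffAt).sub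
        ((c2.contDiffAt (isOpen_Ioi.mem_nhds hx)).mul cQ1.contDiffAt)
    · refine (contDiffAt_const (c := (0 : ℂ))).congr_of_eventuallyEq ?_
      filter_upwards [Iio_mem_nhds (hx.trans_lt hε)] with y hy
      exact fz y fun h => not_lt.2 h.1 hy
  let φ : 𝓓(posReals, ℂ) := ⟨f, cf, isCompact_Icc.of_isClosed_subset (isClosed_tsupport _) fsupp,
    fsupp.trans fun x hx => lt_of_lt_of_le hε hx.1⟩
  refine ⟨φ, fun x => ?_⟩
  rcases lt_or_ge 0 x with hx | hx
  · have d1 : ∀ y, 0 < y → HasDerivAt f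
        ((recSolDeriv α k y : ℂ) * Q2 y - (domSolDeriv α k y : ℂ) * Q1 y) y := by
      intro y hy
      refine (((hasDerivAt_recSol hα0 hy).ofReal_comp.mul (dQ q2 y)).sub
        ((hasDerivAt_domSol hα0 hk hy).ofReal_comp.mul (dQ q1 y))).congr_deriv ?_
      change _ + _ * (domSol α k y * ψ y) - (_ + _ * (recSol α k y * ψ y)) = _
      ring
    have d2 : HasDerivAt (deriv f) ((potential α k x : ℂ) * f x - ψ x) x := by
      have e : deriv f =ᶠ[𝓝 x] fun y =>
          (recSolDeriv α k y : ℂ) * Q2 y - (domSolDeriv α k y : ℂ) * Q1 y := by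
        filter_upwards [Ioi_mem_nhds hx] with y hy
        exact (d1 y hy).deriv
      refine HasDerivAt.congr_of_eventuallyEq ?_ e
      refine (((hasDerivAt_recSolDeriv hα0 hx).ofReal_comp.mul (dQ q2 x)).sub
        ((hasDerivAt_domSolDeriv hα0 hk hx).ofReal_comp.mul (dQ q1 x))).congr_deriv ?_
      change _ + _ * (domSol α k x * ψ x) - (_ + _ * (recSol α k x * ψ x)) = _
      have hw : (recSol α k x : ℂ) * domSolDeriv α k x - recSolDeriv α k x * domSol α k x = 1 := by
        exact_mod_cast wronskian (α := α) hk hx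
      simp only [f]
      push_cast
      linear_combination -ψ x * hw
    have d3 : iteratedDeriv 2 φ x = (potential α k x : ℂ) * f x - ψ x := by
      rw [iteratedDeriv_succ, iteratedDeriv_one]
      exact d2.deriv
    rw [diffOp, d3]
    change _ + _ * f x = _
    ring
  · have e1 : diffOp α k φ x = 0 := by
      by_contra hne
      exact not_lt.2 hx (φ.tsupport_subset (support_diffOp φ hne))
    rw [e1, (eventuallyEq_zero_of_nonpos ψ hx).eq_of_nhds, Pi.zero_apply]

/-- Integration against a locally integrable function. -/
def testIntegral (v : ℝ → ℂ) (hv : LocallyIntegrableOn v (Ioi 0)) : 𝓓(posReals, ℂ) →ₗ[ℂ] ℂ where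
  toFun φ := ∫ x in Ioi (0 : ℝ), v x * φ x
  map_add' φ ψ := by
    rw [← integral_add (integrable_mul_test hv φ).integrableOn
      (integrable_mul_test hv ψ).integrableOn]
    refine integral_congr_ae (ae_of_all _ fun x => ?_)
    exact mul_add _ _ _
  map_smul' c φ := by
    rw [RingHom.id_apply, smul_eq_mul, ← integral_const_mul]
    refine integral_congr_ae (ae_of_all _ fun x => ?_)
    exact mul_left_comm _ _ _

/-- A functional that vanishes on the common kernel of two functionals is a combination of them.
Here the common kernel consists of functions -φ'' + V φ with φ a test function (`exists_diffOp_eq`),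
which v annihilates; no regularity of v is needed. -/
theorem exists_ae_eq_of_isSol_zero (hα0 : 0 ≤ α) (hk : k ≠ 0) {v : ℝ → ℂ}
    (hv : LocallyIntegrableOn v (Ioi 0)) (hs : IsSol α k v 0) :
    ∃ a b : ℂ, v =ᵐ[leb] fun x => a * recSol α k x + b * domSol α k x := by
  have l1 : LocallyIntegrableOn (fun x => (recSol α k x : ℂ)) (Ioi 0) :=
    (Complex.continuous_ofReal.comp_continuousOn continuousOn_recSol).locallyIntegrableOn
      measurableSet_Ioi
  have l2 : LocallyIntegrableOn (fun x => (domSol α k x : ℂ)) (Ioi 0) :=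
    (Complex.continuous_ofReal.comp_continuousOn continuousOn_domSol).locallyIntegrableOn
      measurableSet_Ioi
  have hm := mem_span_of_iInf_ker_le_ker (L := ![testIntegral _ l1, testIntegral _ l2])
    (K := testIntegral v hv) (by
      intro ψ hψ
      rw [Submodule.mem_iInf] at hψ
      obtain ⟨φ, hφ⟩ := exists_diffOp_eq hα0 hk ψ (hψ 0) (hψ 1)
      have := hs φ
      simp only [hφ, Pi.zero_apply, zero_mul, integral_zero] at this
      exact this)
  rw [Matrix.range_cons, Matrix.range_cons, Matrix.range_empty, union_empty,
    singleton_union, Submodule.mem_span_pair] at hm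
  obtain ⟨a, b, hab⟩ := hm
  refine ⟨a, b, ?_⟩
  have l3 : LocallyIntegrableOn (fun x => a * (recSol α k x : ℂ) + b * domSol α k x) (Ioi 0) :=
    (l1.smul a).add (l2.smul b)
  have h0 := ae_eq_zero_of_forall_test (hv.sub l3) fun φ => by
    have e := LinearMap.congr_fun hab φ
    change a * (∫ x in Ioi (0 : ℝ), (recSol α k x : ℂ) * φ x) +
      b * (∫ x in Ioi (0 : ℝ), (domSol α k x : ℂ) * φ x) = ∫ x in Ioi (0 : ℝ), v x * φ x at e
    have i1 := (integrable_mul_test l1 φ).integrableOn (s := Ioi 0)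
    have i2 := (integrable_mul_test l2 φ).integrableOn (s := Ioi 0)
    have i3 := (integrable_mul_test hv φ).integrableOn (s := Ioi 0)
    have i4 : IntegrableOn (fun x => a * ((recSol α k x : ℂ) * φ x) +
      b * ((domSol α k x : ℂ) * φ x)) (Ioi 0) := (i1.const_mul a).add (i2.const_mul b)
    rw [← sub_eq_zero, ← integral_const_mul, ← integral_const_mul, ← integral_add (i1.const_mul a)
      (i2.const_mul b), ← integral_sub i4 i3] at e
    rw [← neg_eq_zero, ← integral_neg, ← e]
    refine integral_congr_ae (ae_of_all _ fun x => ?_)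
    simp only [Pi.sub_apply]
    ring
  filter_upwards [h0] with x hx
  exact sub_eq_zero.1 hx

/-- Subtracting the particular solution with zero constants leaves a homogeneous one, and its two
coefficients become the constants. -/
theorem exists_ae_eq_repSol (hα0 : 0 ≤ α) (hα1 : α < 1) (hk : k ≠ 0) (hh : MemLp h 2 leb)
    {g : ℝ → ℂ} (hg : LocallyIntegrableOn g (Ioi 0)) (hs : IsSol α k g h) :
    ∃ a b : ℂ, g =ᵐ[leb] repSol α k h a b := by
  have hr := isSol_repSol hα0 hα1 hk hh 0 0
  have hrl := (continuousOn_repSol hα0 hα1 hk hh 0 0).locallyIntegrableOn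
    measurableSet_Ioi (μ := volume)
  obtain ⟨a, b, hab⟩ := exists_ae_eq_of_isSol_zero hα0 hk (hg.sub hrl) fun φ => by
    have e : ∫ x in Ioi (0 : ℝ), (g - repSol α k h 0 0) x * diffOp α k φ x =
        (∫ x in Ioi (0 : ℝ), g x * diffOp α k φ x) -
          ∫ x in Ioi (0 : ℝ), repSol α k h 0 0 x * diffOp α k φ x := by
      rw [← integral_sub (integrable_mul_diffOp hg φ).integrableOn
        (integrable_mul_diffOp hrl φ).integrableOn]
      refine integral_congr_ae (ae_of_all _ fun x => ?_)
      simp only [Pi.sub_apply]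
      ring
    rw [e, hs φ, hr φ]
    simp
  refine ⟨a, b, ?_⟩
  filter_upwards [hab] with x hx
  rw [Pi.sub_apply, sub_eq_iff_eq_add] at hx
  rw [hx]
  simp only [repSol]
  ring


variable {α : ℝ} {k : ℤ} {h l : ℝ → ℂ} {x : ℝ}

/-! ### Behaviour of the solutions at the origin -/

theorem integrableOn_norm_sq (hh : MemLp h 2 leb) : IntegrableOn (fun x => ‖h x‖ ^ 2) (Ioi 0) :=
  (memLp_two_iff_integrable_sq_norm hh.1).1 hh

theorem tendsto_integral_Ioc_norm_sq (hh : MemLp h 2 leb) :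
    Tendsto (fun x => √(∫ t in Ioc 0 x, ‖h t‖ ^ 2)) (𝓝[>] 0) (𝓝 0) := by
  have h1 : IntegrableOn (fun x => ‖h x‖ ^ 2) (Icc 0 1) := by
    rw [integrableOn_Icc_iff_integrableOn_Ioc]
    exact (integrableOn_norm_sq hh).mono_set Ioc_subset_Ioi_self
  have h2 := (intervalIntegral.continuousOn_primitive h1) 0 (left_mem_Icc.2 zero_le_one)
  have h3 : Tendsto (fun x => ∫ t in Ioc 0 x, ‖h t‖ ^ 2) (𝓝[>] 0) (𝓝 0) := by
    have hle : 𝓝[>] (0 : ℝ) ≤ 𝓝[Icc 0 1] 0 := by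
      rw [← nhdsWithin_Ioo_eq_nhdsGT (zero_lt_one' ℝ)]
      exact nhdsWithin_mono _ Ioo_subset_Icc_self
    simpa using h2.tendsto.mono_left hle
  simpa using h3.sqrt

/-- By Cauchy-Schwarz the powers are (3 + α)/2 from the L² norm of `domSol` on (0, x] and -α/2 from
`recSol`, together 3/2. The L² norm of h near the origin is kept because it turns O into o. -/
theorem integral_domSol_mul_recSol_le (hα0 : 0 ≤ α) (hk : k ≠ 0) (hh : MemLp h 2 leb)
    (hx : 0 < x) :
    ‖(∫ t in (0 : ℝ)..x, (domSol α k t : ℂ) * h t) * recSol α k x‖ ≤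
      Real.exp (phase α k x) * √(∫ t in Ioc 0 x, ‖h t‖ ^ 2) * x ^ (3 / 2 : ℝ) := by
  have h1 := norm_integral_ofReal_mul_le (memLp_domSol hα0 hk hx) (memLp_Ioc hh x)
  have h2 : √(∫ t in Ioc 0 x, domSol α k t ^ 2) ≤
      Real.exp (phase α k x) * x ^ ((3 + α) / 2) := by
    refine Real.sqrt_le_iff.2 ⟨by positivity, (integral_sq_domSol_le hα0 hk hx).trans (le_of_eq ?_)⟩
    rw [mul_pow, ← Real.exp_nat_mul, ← Real.rpow_natCast (x ^ _), ← Real.rpow_mul hx.le]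
    push_cast
    ring_nf
  rw [intervalIntegral.integral_of_le hx.le, norm_mul, Complex.norm_real,
    Real.norm_of_nonneg (recSol_pos hx).le]
  calc _ ≤ (Real.exp (phase α k x) * x ^ ((3 + α) / 2) * √(∫ t in Ioc 0 x, ‖h t‖ ^ 2)) *
        x ^ (-α / 2) := by
        gcongr
        · exact (recSol_pos hx).le
        · exact h1.trans (by gcongr)
        · exact recSol_le hα0 hx
    _ = Real.exp (phase α k x) * √(∫ t in Ioc 0 x, ‖h t‖ ^ 2) *
        (x ^ ((3 + α) / 2) * x ^ (-α / 2)) := by ring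
    _ = _ := by
        rw [← Real.rpow_add hx]
        ring_nf

/-- Here the powers are (1 - α)/2 and 1 + α/2, again with sum 3/2. -/
theorem integral_recSol_mul_domSol_le (hα0 : 0 ≤ α) (hα1 : α < 1) (hk : k ≠ 0)
    (hh : MemLp h 2 leb) (hx : 0 < x) :
    ‖(∫ t in (0 : ℝ)..x, -((recSol α k t : ℂ) * h t)) * domSol α k x‖ ≤
      √(1 / (1 - α)) * Real.exp (phase α k x) * √(∫ t in Ioc 0 x, ‖h t‖ ^ 2) *
        x ^ (3 / 2 : ℝ) := by
  have hα : 0 < 1 - α := by linarith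
  have h1 := norm_integral_ofReal_mul_le ((memLp_recSol hα0 hα1 hk).mono_measure
    (Measure.restrict_mono Ioc_subset_Ioi_self le_rfl)) (memLp_Ioc hh x)
  have h2 : √(∫ t in Ioc 0 x, recSol α k t ^ 2) ≤ √(1 / (1 - α)) * x ^ ((1 - α) / 2) := by
    refine Real.sqrt_le_iff.2 ⟨by positivity,
      (integral_sq_recSol_le hα0 hα1 hk hx).trans (le_of_eq ?_)⟩
    rw [mul_pow, Real.sq_sqrt (by positivity), ← Real.rpow_natCast (x ^ _), ← Real.rpow_mul hx.le]
    push_cast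
    ring_nf
  rw [intervalIntegral.integral_neg, neg_mul, norm_neg, intervalIntegral.integral_of_le hx.le,
    norm_mul, Complex.norm_real, Real.norm_of_nonneg (domSol_nonneg hα0 hx)]
  calc _ ≤ (√(1 / (1 - α)) * x ^ ((1 - α) / 2) * √(∫ t in Ioc 0 x, ‖h t‖ ^ 2)) *
        (x ^ (1 + α / 2) * Real.exp (phase α k x)) := by
        gcongr
        · exact domSol_nonneg hα0 hx
        · exact h1.trans (by gcongr)
        · exact domSol_le hα0 hk hx
    _ = √(1 / (1 - α)) * Real.exp (phase α k x) * √(∫ t in Ioc 0 x, ‖h t‖ ^ 2) *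
        (x ^ ((1 - α) / 2) * x ^ (1 + α / 2)) := by ring
    _ = _ := by
        rw [← Real.rpow_add hx]
        ring_nf

/-- The shift by a|k| in the second coefficient is the first-order term of exp(-phase) in `recSol`;
the two integral terms only enter the remainder. -/
theorem repSol_asymp (hα0 : 0 ≤ α) (hα1 : α < 1) (hk : k ≠ 0) (hh : MemLp h 2 leb) (a b : ℂ) :
    (fun x => repSol α k h a b x - (a * (x ^ (-α / 2) : ℝ) +
      (b - a * |(k : ℝ)|) / (1 + α) * (x ^ (1 + α / 2) : ℝ)))
      =o[𝓝[>] (0 : ℝ)] fun x : ℝ => x ^ (3 / 2 : ℝ) := by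
  have ofR : ∀ {f : ℝ → ℝ} (c : ℂ), f =o[𝓝[>] (0 : ℝ)] (fun x : ℝ => x ^ (3 / 2 : ℝ)) →
      (fun x => c * (f x : ℂ)) =o[𝓝[>] (0 : ℝ)] fun x : ℝ => x ^ (3 / 2 : ℝ) := by
    intro f c hf
    refine Asymptotics.IsLittleO.const_mul_left (Asymptotics.IsLittleO.of_norm_left ?_) c
    simpa only [Complex.norm_real] using hf.norm_left
  have t1 := ofR a (recSol_asymp (k := k) hα0)
  have t2 := ofR b (domSol_asymp hα0 hk)
  have he : ∀ᶠ x in 𝓝[>] (0 : ℝ), Real.exp (phase α k x) ≤ Real.exp 1 :=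
    (eventually_phase_le hα0).mono fun x hx => Real.exp_le_exp.2 hx
  have small : ∀ C : ℝ, (fun x => C * √(∫ t in Ioc 0 x, ‖h t‖ ^ 2) * x ^ (3 / 2 : ℝ))
      =o[𝓝[>] (0 : ℝ)] fun x : ℝ => x ^ (3 / 2 : ℝ) := by
    intro C
    have h0 := (tendsto_integral_Ioc_norm_sq hh).const_mul C
    rw [mul_zero] at h0
    have h1 := ((Asymptotics.isLittleO_one_iff ℝ).2 h0).mul_isBigO
      (Asymptotics.isBigO_refl (fun x : ℝ => x ^ (3 / 2 : ℝ)) (𝓝[>] 0))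
    simpa only [one_mul] using h1
  have t3 : (fun x => (∫ t in (0 : ℝ)..x, (domSol α k t : ℂ) * h t) * recSol α k x)
      =o[𝓝[>] (0 : ℝ)] fun x : ℝ => x ^ (3 / 2 : ℝ) := by
    refine Asymptotics.IsBigO.trans_isLittleO (Asymptotics.IsBigO.of_bound 1 ?_)
      (small (Real.exp 1))
    filter_upwards [self_mem_nhdsWithin, he] with x hx hx'
    have hx : 0 < x := hx
    refine (integral_domSol_mul_recSol_le hα0 hk hh hx).trans ?_
    rw [one_mul, Real.norm_of_nonneg (by positivity)]
    gcongr
  have t4 : (fun x => (∫ t in (0 : ℝ)..x, -((recSol α k t : ℂ) * h t)) * domSol α k x)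
      =o[𝓝[>] (0 : ℝ)] fun x : ℝ => x ^ (3 / 2 : ℝ) := by
    refine Asymptotics.IsBigO.trans_isLittleO (Asymptotics.IsBigO.of_bound 1 ?_)
      (small (√(1 / (1 - α)) * Real.exp 1))
    filter_upwards [self_mem_nhdsWithin, he] with x hx hx'
    have hx : 0 < x := hx
    refine (integral_recSol_mul_domSol_le hα0 hα1 hk hh hx).trans ?_
    rw [one_mul, Real.norm_of_nonneg (by positivity)]
    gcongr
  refine (((t1.add t2).add t3).add t4).congr_left fun x => ?_
  have h1 : (1 + α : ℂ) ≠ 0 := by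
    have : (1 + α : ℝ) ≠ 0 := by positivity
    exact_mod_cast this
  simp only [repSol]
  push_cast
  field_simp
  ring

theorem eqOn_of_ae_eq {f g : ℝ → ℂ} (hf : ContinuousOn f (Ioi 0)) (hg : ContinuousOn g (Ioi 0))
    (hfg : f =ᵐ[leb] g) : EqOn f g (Ioi 0) :=
  Measure.eqOn_open_of_ae_eq hfg isOpen_Ioi hf hg

/-- The expansion of an element at the origin determines its coefficients. -/
theorem coeff_eq_of_asymp (hα0 : 0 ≤ α) (hα1 : α < 1) (hk : k ≠ 0) (hh : MemLp h 2 leb) {a b : ℂ}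
    {f : ℝ → ℂ} (hf : ContinuousOn f (Ioi 0)) (hfr : f =ᵐ[leb] repSol α k h a b) {p q : ℂ}
    (ho : (fun x => f x - (p * (x ^ (-α / 2) : ℝ) + q * (x ^ (1 + α / 2) : ℝ)))
      =o[𝓝[>] (0 : ℝ)] fun x : ℝ => x ^ (3 / 2 : ℝ)) :
    a = p ∧ (b - a * |(k : ℝ)|) / (1 + α) = q := by
  have h1 := eqOn_of_ae_eq hf (continuousOn_repSol hα0 hα1 hk hh a b) hfr
  have h2 := ho.sub (repSol_asymp hα0 hα1 hk hh a b)
  have h3 := eq_zero_of_isLittleO (p := a - p) (q := (b - a * |(k : ℝ)|) / (1 + α) - q) hα0 hα1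
    (h2.congr' (by
      filter_upwards [self_mem_nhdsWithin] with x hx
      rw [h1 hx]
      ring) EventuallyEq.rfl)
  exact ⟨sub_eq_zero.1 h3.1, sub_eq_zero.1 h3.2⟩

theorem coeff_unique (hα0 : 0 ≤ α) (hα1 : α < 1) (hk : k ≠ 0) (hh : MemLp h 2 leb)
    {a b a' b' : ℂ} (he : repSol α k h a b =ᵐ[leb] repSol α k h a' b') : a = a' ∧ b = b' := by
  have h1 := coeff_eq_of_asymp hα0 hα1 hk hh (continuousOn_repSol hα0 hα1 hk hh a b) he
    (repSol_asymp hα0 hα1 hk hh a b)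
  refine ⟨h1.1.symm, ?_⟩
  have h2 : (1 + α : ℂ) ≠ 0 := by
    have : (1 + α : ℝ) ≠ 0 := by positivity
    exact_mod_cast this
  have h3 := h1.2
  rw [h1.1, div_left_inj' h2] at h3
  linear_combination -h3

/-! ### Behaviour at infinity -/

theorem exists_norm_coeff_le (hα0 : 0 ≤ α) (hk : k ≠ 0) (hh : MemLp h 2 leb) (a : ℂ) :
    ∃ M : ℝ, 0 ≤ M ∧ ∀ x, 1 ≤ x →
      ‖a + ∫ t in (0 : ℝ)..x, (domSol α k t : ℂ) * h t‖ ≤ M * Real.exp (phase α k x) := by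
  obtain ⟨C, hC, hC'⟩ := exists_integral_sq_domSol_le hα0 hk (α := α)
  refine ⟨‖a‖ + √C * √(∫ t in Ioi 0, ‖h t‖ ^ 2), by positivity, fun x hx => ?_⟩
  have hx0 : 0 < x := by linarith
  have h1 := norm_integral_ofReal_mul_le (memLp_domSol hα0 hk hx0) (memLp_Ioc hh x)
  have h2 : √(∫ t in Ioc 0 x, domSol α k t ^ 2) ≤ √C * Real.exp (phase α k x) := by
    refine Real.sqrt_le_iff.2 ⟨by positivity, (hC' x hx).trans (le_of_eq ?_)⟩
    rw [mul_pow, Real.sq_sqrt hC, ← Real.exp_nat_mul]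
    push_cast
    ring_nf
  have h3 : √(∫ t in Ioc 0 x, ‖h t‖ ^ 2) ≤ √(∫ t in Ioi 0, ‖h t‖ ^ 2) :=
    Real.sqrt_le_sqrt (setIntegral_mono_set (integrableOn_norm_sq hh)
      (ae_of_all _ fun _ => sq_nonneg _) Ioc_subset_Ioi_self.eventuallyLE)
  have h4 : 1 ≤ Real.exp (phase α k x) := Real.one_le_exp (phase_nonneg hα0 hx0)
  rw [intervalIntegral.integral_of_le hx0.le, add_mul]
  refine (norm_add_le _ _).trans (add_le_add (le_mul_of_one_le_right (norm_nonneg _) h4) ?_)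
  calc _ ≤ (√C * Real.exp (phase α k x)) * √(∫ t in Ioi 0, ‖h t‖ ^ 2) := by
        refine h1.trans ?_
        gcongr
    _ = _ := by ring

theorem tendsto_domSol_atTop (hα0 : 0 ≤ α) (hk : k ≠ 0) : Tendsto (domSol α k) atTop atTop := by
  have h0 : 0 < |(k : ℝ)| := by simpa using hk
  have h1 : Tendsto (fun x : ℝ => 1 / (1 + α) * x ^ (1 + α / 2)) atTop atTop :=
    (tendsto_rpow_atTop (by linarith)).const_mul_atTop (by positivity)
  refine tendsto_atTop_mono' _ ?_ h1
  filter_upwards [eventually_gt_atTop 0] with x hx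
  rw [domSol, le_div_iff₀ h0]
  calc 1 / (1 + α) * x ^ (1 + α / 2) * |(k : ℝ)| = x ^ (-α / 2) * phase α k x := by
        rw [rpow_neg_half_mul_phase hx]; ring
    _ ≤ _ := by
        gcongr
        exact Real.self_le_sinh_iff.2 (phase_nonneg hα0 hx)

/-- Otherwise the coefficient of `domSol` would tend to a nonzero limit while `domSol` tends to
infinity. The `recSol` part stays bounded, so the solution would eventually have modulus at least 1,
which is impossible in L². -/
theorem eq_integral_of_memLp_repSol (hα0 : 0 ≤ α) (hα1 : α < 1) (hk : k ≠ 0) (hh : MemLp h 2 leb)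
    {a b : ℂ} (hr : MemLp (repSol α k h a b) 2 leb) :
    b = ∫ t in Ioi 0, (recSol α k t : ℂ) * h t := by
  by_contra hne
  obtain ⟨M, hM, hM'⟩ := exists_norm_coeff_le hα0 hk hh a
  have ht : Tendsto (fun x => b + ∫ t in (0 : ℝ)..x, -((recSol α k t : ℂ) * h t)) atTop
      (𝓝 (b - ∫ t in Ioi 0, (recSol α k t : ℂ) * h t)) := by
    rw [sub_eq_add_neg, ← integral_neg]
    exact tendsto_const_nhds.add (intervalIntegral_tendsto_integral_Ioi 0
      (integrableOn_recSol_mul hα0 hα1 hk hh).neg tendsto_id)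
  have hp : 0 < ‖b - ∫ t in Ioi 0, (recSol α k t : ℂ) * h t‖ :=
    norm_pos_iff.2 (sub_ne_zero.2 hne)
  have hd : Tendsto (fun x => ‖b + ∫ t in (0 : ℝ)..x, -((recSol α k t : ℂ) * h t)‖ *
      domSol α k x) atTop atTop := ht.norm.pos_mul_atTop hp (tendsto_domSol_atTop hα0 hk)
  have hev : ∀ᶠ x in atTop, 1 ≤ ‖repSol α k h a b x‖ ^ 2 := by
    filter_upwards [hd.eventually_ge_atTop (M + 1), eventually_ge_atTop 1] with x hx hx1
    have hx0 : 0 < x := by linarith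
    have h1 : ‖(a + ∫ t in (0 : ℝ)..x, (domSol α k t : ℂ) * h t) * recSol α k x‖ ≤ M := by
      rw [norm_mul, Complex.norm_real, Real.norm_of_nonneg (recSol_pos hx0).le]
      have e : x ^ (-α / 2) ≤ 1 := Real.rpow_le_one_of_one_le_of_nonpos hx1 (by linarith)
      calc _ ≤ M * Real.exp (phase α k x) * (x ^ (-α / 2) * Real.exp (-phase α k x)) := by
            gcongr
            · exact (recSol_pos hx0).le
            · exact hM' x hx1
            · exact le_rfl
        _ = M * x ^ (-α / 2) * (Real.exp (phase α k x) * Real.exp (-phase α k x)) := by ring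
        _ = M * x ^ (-α / 2) := by rw [← Real.exp_add, add_neg_cancel, Real.exp_zero, mul_one]
        _ ≤ M := mul_le_of_le_one_right hM e
    have h2 : M + 1 ≤ ‖(b + ∫ t in (0 : ℝ)..x, -((recSol α k t : ℂ) * h t)) * domSol α k x‖ := by
      rw [norm_mul, Complex.norm_real, Real.norm_of_nonneg (domSol_nonneg hα0 hx0)]
      exact hx
    have h3 := norm_sub_le_norm_add
      ((b + ∫ t in (0 : ℝ)..x, -((recSol α k t : ℂ) * h t)) * domSol α k x)
      ((a + ∫ t in (0 : ℝ)..x, (domSol α k t : ℂ) * h t) * recSol α k x)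
    rw [add_comm (_ * (domSol α k x : ℂ))] at h3
    refine one_le_pow₀ (le_trans ?_ h3)
    linarith
  obtain ⟨X, hX⟩ := eventually_atTop.1 hev
  have hi : IntegrableOn (fun x => ‖repSol α k h a b x‖ ^ 2) (Ioi (max X 0)) :=
    (integrableOn_norm_sq hr).mono_set (Ioi_subset_Ioi (le_max_right _ _))
  have h1 : IntegrableOn (fun _ : ℝ => (1 : ℝ)) (Ioi (max X 0)) := by
    refine Integrable.mono' hi aestronglyMeasurable_const ?_
    refine (ae_restrict_mem measurableSet_Ioi).mono fun x hx => ?_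
    rw [norm_one]
    exact hX x ((le_max_left _ _).trans (le_of_lt hx))
  rw [integrableOn_const_iff] at h1
  simp at h1

theorem tendsto_integral_Ioi_norm_sq (hh : MemLp h 2 leb) :
    Tendsto (fun x => √(∫ t in Ioi x, ‖h t‖ ^ 2)) atTop (𝓝 0) := by
  have h1 := intervalIntegral_tendsto_integral_Ioi 0 (integrableOn_norm_sq hh) tendsto_id
  have h2 := h1.const_sub (∫ t in Ioi 0, ‖h t‖ ^ 2)
  rw [sub_self] at h2
  have h3 : Tendsto (fun x => ∫ t in Ioi x, ‖h t‖ ^ 2) atTop (𝓝 0) := by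
    refine h2.congr' ?_
    filter_upwards [eventually_ge_atTop 0] with x hx
    rw [id, intervalIntegral.integral_of_le hx, ← Ioc_union_Ioi_eq_Ioi hx, setIntegral_union
      (Ioc_disjoint_Ioi le_rfl) measurableSet_Ioi
      ((integrableOn_norm_sq hh).mono_set Ioc_subset_Ioi_self)
      ((integrableOn_norm_sq hh).mono_set (Ioi_subset_Ioi hx))]
    ring
  simpa using h3.sqrt

/-- The first coefficient is O(exp(phase)). By `eq_integral_of_memLp_repSol` the second is a tail
integral, of size exp(-phase) times the vanishing L² tail of l, so the exponentials cancel. -/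
theorem tendsto_coeff_mul_coeff (hα0 : 0 ≤ α) (hα1 : α < 1) (hk : k ≠ 0) (hh : MemLp h 2 leb)
    (hl : MemLp l 2 leb) (a : ℂ) {a' b' : ℂ} (hr : MemLp (repSol α k l a' b') 2 leb) :
    Tendsto (fun x => (a + ∫ t in (0 : ℝ)..x, (domSol α k t : ℂ) * h t) *
      (b' + ∫ t in (0 : ℝ)..x, -((recSol α k t : ℂ) * l t))) atTop (𝓝 0) := by
  have h0 : 0 < |(k : ℝ)| := by simpa using hk
  obtain ⟨M, hM, hM'⟩ := exists_norm_coeff_le hα0 hk hh a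
  have hb := eq_integral_of_memLp_repSol hα0 hα1 hk hl hr
  have ht := (tendsto_integral_Ioi_norm_sq hl).const_mul (M * √(1 / (2 * |(k : ℝ)|)))
  rw [mul_zero] at ht
  refine squeeze_zero_norm' ?_ ht
  filter_upwards [eventually_ge_atTop 1] with x hx
  have hx0 : 0 < x := by linarith
  have hi := integrableOn_recSol_mul hα0 hα1 hk hl
  have e1 : b' + ∫ t in (0 : ℝ)..x, -((recSol α k t : ℂ) * l t) =
      ∫ t in Ioi x, (recSol α k t : ℂ) * l t := by
    rw [hb, intervalIntegral.integral_neg, intervalIntegral.integral_of_le hx0.le,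
      ← Ioc_union_Ioi_eq_Ioi hx0.le, setIntegral_union (Ioc_disjoint_Ioi le_rfl) measurableSet_Ioi
      (hi.mono_set Ioc_subset_Ioi_self) (hi.mono_set (Ioi_subset_Ioi hx0.le))]
    ring
  have hmono : volume.restrict (Ioi x) ≤ leb :=
    Measure.restrict_mono (Ioi_subset_Ioi hx0.le) le_rfl
  have h1 := norm_integral_ofReal_mul_le ((memLp_recSol hα0 hα1 hk).mono_measure hmono)
    (hl.mono_measure hmono)
  have h2 : √(∫ t in Ioi x, recSol α k t ^ 2) ≤
      √(1 / (2 * |(k : ℝ)|)) * Real.exp (-phase α k x) := by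
    refine Real.sqrt_le_iff.2 ⟨by positivity,
      (integral_sq_recSol_Ioi_le hα0 hα1 hk hx).trans (le_of_eq ?_)⟩
    rw [mul_pow, Real.sq_sqrt (by positivity), ← Real.exp_nat_mul]
    push_cast
    ring_nf
  rw [norm_mul, e1]
  calc _ ≤ (M * Real.exp (phase α k x)) * ((√(1 / (2 * |(k : ℝ)|)) * Real.exp (-phase α k x)) *
        √(∫ t in Ioi x, ‖l t‖ ^ 2)) := by
        gcongr
        · exact hM' x hx
        · exact h1.trans (by gcongr)
    _ = M * √(1 / (2 * |(k : ℝ)|)) * √(∫ t in Ioi x, ‖l t‖ ^ 2) *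
        (Real.exp (phase α k x) * Real.exp (-phase α k x)) := by ring
    _ = _ := by rw [← Real.exp_add, add_neg_cancel, Real.exp_zero, mul_one]

/-! ### Green's identity -/

/-- Let P, Q and P', Q' be the coefficient functions of the two solutions. The integrand is the
derivative of P Q' - Q P', whose value at the origin is a b' - b a' and whose limit at infinity is
0. -/
theorem integral_green (hα0 : 0 ≤ α) (hα1 : α < 1) (hk : k ≠ 0) (hh : MemLp h 2 leb)
    (hl : MemLp l 2 leb) {a b a' b' : ℂ} (hr : MemLp (repSol α k h a b) 2 leb)
    (hr' : MemLp (repSol α k l a' b') 2 leb) :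
    ∫ x in Ioi (0 : ℝ), (h x * repSol α k l a' b' x - repSol α k h a b x * l x) =
      b * a' - a * b' := by
  have hi : IntegrableOn (fun x => h x * repSol α k l a' b' x - repSol α k h a b x * l x)
      (Ioi 0) := (hh.integrable_mul hr').sub (hr.integrable_mul hl)
  have t1 := intervalIntegral_tendsto_integral_Ioi 0 hi tendsto_id
  have t2 := ((tendsto_coeff_mul_coeff hα0 hα1 hk hh hl a hr').sub
    (tendsto_coeff_mul_coeff hα0 hα1 hk hl hh a' hr)).add_const (b * a' - a * b')
  rw [sub_zero, zero_add] at t2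
  refine tendsto_nhds_unique t1 (t2.congr' ?_)
  filter_upwards [eventually_gt_atTop 0] with R hR
  have i1 := intervalIntegrable_domSol_mul (k := k) hα0 hk hh hR
  have i2 : IntervalIntegrable (fun t => -((recSol α k t : ℂ) * h t)) volume 0 R :=
    (intervalIntegrable_recSol_mul hα0 hα1 hk hh hR.le).neg
  have j1 := intervalIntegrable_domSol_mul (k := k) hα0 hk hl hR
  have j2 : IntervalIntegrable (fun t => -((recSol α k t : ℂ) * l t)) volume 0 R :=
    (intervalIntegrable_recSol_mul hα0 hα1 hk hl hR.le).neg
  have e1 := integral_mul_add_mul_eq a b' i1 j2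
  have e2 := integral_mul_add_mul_eq a' b j1 i2
  have cont : ∀ (c : ℂ) {f : ℝ → ℂ}, IntervalIntegrable f volume 0 R →
      ContinuousOn (fun x => c + ∫ t in (0 : ℝ)..x, f t) (uIcc 0 R) := fun c f hf =>
    continuousOn_const.add (intervalIntegral.continuousOn_primitive_interval' hf left_mem_uIcc)
  have k1 := (i1.mul_continuousOn (cont b' j2)).add (j2.continuousOn_mul (cont a i1))
  have k2 := (j1.mul_continuousOn (cont b i2)).add (i2.continuousOn_mul (cont a' j1))
  have e3 := intervalIntegral.integral_sub k1 k2
  rw [e1, e2] at e3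
  have e4 : (∫ x in (0 : ℝ)..id R, (h x * repSol α k l a' b' x - repSol α k h a b x * l x)) =
      (a + ∫ t in (0 : ℝ)..R, (domSol α k t : ℂ) * h t) *
        (b' + ∫ t in (0 : ℝ)..R, -((recSol α k t : ℂ) * l t)) - a * b' -
      ((a' + ∫ t in (0 : ℝ)..R, (domSol α k t : ℂ) * l t) *
        (b + ∫ t in (0 : ℝ)..R, -((recSol α k t : ℂ) * h t)) - a' * b) := by
    rw [← e3]
    refine intervalIntegral.integral_congr fun x _ => ?_
    simp only [repSol]
    ring
  rw [e4]
  ring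


variable {α : ℝ} {k : ℤ} {h l : ℝ → ℂ} {x : ℝ}

/-! ### Boundary values of elements of the domain of the adjoint -/

theorem repSol_add (hα0 : 0 ≤ α) (hα1 : α < 1) (hk : k ≠ 0) (hh : MemLp h 2 leb)
    (hl : MemLp l 2 leb) (a b a' b' : ℂ) (hx : 0 < x) :
    repSol α k (h + l) (a + a') (b + b') x = repSol α k h a b x + repSol α k l a' b' x := by
  have e1 := intervalIntegral.integral_add (intervalIntegrable_domSol_mul (k := k) hα0 hk hh hx)
    (intervalIntegrable_domSol_mul (k := k) hα0 hk hl hx)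
  have e2 := intervalIntegral.integral_add
    (intervalIntegrable_recSol_mul (k := k) hα0 hα1 hk hh hx.le)
    (intervalIntegrable_recSol_mul (k := k) hα0 hα1 hk hl hx.le)
  simp only [repSol, Pi.add_apply, mul_add, intervalIntegral.integral_neg, e1, e2]
  ring

theorem repSol_smul (c a b : ℂ) (x : ℝ) :
    repSol α k (c • h) (c * a) (c * b) x = c * repSol α k h a b x := by
  have e : ∀ u : ℝ → ℝ, ∫ t in (0 : ℝ)..x, (u t : ℂ) * (c * h t) =
      c * ∫ t in (0 : ℝ)..x, (u t : ℂ) * h t := by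
    intro u
    rw [← intervalIntegral.integral_const_mul]
    refine intervalIntegral.integral_congr fun t _ => ?_
    ring
  simp only [repSol, Pi.smul_apply, smul_eq_mul, intervalIntegral.integral_neg, e]
  ring

theorem repSol_congr {h' : ℝ → ℂ} (hh : h =ᵐ[leb] h') (a b : ℂ) (hx : 0 < x) :
    repSol α k h a b x = repSol α k h' a b x := by
  have hh' : ∀ᵐ t, t ∈ Ioi (0 : ℝ) → h t = h' t := (ae_restrict_iff' measurableSet_Ioi).1 hh
  have e : ∀ u : ℝ → ℝ, ∫ t in (0 : ℝ)..x, (u t : ℂ) * h t =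
      ∫ t in (0 : ℝ)..x, (u t : ℂ) * h' t := by
    intro u
    refine intervalIntegral.integral_congr_ae ?_
    filter_upwards [hh'] with t ht ht'
    rw [uIoc_of_le hx.le] at ht'
    rw [ht ht'.1]
  simp only [repSol, intervalIntegral.integral_neg, e]

theorem conj_repSol (a b : ℂ) (x : ℝ) :
    conj (repSol α k h a b x) = repSol α k (fun t => conj (h t)) (conj a) (conj b) x := by
  have e : ∀ u : ℝ → ℝ, conj (∫ t in (0 : ℝ)..x, (u t : ℂ) * h t) =
      ∫ t in (0 : ℝ)..x, (u t : ℂ) * conj (h t) := by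
    intro u
    rw [← intervalIntegral.intervalIntegral_conj]
    simp only [map_mul, Complex.conj_ofReal]
  simp only [repSol, map_add, map_mul, Complex.conj_ofReal, intervalIntegral.integral_neg, map_neg,
    e]

/-- `g` has the boundary values `a`, `b` at the origin. -/
def HasCoeff (α : ℝ) (k : ℤ) (g : (op α k)†.domain) (a b : ℂ) : Prop :=
  (g : L2) =ᵐ[leb] repSol α k ((op α k)† g) a b

theorem ae_leb_of_forall {p : ℝ → Prop} (hp : ∀ x, 0 < x → p x) : ∀ᵐ x ∂leb, p x :=
  (ae_restrict_mem measurableSet_Ioi).mono fun x hx => hp x hx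

theorem exists_hasCoeff (hα0 : 0 ≤ α) (hα1 : α < 1) (hk : k ≠ 0) (g : (op α k)†.domain) :
    ∃ p : ℂ × ℂ, HasCoeff α k g p.1 p.2 := by
  obtain ⟨a, b, hab⟩ := exists_ae_eq_repSol hα0 hα1 hk (Lp.memLp ((op α k)† g))
    (locallyIntegrableOn_L2 _) (isSol_adjoint g)
  exact ⟨(a, b), hab⟩

theorem HasCoeff.unique (hα0 : 0 ≤ α) (hα1 : α < 1) (hk : k ≠ 0) {g : (op α k)†.domain}
    {a b a' b' : ℂ} (h1 : HasCoeff α k g a b) (h2 : HasCoeff α k g a' b') :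
    a = a' ∧ b = b' :=
  coeff_unique hα0 hα1 hk (Lp.memLp _) (h1.symm.trans h2)

theorem HasCoeff.add (hα0 : 0 ≤ α) (hα1 : α < 1) (hk : k ≠ 0) {g g' : (op α k)†.domain}
    {a b a' b' : ℂ} (h1 : HasCoeff α k g a b) (h2 : HasCoeff α k g' a' b') :
    HasCoeff α k (g + g') (a + a') (b + b') := by
  have e1 := Lp.coeFn_add ((op α k)† g) ((op α k)† g')
  have e2 := Lp.coeFn_add (g : L2) (g' : L2)
  rw [HasCoeff, LinearPMap.map_add]
  filter_upwards [h1, h2, e2, ae_leb_of_forall (fun x hx => hx)] with x k1 k2 k3 hx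
  rw [repSol_congr e1 _ _ hx, repSol_add hα0 hα1 hk (Lp.memLp _) (Lp.memLp _) _ _ _ _ hx, ← k1,
    ← k2]
  exact k3

theorem HasCoeff.smul {g : (op α k)†.domain} {a b : ℂ} (h1 : HasCoeff α k g a b) (c : ℂ) :
    HasCoeff α k (c • g) (c * a) (c * b) := by
  have e1 := Lp.coeFn_smul c ((op α k)† g)
  have e2 := Lp.coeFn_smul c (g : L2)
  rw [HasCoeff, LinearPMap.map_smul]
  filter_upwards [h1, e2, ae_leb_of_forall (fun x hx => hx)] with x k1 k3 hx
  rw [repSol_congr e1 _ _ hx, repSol_smul, ← k1]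
  exact k3

/-- The pair of boundary values as a linear map. -/
def coeffMap (hα0 : 0 ≤ α) (hα1 : α < 1) (hk : k ≠ 0) : (op α k)†.domain →ₗ[ℂ] ℂ × ℂ where
  toFun g := (exists_hasCoeff hα0 hα1 hk g).choose
  map_add' g g' := by
    have := HasCoeff.unique hα0 hα1 hk (exists_hasCoeff hα0 hα1 hk (g + g')).choose_spec
      ((exists_hasCoeff hα0 hα1 hk g).choose_spec.add hα0 hα1 hk
        (exists_hasCoeff hα0 hα1 hk g').choose_spec)
    exact Prod.ext this.1 this.2
  map_smul' c g := by
    have := HasCoeff.unique hα0 hα1 hk (exists_hasCoeff hα0 hα1 hk (c • g)).choose_spec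
      ((exists_hasCoeff hα0 hα1 hk g).choose_spec.smul c)
    exact Prod.ext this.1 this.2

/-- The coefficient of `recSol`. -/
def coeffA (hα0 : 0 ≤ α) (hα1 : α < 1) (hk : k ≠ 0) : (op α k)†.domain →ₗ[ℂ] ℂ :=
  LinearMap.fst ℂ ℂ ℂ ∘ₗ coeffMap hα0 hα1 hk

/-- The coefficient of `domSol`. -/
def coeffB (hα0 : 0 ≤ α) (hα1 : α < 1) (hk : k ≠ 0) : (op α k)†.domain →ₗ[ℂ] ℂ :=
  LinearMap.snd ℂ ℂ ℂ ∘ₗ coeffMap hα0 hα1 hk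

theorem hasCoeff_coeff (hα0 : 0 ≤ α) (hα1 : α < 1) (hk : k ≠ 0) (g : (op α k)†.domain) :
    HasCoeff α k g (coeffA hα0 hα1 hk g) (coeffB hα0 hα1 hk g) :=
  (exists_hasCoeff hα0 hα1 hk g).choose_spec

theorem HasCoeff.coeff_eq (hα0 : 0 ≤ α) (hα1 : α < 1) (hk : k ≠ 0) {g : (op α k)†.domain}
    {a b : ℂ} (h : HasCoeff α k g a b) :
    coeffA hα0 hα1 hk g = a ∧ coeffB hα0 hα1 hk g = b :=
  (hasCoeff_coeff hα0 hα1 hk g).unique hα0 hα1 hk h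

/-- Variation of parameters gives elements of the domain of the adjoint. -/
theorem mem_adjoint_of_repSol (hα0 : 0 ≤ α) (hα1 : α < 1) (hk : k ≠ 0) {g h : L2} {a b : ℂ}
    (hg : g =ᵐ[leb] repSol α k h a b) :
    ∃ hd : g ∈ (op α k)†.domain, (op α k)† ⟨g, hd⟩ = h ∧ HasCoeff α k ⟨g, hd⟩ a b := by
  have hs : IsSol α k g h := fun φ => by
    rw [← isSol_repSol hα0 hα1 hk (Lp.memLp h) a b φ]
    refine integral_congr_ae ?_
    filter_upwards [hg] with x hx
    rw [hx]
  refine ⟨mem_adjoint_domain_of_isSol hs, adjoint_eq_of_isSol hs _, ?_⟩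
  rw [HasCoeff, adjoint_eq_of_isSol hs]
  exact hg

theorem green_identity (hα0 : 0 ≤ α) (hα1 : α < 1) (hk : k ≠ 0) (f g : (op α k)†.domain) :
    inner ℂ ((op α k)† f) (g : L2) - inner ℂ (f : L2) ((op α k)† g) =
      conj (coeffB hα0 hα1 hk f) * coeffA hα0 hα1 hk g -
        conj (coeffA hα0 hα1 hk f) * coeffB hα0 hα1 hk g := by
  have hf := hasCoeff_coeff hα0 hα1 hk f
  have hg := hasCoeff_coeff hα0 hα1 hk g
  have mf : MemLp (fun x => conj ((op α k)† f x)) 2 leb := (Lp.memLp ((op α k)† f)).star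
  have hf' : (fun x => conj ((f : L2) x)) =ᵐ[leb] repSol α k (fun x => conj ((op α k)† f x))
      (conj (coeffA hα0 hα1 hk f)) (conj (coeffB hα0 hα1 hk f)) := by
    filter_upwards [hf] with x hx
    rw [hx, conj_repSol]
  have mf' : MemLp (fun x => conj ((f : L2) x)) 2 leb := (Lp.memLp (f : L2)).star
  have hgr := integral_green hα0 hα1 hk mf (Lp.memLp ((op α k)† g)) (mf'.ae_eq hf')
    ((Lp.memLp (g : L2)).ae_eq hg)
  rw [← hgr, L2.inner_def, L2.inner_def, ← integral_sub]
  · refine integral_congr_ae ?_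
    filter_upwards [hf', hg] with x h1 h2
    rw [RCLike.inner_apply, RCLike.inner_apply, ← h1, ← h2]
    ring
  · exact L2.integrable_inner _ _
  · exact L2.integrable_inner _ _

end HalfLine

/-! ### Bessel functions of order one half -/

/-- The substitution u = sinh(t/2), with cosh t = 1 + 2u², gives a Gaussian integral; cosh(t/2)
supplies the Jacobian. -/
theorem besselK_half (z : ℝ) :
    besselK (1 / 2) z = √(Real.pi / (2 * z)) * Real.exp (-z) := by
  have himg : (fun t : ℝ => Real.sinh (t / 2)) '' Ioi 0 = Ioi 0 := by
    ext y
    constructor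
    · rintro ⟨t, ht, rfl⟩
      exact Real.sinh_pos_iff.2 (half_pos ht)
    · intro hy
      refine ⟨2 * Real.arsinh y, ?_, ?_⟩
      · have := Real.arsinh_pos_iff.2 hy
        exact mul_pos two_pos this
      · simp [Real.sinh_arsinh]
  have hd : ∀ t ∈ Ioi (0 : ℝ), HasDerivWithinAt (fun t : ℝ => Real.sinh (t / 2))
      (Real.cosh (t / 2) / 2) (Ioi 0) t := fun t _ => by
    have := ((hasDerivAt_id t).div_const 2).sinh
    refine (this.congr_deriv ?_).hasDerivWithinAt
    simp only [id]
    ring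
  have hinj : InjOn (fun t : ℝ => Real.sinh (t / 2)) (Ioi 0) := fun s _ t _ hst => by
    have := Real.sinh_injective hst
    linarith
  have h := integral_image_eq_integral_abs_deriv_smul measurableSet_Ioi hd hinj
    (fun u => Real.exp (-(2 * z) * u ^ 2))
  rw [himg, integral_gaussian_Ioi] at h
  have h2 : besselK (1 / 2) z = 2 * Real.exp (-z) * ∫ t in Ioi (0 : ℝ),
      |Real.cosh (t / 2) / 2| • Real.exp (-(2 * z) * Real.sinh (t / 2) ^ 2) := by
    rw [besselK, ← integral_const_mul]
    refine integral_congr_ae (ae_of_all _ fun t => ?_)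
    have hc : Real.cosh t = 1 + 2 * Real.sinh (t / 2) ^ 2 := by
      have := Real.cosh_two_mul (t / 2)
      rw [mul_div_cancel₀ t two_ne_zero, Real.cosh_sq] at this
      linarith
    have hcp := Real.cosh_pos (t / 2)
    simp only [smul_eq_mul]
    rw [abs_of_pos (by positivity), hc, show -(z * (1 + 2 * Real.sinh (t / 2) ^ 2)) =
      -z + -(2 * z) * Real.sinh (t / 2) ^ 2 by ring, Real.exp_add, one_div_mul_eq_div]
    ring
  rw [h2, ← h]
  ring

/-- The duplication formula at half-integers: it turns the coefficients of the series of I_{1/2}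
into those of sinh. -/
theorem factorial_mul_Gamma (m : ℕ) :
    (m.factorial : ℝ) * Real.Gamma ((m : ℝ) + 1 / 2 + 1) =
      ((2 * m + 1).factorial : ℝ) * √Real.pi / 2 ^ (2 * m + 1) := by
  induction m with
  | zero =>
    rw [Nat.cast_zero, zero_add, Real.Gamma_add_one (by norm_num), Real.Gamma_one_half_eq]
    simp
    ring
  | succ m ih =>
    have e1 : ((m + 1 : ℕ) : ℝ) + 1 / 2 + 1 = ((m : ℝ) + 1 / 2 + 1) + 1 := by push_cast; ring
    have e2 : 2 * (m + 1) + 1 = (2 * m + 1) + 1 + 1 := by ring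
    rw [e1, Real.Gamma_add_one (by positivity), e2, Nat.factorial_succ, Nat.factorial_succ,
      Nat.factorial_succ]
    push_cast
    rw [show ((m : ℝ) + 1) * m.factorial * (((m : ℝ) + 1 / 2 + 1) *
      Real.Gamma ((m : ℝ) + 1 / 2 + 1)) = ((m : ℝ) + 1) * ((m : ℝ) + 1 / 2 + 1) *
      (m.factorial * Real.Gamma ((m : ℝ) + 1 / 2 + 1)) by ring, ih, pow_succ, pow_succ]
    field_simp
    ring

theorem besselI_half {z : ℝ} (hz : 0 < z) :
    besselI (1 / 2) z = √(2 / (Real.pi * z)) * Real.sinh z := by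
  have h := ((Real.hasSum_sinh z).mul_left √(2 / (Real.pi * z))).tsum_eq
  rw [← h, besselI]
  refine tsum_congr fun m => ?_
  rw [factorial_mul_Gamma, Real.rpow_add (by positivity),
    show (2 * (m : ℝ)) = ((2 * m : ℕ) : ℝ) by push_cast; ring, Real.rpow_natCast,
    ← Real.sqrt_eq_rpow]
  have h1 : √(z / 2) = z / 2 * √(2 / z) := by
    rw [Real.sqrt_eq_iff_mul_self_eq (by positivity) (by positivity)]
    rw [mul_mul_mul_comm, Real.mul_self_sqrt (by positivity)]
    field_simp
  have h2 : √(2 / (Real.pi * z)) = √(2 / z) / √Real.pi := by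
    rw [← Real.sqrt_div (by positivity)]
    congr 1
    field_simp
  have hp : √Real.pi ≠ 0 := by positivity
  rw [h1, h2, div_pow]
  field_simp
  ring

namespace HalfLine

variable {α : ℝ} {k : ℤ} {x : ℝ}

/-- The factor between `Phi` and `recSol`. -/
def normConst (α : ℝ) (k : ℤ) : ℝ := √(Real.pi * (1 + α) / (2 * |(k : ℝ)|))

theorem normConst_pos (hα0 : 0 ≤ α) (hk : k ≠ 0) : 0 < normConst α k := by
  have h0 : 0 < |(k : ℝ)| := by simpa using hk
  unfold normConst
  positivity

theorem phase_pos (hα0 : 0 ≤ α) (hk : k ≠ 0) (hx : 0 < x) : 0 < phase α k x := by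
  have h0 : 0 < |(k : ℝ)| := by simpa using hk
  unfold phase; positivity

/-- The factor √x of Φ and F combines with the prefactor phase^(-1/2) of the Bessel functions to
give x^(-α/2). -/
theorem sqrt_mul_sqrt_div_phase (hα0 : 0 ≤ α) (hk : k ≠ 0) (hx : 0 < x) {c : ℝ} (hc : 0 ≤ c) :
    √x * √(c / phase α k x) = √(c * (1 + α) / |(k : ℝ)|) * x ^ (-α / 2) := by
  have h0 : 0 < |(k : ℝ)| := by simpa using hk
  have hp := phase_pos hα0 hk hx
  have h1 : x ^ (-α / 2) = √(x ^ (-α)) := by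
    rw [Real.sqrt_eq_rpow, ← Real.rpow_mul hx.le]
    ring_nf
  rw [h1, ← Real.sqrt_mul hx.le, ← Real.sqrt_mul (by positivity)]
  congr 1
  rw [phase, Real.rpow_add hx, Real.rpow_one, Real.rpow_neg hx.le]
  field_simp

theorem Phi_eq (hα0 : 0 ≤ α) (hk : k ≠ 0) (hx : 0 < x) :
    Phi α k x = normConst α k * recSol α k x := by
  have hp := phase_pos hα0 hk hx
  have h1 := sqrt_mul_sqrt_div_phase (c := Real.pi / 2) hα0 hk hx (by positivity)
  change √x * besselK (1 / 2) (phase α k x) = _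
  rw [besselK_half, ← mul_assoc, show Real.pi / (2 * phase α k x) = Real.pi / 2 / phase α k x by
    field_simp, h1, normConst, recSol, ← mul_assoc]
  congr 3
  field_simp

/-- The constant is reciprocal to that of `Phi_eq` up to 1 + α, so the normalization of the Green
function cancels and leaves the plain product of `recSol` and `domSol`. -/
theorem Fsol_eq (hα0 : 0 ≤ α) (hk : k ≠ 0) (hx : 0 < x) :
    Fsol α k x = (1 + α) / normConst α k * domSol α k x := by
  have h0 : 0 < |(k : ℝ)| := by simpa using hk
  have hp := phase_pos hα0 hk hx
  have hn := normConst_pos hα0 hk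
  have h1 := sqrt_mul_sqrt_div_phase (c := 2 / Real.pi) hα0 hk hx (by positivity)
  change √x * besselI (1 / 2) (phase α k x) = _
  rw [besselI_half hp, ← mul_assoc, show 2 / (Real.pi * phase α k x) = 2 / Real.pi / phase α k x by
    field_simp, h1, domSol]
  have h2 : √(2 / Real.pi * (1 + α) / |(k : ℝ)|) * |(k : ℝ)| * normConst α k = 1 + α := by
    rw [normConst, mul_right_comm, ← Real.sqrt_mul (by positivity)]
    rw [show 2 / Real.pi * (1 + α) / |(k : ℝ)| * (Real.pi * (1 + α) / (2 * |(k : ℝ)|)) =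
      ((1 + α) / |(k : ℝ)|) ^ 2 by field_simp, Real.sqrt_sq (by positivity)]
    field_simp
  have h3 : (1 + α) / normConst α k = √(2 / Real.pi * (1 + α) / |(k : ℝ)|) * |(k : ℝ)| := by
    rw [div_eq_iff hn.ne', h2]
  rw [h3]
  field_simp

/-! ### The Green function applied to the decaying solution -/

/-- The solution of `-u'' + V u = recSol` given by the Green function. -/
def greenSol (α : ℝ) (k : ℤ) (x : ℝ) : ℝ :=
  recSol α k x * (∫ t in (0 : ℝ)..x, domSol α k t * recSol α k t) +
    domSol α k x * ∫ t in Ioi x, recSol α k t ^ 2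

theorem Psi_eq (hα0 : 0 ≤ α) (hα1 : α < 1) (hk : k ≠ 0) (hx : 0 < x) :
    Psi α k x = normConst α k * greenSol α k x := by
  have hn := (normConst_pos hα0 hk).ne'
  have hα : (1 + α) ≠ 0 := by positivity
  have i1 : IntegrableOn (fun t => domSol α k t * recSol α k t) (Ioc 0 x) := by
    have h1 := (memLp_two_iff_integrable_sq
      ((continuousOn_domSol.mono Ioc_subset_Ioi_self).aestronglyMeasurable measurableSet_Ioc)).2
      (integrableOn_sq_domSol hα0 hk hx)
    have h2 := (memLp_two_iff_integrable_sq
      ((continuousOn_recSol.mono Ioc_subset_Ioi_self).aestronglyMeasurable measurableSet_Ioc)).2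
      ((integrableOn_sq_recSol hα0 hα1 hk).mono_set (Ioc_subset_Ioi_self : Ioc 0 x ⊆ Ioi 0))
    exact h1.integrable_mul h2
  have i2 : IntegrableOn (fun t => recSol α k t ^ 2) (Ioi x) :=
    (integrableOn_sq_recSol hα0 hα1 hk).mono_set (Ioi_subset_Ioi hx.le)
  have e1 : EqOn (fun ρ => green α k x ρ * Phi α k ρ)
      (fun ρ => normConst α k * recSol α k x * (domSol α k ρ * recSol α k ρ)) (Ioc 0 x) := by
    intro ρ hρ
    have hρ0 : 0 < ρ := hρ.1
    simp only [green]
    rcases hρ.2.lt_or_eq with h | h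
    · rw [if_pos h, Phi_eq hα0 hk hx, Fsol_eq hα0 hk hρ0, Phi_eq hα0 hk hρ0]
      field_simp
    -- On the diagonal the other branch of the Green function applies, with the same value.
    · rw [if_neg (by rw [h]; exact lt_irrefl x), h, Phi_eq hα0 hk hx, Fsol_eq hα0 hk hx]
      field_simp
  have e2 : EqOn (fun ρ => green α k x ρ * Phi α k ρ)
      (fun ρ => normConst α k * domSol α k x * recSol α k ρ ^ 2) (Ioi x) := by
    intro ρ hρ
    have hρ0 : 0 < ρ := hx.trans hρ
    simp only [green]
    rw [if_neg (not_lt.2 (le_of_lt hρ)), Phi_eq hα0 hk hρ0, Fsol_eq hα0 hk hx]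
    field_simp
  have j1 : IntegrableOn (fun ρ => normConst α k * recSol α k x *
      (domSol α k ρ * recSol α k ρ)) (Ioc 0 x) := i1.const_mul _
  have j2 : IntegrableOn (fun ρ => normConst α k * domSol α k x * recSol α k ρ ^ 2) (Ioi x) :=
    i2.const_mul _
  rw [Psi, ← Ioc_union_Ioi_eq_Ioi hx.le, setIntegral_union (Ioc_disjoint_Ioi le_rfl)
    measurableSet_Ioi (j1.congr_fun e1.symm measurableSet_Ioc)
    (j2.congr_fun e2.symm measurableSet_Ioi),
    setIntegral_congr_fun measurableSet_Ioc e1, setIntegral_congr_fun measurableSet_Ioi e2,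
    integral_const_mul, integral_const_mul, greenSol, intervalIntegral.integral_of_le hx.le]
  ring

/-- The exponentials cancel, and the powers 1 + α/2 and -α/2 add up to 1. -/
theorem domSol_mul_recSol_le (hα0 : 0 ≤ α) (hk : k ≠ 0) (hx : 0 < x) :
    domSol α k x * recSol α k x ≤ x := by
  calc _ ≤ x ^ (1 + α / 2) * Real.exp (phase α k x) *
        (x ^ (-α / 2) * Real.exp (-phase α k x)) := by
        have := (recSol_pos (α := α) (k := k) hx).le
        gcongr
        · exact domSol_le hα0 hk hx
        · exact le_rfl
    _ = (x ^ (1 + α / 2) * x ^ (-α / 2)) *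
        (Real.exp (phase α k x) * Real.exp (-phase α k x)) := by ring
    _ = x := by
        rw [← Real.rpow_add hx, ← Real.exp_add, add_neg_cancel, Real.exp_zero, mul_one,
          show 1 + α / 2 + -α / 2 = 1 by ring, Real.rpow_one]

theorem intervalIntegrable_domSol_mul_recSol (hα0 : 0 ≤ α) (hk : k ≠ 0) (hx : 0 < x) :
    IntervalIntegrable (fun t => domSol α k t * recSol α k t) volume 0 x := by
  rw [intervalIntegrable_iff_integrableOn_Ioc_of_le hx.le]
  refine Integrable.mono' (g := fun _ => x) (by simp)
    (((continuousOn_domSol.mul continuousOn_recSol).mono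
    Ioc_subset_Ioi_self).aestronglyMeasurable measurableSet_Ioc) ?_
  refine (ae_restrict_mem measurableSet_Ioc).mono fun t ht => ?_
  rw [Real.norm_of_nonneg (mul_nonneg (domSol_nonneg hα0 ht.1) (recSol_pos ht.1).le)]
  exact (domSol_mul_recSol_le hα0 hk ht.1).trans ht.2

theorem integral_domSol_mul_recSol_le_sq (hα0 : 0 ≤ α) (hk : k ≠ 0) (hx : 0 < x) :
    ∫ t in (0 : ℝ)..x, domSol α k t * recSol α k t ≤ x ^ 2 := by
  have h1 : ∫ t in (0 : ℝ)..x, domSol α k t * recSol α k t ≤ ∫ t in (0 : ℝ)..x, x := by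
    refine intervalIntegral.integral_mono_on_of_le_Ioo hx.le
      (intervalIntegrable_domSol_mul_recSol hα0 hk hx) (by simp) fun t ht => ?_
    exact (domSol_mul_recSol_le hα0 hk ht.1).trans ht.2.le
  refine h1.trans (le_of_eq ?_)
  simp
  ring

theorem integral_domSol_mul_recSol_nonneg (hα0 : 0 ≤ α) (hx : 0 < x) :
    0 ≤ ∫ t in (0 : ℝ)..x, domSol α k t * recSol α k t := by
  rw [intervalIntegral.integral_of_le hx.le]
  exact setIntegral_nonneg measurableSet_Ioc fun t ht =>
    mul_nonneg (domSol_nonneg hα0 ht.1) (recSol_pos ht.1).le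

theorem integral_sq_recSol_pos (hα0 : 0 ≤ α) (hα1 : α < 1) (hk : k ≠ 0) :
    0 < ∫ t in Ioi 0, recSol α k t ^ 2 := by
  rw [setIntegral_pos_iff_support_of_nonneg_ae
    (ae_of_all _ fun _ => sq_nonneg _) (integrableOn_sq_recSol hα0 hα1 hk)]
  have : Function.support (fun t => recSol α k t ^ 2) ∩ Ioi 0 = Ioi 0 := by
    refine inter_eq_right.2 fun t ht => ?_
    exact (pow_pos (recSol_pos ht) 2).ne'
  rw [this]
  simp

theorem integral_sq_recSol_Ioi_nonneg (x : ℝ) : 0 ≤ ∫ t in Ioi x, recSol α k t ^ 2 :=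
  setIntegral_nonneg measurableSet_Ioi fun _ _ => sq_nonneg _

theorem greenSol_nonneg (hα0 : 0 ≤ α) (hx : 0 < x) : 0 ≤ greenSol α k x :=
  add_nonneg (mul_nonneg (recSol_pos hx).le (integral_domSol_mul_recSol_nonneg hα0 hx))
    (mul_nonneg (domSol_nonneg hα0 hx) (integral_sq_recSol_Ioi_nonneg x))

theorem integral_sq_recSol_Ioi_le_Ioi_zero (hα0 : 0 ≤ α) (hα1 : α < 1) (hk : k ≠ 0) (hx : 0 < x) :
    ∫ t in Ioi x, recSol α k t ^ 2 ≤ ∫ t in Ioi 0, recSol α k t ^ 2 :=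
  setIntegral_mono_set (integrableOn_sq_recSol hα0 hα1 hk) (ae_of_all _ fun _ => sq_nonneg _)
    (Ioi_subset_Ioi hx.le).eventuallyLE

theorem domSol_mul_integral_le (hα0 : 0 ≤ α) (hα1 : α < 1) (hk : k ≠ 0) (hx : 0 < x) (hx1 : x ≤ 1) :
    domSol α k x * ∫ t in Ioi x, recSol α k t ^ 2 ≤
      Real.exp (phase α k 1) * (∫ t in Ioi 0, recSol α k t ^ 2) * x := by
  have h1 : domSol α k x ≤ x * Real.exp (phase α k 1) := by
    refine (domSol_le hα0 hk hx).trans ?_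
    gcongr
    · calc x ^ (1 + α / 2) ≤ x ^ (1 : ℝ) :=
            Real.rpow_le_rpow_of_exponent_ge hx hx1 (by linarith)
        _ = x := Real.rpow_one x
    · exact phase_mono hα0 hx hx1
  calc _ ≤ (x * Real.exp (phase α k 1)) * ∫ t in Ioi 0, recSol α k t ^ 2 :=
        mul_le_mul h1 (integral_sq_recSol_Ioi_le_Ioi_zero hα0 hα1 hk hx)
          (integral_sq_recSol_Ioi_nonneg x) (by positivity)
    _ = _ := by ring

/-- Near the origin `greenSol` is at most of linear growth. -/
theorem greenSol_le_mul (hα0 : 0 ≤ α) (hα1 : α < 1) (hk : k ≠ 0) :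
    ∃ C : ℝ, 0 ≤ C ∧ ∀ x, 0 < x → x ≤ 1 → greenSol α k x ≤ C * x := by
  refine ⟨1 + Real.exp (phase α k 1) * ∫ t in Ioi 0, recSol α k t ^ 2, ?_, fun x hx hx1 => ?_⟩
  · have := integral_sq_recSol_Ioi_nonneg (α := α) (k := k) 0
    positivity
  · rw [greenSol, add_mul]
    refine add_le_add ?_ (domSol_mul_integral_le hα0 hα1 hk hx hx1)
    calc _ ≤ x ^ (-α / 2) * x ^ 2 :=
          mul_le_mul (recSol_le hα0 hx) (integral_domSol_mul_recSol_le_sq hα0 hk hx)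
            (integral_domSol_mul_recSol_nonneg hα0 hx) (by positivity)
      _ = x ^ (2 - α / 2) := by
          rw [← Real.rpow_natCast x 2, ← Real.rpow_add hx]
          push_cast
          ring_nf
      _ ≤ x ^ (1 : ℝ) := Real.rpow_le_rpow_of_exponent_ge hx hx1 (by linarith)
      _ = 1 * x := by rw [Real.rpow_one, one_mul]

/-- This pointwise bound yields square-integrability. The constant is a sum of two terms: the first
serves x ≤ 1, where `recSol` is at least exp(-phase(1)), and the second serves x > 1, where the
growth of `domSol` is beaten by the tail integral. -/
theorem greenSol_le (hα0 : 0 ≤ α) (hα1 : α < 1) (hk : k ≠ 0) :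
    ∃ C : ℝ, 0 ≤ C ∧ ∀ x, 0 < x → greenSol α k x ≤ (x ^ 2 + C) * recSol α k x := by
  have h0 : 0 < |(k : ℝ)| := by simpa using hk
  have hI := integral_sq_recSol_Ioi_nonneg (α := α) (k := k) 0
  refine ⟨Real.exp (phase α k 1) * (∫ t in Ioi 0, recSol α k t ^ 2) * Real.exp (phase α k 1) +
    1 / |(k : ℝ)| * (1 / (2 * |(k : ℝ)|)), by positivity, fun x hx => ?_⟩
  rw [greenSol, add_mul, mul_comm (recSol α k x)]
  have hr := recSol_pos (α := α) (k := k) hx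
  refine add_le_add (mul_le_mul_of_nonneg_right (integral_domSol_mul_recSol_le_sq hα0 hk hx)
    hr.le) ?_
  rcases le_or_gt x 1 with hx1 | hx1
  · have h2 : 1 ≤ Real.exp (phase α k 1) * recSol α k x := by
      have h3 : 1 ≤ x ^ (-α / 2) := Real.one_le_rpow_of_pos_of_le_one_of_nonpos hx hx1 (by linarith)
      have h4 : 1 ≤ Real.exp (phase α k 1) * Real.exp (-phase α k x) := by
        rw [← Real.exp_add, Real.one_le_exp_iff]
        linarith [phase_mono (k := k) hα0 hx hx1]
      calc (1 : ℝ) ≤ x ^ (-α / 2) * (Real.exp (phase α k 1) * Real.exp (-phase α k x)) :=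
            one_le_mul_of_one_le_of_one_le h3 h4
        _ = _ := by rw [recSol]; ring
    refine (domSol_mul_integral_le hα0 hα1 hk hx hx1).trans ?_
    rw [add_mul]
    refine le_add_of_le_of_nonneg ?_ (by positivity)
    rw [mul_assoc _ (Real.exp (phase α k 1)) (recSol α k x)]
    gcongr
    exact hx1.trans h2
  · rw [add_mul]
    refine le_add_of_nonneg_of_le (by positivity) ?_
    calc _ ≤ (x ^ (-α / 2) * Real.exp (phase α k x) / |(k : ℝ)|) *
          (Real.exp (-2 * phase α k x) / (2 * |(k : ℝ)|)) :=
          mul_le_mul (domSol_le_exp hx) (integral_sq_recSol_Ioi_le hα0 hα1 hk hx1.le)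
            (integral_sq_recSol_Ioi_nonneg x) (by positivity)
      _ = 1 / |(k : ℝ)| * (1 / (2 * |(k : ℝ)|)) * (x ^ (-α / 2) * (Real.exp (phase α k x) *
          Real.exp (-2 * phase α k x))) := by field_simp
      _ = _ := by
          rw [← Real.exp_add, recSol]
          ring_nf

/-- Replacing the integral over (x, ∞) by the full integral minus that over (0, x] exhibits the
boundary values 0 and ‖recSol‖². -/
theorem greenSol_eq_repSol (hα0 : 0 ≤ α) (hα1 : α < 1) (hk : k ≠ 0) (hx : 0 < x) :
    (greenSol α k x : ℂ) = repSol α k (fun t => (recSol α k t : ℂ)) 0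
      ((∫ t in Ioi 0, recSol α k t ^ 2 : ℝ) : ℂ) x := by
  have hi := integrableOn_sq_recSol hα0 hα1 hk
  have e1 : ∫ t in Ioi 0, recSol α k t ^ 2 = (∫ t in (0 : ℝ)..x, recSol α k t ^ 2) +
      ∫ t in Ioi x, recSol α k t ^ 2 := by
    rw [intervalIntegral.integral_of_le hx.le, ← setIntegral_union (Ioc_disjoint_Ioi le_rfl)
      measurableSet_Ioi (hi.mono_set Ioc_subset_Ioi_self) (hi.mono_set (Ioi_subset_Ioi hx.le)),
      Ioc_union_Ioi_eq_Ioi hx.le]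
  have e2 : ∀ u : ℝ → ℝ, ∫ t in (0 : ℝ)..x, (u t : ℂ) * (recSol α k t : ℂ) =
      ((∫ t in (0 : ℝ)..x, u t * recSol α k t : ℝ) : ℂ) := by
    intro u
    rw [← intervalIntegral.integral_ofReal]
    refine intervalIntegral.integral_congr fun t _ => ?_
    push_cast
    rfl
  have e3 : ∫ t in (0 : ℝ)..x, recSol α k t ^ 2 = ∫ t in (0 : ℝ)..x, recSol α k t * recSol α k t :=
    intervalIntegral.integral_congr fun t _ => pow_two _
  rw [repSol, intervalIntegral.integral_neg, e2, e2, greenSol, e1, e3]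
  push_cast
  ring

theorem memLp_greenSol (hα0 : 0 ≤ α) (hα1 : α < 1) (hk : k ≠ 0) :
    MemLp (fun x => (greenSol α k x : ℂ)) 2 leb := by
  have h0 : 0 < |(k : ℝ)| := by simpa using hk
  obtain ⟨C, hC, hC'⟩ := greenSol_le hα0 hα1 hk
  have hc : ContinuousOn (fun x => (greenSol α k x : ℂ)) (Ioi 0) :=
    (continuousOn_repSol hα0 hα1 hk (memLp_recSol hα0 hα1 hk) _ _).congr fun x hx =>
      greenSol_eq_repSol hα0 hα1 hk hx
  have hi : IntegrableOn (fun x => (x ^ 2 * recSol α k x) ^ 2) (Ioi 0) := by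
    have h := integrableOn_rpow_mul_exp_neg_mul_rpow (s := 4 - α) (p := 1 + α)
      (b := 2 * (|(k : ℝ)| / (1 + α))) (by linarith) (by linarith) (by positivity)
    refine h.congr_fun (fun x hx => ?_) measurableSet_Ioi
    have hx : 0 < x := hx
    simp only
    rw [mul_pow, sq_recSol hx, phase, sub_eq_add_neg, Real.rpow_add hx, ← pow_mul,
      show (4 : ℝ) = ((2 * 2 : ℕ) : ℝ) by norm_num, Real.rpow_natCast]
    ring_nf
  have m1 : MemLp (fun x => ((x ^ 2 * recSol α k x : ℝ) : ℂ)) 2 leb :=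
    memLp_ofReal measurableSet_Ioi ((continuousOn_pow 2).mul continuousOn_recSol) hi
  refine (m1.add ((memLp_recSol hα0 hα1 hk).const_mul (C : ℂ))).mono
    (hc.aestronglyMeasurable measurableSet_Ioi) (ae_leb_of_forall fun x hx => ?_)
  have hr := recSol_pos (α := α) (k := k) hx
  have e : ((fun x => ((x ^ 2 * recSol α k x : ℝ) : ℂ)) + fun x => (C : ℂ) * (recSol α k x : ℂ)) x =
      (((x ^ 2 + C) * recSol α k x : ℝ) : ℂ) := by
    simp only [Pi.add_apply]
    push_cast
    ring
  rw [e, Complex.norm_real, Complex.norm_real, Real.norm_of_nonneg (greenSol_nonneg hα0 hx),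
    Real.norm_of_nonneg (by positivity)]
  exact hC' x hx

/-- The derivative of `greenSol`. -/
def greenSolDeriv (α : ℝ) (k : ℤ) (x : ℝ) : ℝ :=
  recSolDeriv α k x * (∫ t in (0 : ℝ)..x, domSol α k t * recSol α k t) +
    domSolDeriv α k x * ∫ t in Ioi x, recSol α k t ^ 2

theorem hasDerivAt_integral_domSol_mul_recSol (hα0 : 0 ≤ α) (hk : k ≠ 0) (hx : 0 < x) :
    HasDerivAt (fun x => ∫ t in (0 : ℝ)..x, domSol α k t * recSol α k t)
      (domSol α k x * recSol α k x) x := by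
  have hc : ContinuousOn (fun t => domSol α k t * recSol α k t) (Ioi 0) :=
    continuousOn_domSol.mul continuousOn_recSol
  refine intervalIntegral.integral_hasDerivAt_right
    (intervalIntegrable_domSol_mul_recSol hα0 hk hx)
    (hc.stronglyMeasurableAtFilter isOpen_Ioi _ hx) (hc.continuousAt (Ioi_mem_nhds hx))

theorem hasDerivAt_integral_sq_recSol (hα0 : 0 ≤ α) (hα1 : α < 1) (hk : k ≠ 0) (hx : 0 < x) :
    HasDerivAt (fun x => ∫ t in Ioi x, recSol α k t ^ 2) (-recSol α k x ^ 2) x := by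
  have hi := integrableOn_sq_recSol hα0 hα1 hk
  have hc : ContinuousOn (fun t => recSol α k t ^ 2) (Ioi 0) := continuousOn_recSol.pow 2
  have hii : IntervalIntegrable (fun t => recSol α k t ^ 2) volume 0 x :=
    (intervalIntegrable_iff_integrableOn_Ioc_of_le hx.le).2 (hi.mono_set Ioc_subset_Ioi_self)
  have h1 := (intervalIntegral.integral_hasDerivAt_right hii
    (hc.stronglyMeasurableAtFilter isOpen_Ioi _ hx)
    (hc.continuousAt (Ioi_mem_nhds hx))).const_sub (∫ t in Ioi 0, recSol α k t ^ 2)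
  refine h1.congr_of_eventuallyEq ?_
  filter_upwards [Ioi_mem_nhds hx] with y hy
  have hy : 0 < y := hy
  rw [intervalIntegral.integral_of_le hy.le, ← Ioc_union_Ioi_eq_Ioi hy.le,
    setIntegral_union (Ioc_disjoint_Ioi le_rfl)
      measurableSet_Ioi (hi.mono_set Ioc_subset_Ioi_self) (hi.mono_set (Ioi_subset_Ioi hy.le))]
  ring

theorem hasDerivAt_greenSol (hα0 : 0 ≤ α) (hα1 : α < 1) (hk : k ≠ 0) (hx : 0 < x) :
    HasDerivAt (greenSol α k) (greenSolDeriv α k x) x := by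
  refine (((hasDerivAt_recSol hα0 hx).mul (hasDerivAt_integral_domSol_mul_recSol hα0 hk hx)).add
    ((hasDerivAt_domSol hα0 hk hx).mul
      (hasDerivAt_integral_sq_recSol hα0 hα1 hk hx))).congr_deriv ?_
  rw [greenSolDeriv]
  ring

theorem hasDerivAt_greenSolDeriv (hα0 : 0 ≤ α) (hα1 : α < 1) (hk : k ≠ 0) (hx : 0 < x) :
    HasDerivAt (greenSolDeriv α k) (potential α k x * greenSol α k x - recSol α k x) x := by
  refine (((hasDerivAt_recSolDeriv hα0 hx).mul
    (hasDerivAt_integral_domSol_mul_recSol hα0 hk hx)).add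
    ((hasDerivAt_domSolDeriv hα0 hk hx).mul
      (hasDerivAt_integral_sq_recSol hα0 hα1 hk hx))).congr_deriv ?_
  rw [greenSol]
  linear_combination -recSol α k x * wronskian (α := α) hk hx

theorem contDiffOn_of_hasDerivAt {F f : ℝ → ℝ} (hF : ∀ x, 0 < x → HasDerivAt F (f x) x)
    (hf : ContDiffOn ℝ ∞ f (Ioi 0)) : ContDiffOn ℝ ∞ F (Ioi 0) := by
  rw [contDiffOn_infty_iff_deriv_of_isOpen isOpen_Ioi]
  exact ⟨fun x hx => (hF x hx).differentiableAt.differentiableWithinAt,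
    hf.congr fun x hx => (hF x hx).deriv⟩

theorem contDiffOn_greenSol (hα0 : 0 ≤ α) (hα1 : α < 1) (hk : k ≠ 0) :
    ContDiffOn ℝ ∞ (greenSol α k) (Ioi 0) :=
  (contDiffOn_recSol.mul (contDiffOn_of_hasDerivAt
    (fun _ hx => hasDerivAt_integral_domSol_mul_recSol hα0 hk hx)
    (contDiffOn_domSol.mul contDiffOn_recSol))).add
  (contDiffOn_domSol.mul (contDiffOn_of_hasDerivAt
    (fun _ hx => hasDerivAt_integral_sq_recSol hα0 hα1 hk hx) (contDiffOn_recSol.pow 2).neg))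

theorem contDiffOn_Phi (hα0 : 0 ≤ α) (hk : k ≠ 0) : ContDiffOn ℝ ∞ (Phi α k) (Ioi 0) :=
  (contDiffOn_const.mul contDiffOn_recSol).congr fun _ hx => Phi_eq hα0 hk hx

theorem contDiffOn_Psi (hα0 : 0 ≤ α) (hα1 : α < 1) (hk : k ≠ 0) :
    ContDiffOn ℝ ∞ (Psi α k) (Ioi 0) :=
  (contDiffOn_const.mul (contDiffOn_greenSol hα0 hα1 hk)).congr fun _ hx => Psi_eq hα0 hα1 hk hx

end HalfLine

/-! ### Decomposition of a space along two functionals -/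

section Decomposition

variable {E : Type*} [AddCommGroup E] [Module ℂ E] {D X : Submodule ℂ E} {a b : D →ₗ[ℂ] ℂ}
  {r s : D}

/-- With X the common kernel of a and b, with s in ker a but not in ker b, and later with r outside
ker a, everything is triangular elimination: subtract the multiple of s that makes b vanish, after
first removing a multiple of r if a is not zero. -/
theorem Submodule.mem_sup_span_iff_of_functionals
    (hX : ∀ x, x ∈ X ↔ ∃ h : x ∈ D, a ⟨x, h⟩ = 0 ∧ b ⟨x, h⟩ = 0)
    (hs1 : a s = 0) (hs2 : b s ≠ 0) (x : E) :
    x ∈ X ⊔ Submodule.span ℂ {(s : E)} ↔ ∃ h : x ∈ D, a ⟨x, h⟩ = 0 := by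
  rw [Submodule.mem_sup]
  constructor
  · rintro ⟨y, hy, z, hz, rfl⟩
    obtain ⟨c, rfl⟩ := Submodule.mem_span_singleton.1 hz
    obtain ⟨hyD, hya, -⟩ := (hX y).1 hy
    refine ⟨D.add_mem hyD (D.smul_mem c s.2), ?_⟩
    have : a (⟨y, hyD⟩ + c • s) = 0 := by rw [map_add, map_smul, hya, hs1]; simp
    exact this
  · rintro ⟨h, ha⟩
    have e : (⟨x, h⟩ - (b ⟨x, h⟩ / b s) • s : D) = x - (b ⟨x, h⟩ / b s) • (s : E) := rfl
    refine ⟨x - (b ⟨x, h⟩ / b s) • (s : E), ?_, (b ⟨x, h⟩ / b s) • (s : E),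
      Submodule.smul_mem _ _ (Submodule.mem_span_singleton_self _), sub_add_cancel _ _⟩
    refine (hX _).2 ⟨e ▸ Subtype.property _, ?_⟩
    have e1 : a (⟨x, h⟩ - (b ⟨x, h⟩ / b s) • s) = 0 := by
      rw [map_sub, map_smul, ha, hs1]; simp
    have e2 : b (⟨x, h⟩ - (b ⟨x, h⟩ / b s) • s) = 0 := by
      rw [map_sub, map_smul, smul_eq_mul, div_mul_cancel₀ _ hs2, sub_self]
    exact ⟨e1, e2⟩

theorem Submodule.eq_sup_span_sup_span_of_functionals
    (hX : ∀ x, x ∈ X ↔ ∃ h : x ∈ D, a ⟨x, h⟩ = 0 ∧ b ⟨x, h⟩ = 0)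
    (hs1 : a s = 0) (hs2 : b s ≠ 0) (hr1 : a r ≠ 0) :
    D = X ⊔ Submodule.span ℂ {(s : E)} ⊔ Submodule.span ℂ {(r : E)} := by
  ext x
  rw [Submodule.mem_sup]
  constructor
  · intro h
    have e : (⟨x, h⟩ - (a ⟨x, h⟩ / a r) • r : D) = x - (a ⟨x, h⟩ / a r) • (r : E) := rfl
    refine ⟨x - (a ⟨x, h⟩ / a r) • (r : E), ?_, (a ⟨x, h⟩ / a r) • (r : E),
      Submodule.smul_mem _ _ (Submodule.mem_span_singleton_self _), sub_add_cancel _ _⟩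
    rw [Submodule.mem_sup_span_iff_of_functionals hX hs1 hs2]
    refine ⟨e ▸ Subtype.property _, ?_⟩
    have e2 : a (⟨x, h⟩ - (a ⟨x, h⟩ / a r) • r) = 0 := by
      rw [map_sub, map_smul, smul_eq_mul, div_mul_cancel₀ _ hr1, sub_self]
    exact e2
  · rintro ⟨y, hy, z, hz, rfl⟩
    obtain ⟨hy', -⟩ := (Submodule.mem_sup_span_iff_of_functionals hX hs1 hs2 y).1 hy
    refine D.add_mem hy' ?_
    obtain ⟨c, rfl⟩ := Submodule.mem_span_singleton.1 hz
    exact D.smul_mem c r.2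

theorem Submodule.disjoint_span_of_functionals
    (hX : ∀ x, x ∈ X ↔ ∃ h : x ∈ D, a ⟨x, h⟩ = 0 ∧ b ⟨x, h⟩ = 0) (hs2 : b s ≠ 0) :
    Disjoint X (Submodule.span ℂ {(s : E)}) := by
  rw [Submodule.disjoint_def]
  intro x hx hx'
  obtain ⟨c, rfl⟩ := Submodule.mem_span_singleton.1 hx'
  obtain ⟨h, -, hb⟩ := (hX _).1 hx
  have e : b (c • s) = 0 := hb
  rw [map_smul, smul_eq_mul, mul_eq_zero, or_iff_left hs2] at e
  rw [e, zero_smul]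

theorem Submodule.iSupIndep_of_functionals
    (hX : ∀ x, x ∈ X ↔ ∃ h : x ∈ D, a ⟨x, h⟩ = 0 ∧ b ⟨x, h⟩ = 0)
    (hs1 : a s = 0) (hs2 : b s ≠ 0) (hr1 : a r ≠ 0) :
    iSupIndep ![X, Submodule.span ℂ {(s : E)}, Submodule.span ℂ {(r : E)}] := by
  have key : ∀ (y : E) (c d : ℂ), y ∈ X → c • (s : E) + d • (r : E) + y = 0 → c = 0 ∧ d = 0 := by
    intro y c d hy h
    obtain ⟨hyD, ha, hb⟩ := (hX y).1 hy
    have h' : c • s + d • r + ⟨y, hyD⟩ = 0 := Subtype.ext h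
    have e1 := congrArg a h'
    have e2 := congrArg b h'
    simp only [map_add, map_smul, map_zero, smul_eq_mul, hs1, ha, hb, mul_zero, zero_add,
      add_zero] at e1 e2
    have hd : d = 0 := (mul_eq_zero.1 e1).resolve_right hr1
    rw [hd, zero_mul, add_zero] at e2
    exact ⟨(mul_eq_zero.1 e2).resolve_right hs2, hd⟩
  rw [iSupIndep_fin_three]
  simp only [Submodule.disjoint_def, Submodule.mem_sup, Submodule.mem_span_singleton,
    Matrix.cons_val_zero, Matrix.cons_val_one, Matrix.cons_val]
  refine ⟨?_, ?_, ?_⟩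
  · rintro x hx ⟨_, ⟨c, rfl⟩, _, ⟨d, rfl⟩, rfl⟩
    obtain ⟨rfl, rfl⟩ : c = 0 ∧ d = 0 := key _ c d (X.neg_mem hx) (add_neg_cancel _)
    simp
  · rintro _ ⟨c, rfl⟩ ⟨_, ⟨d, rfl⟩, y, hy, h⟩
    obtain ⟨rfl, -⟩ := key y (-c) d hy (by rw [add_assoc, h, neg_smul, neg_add_cancel])
      |>.imp_left neg_eq_zero.1
    simp
  · rintro _ ⟨d, rfl⟩ ⟨y, hy, _, ⟨c, rfl⟩, h⟩
    obtain ⟨-, rfl⟩ := key y c (-d) hy (by rw [neg_smul, ← h]; abel)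
      |>.imp_right neg_eq_zero.1
    simp

end Decomposition

namespace HalfLine

variable {α : ℝ} {k : ℤ} {x : ℝ}

/-! ### The boundary pair -/

theorem exists_adjoint_recSol (hα0 : 0 ≤ α) (hα1 : α < 1) (hk : k ≠ 0) :
    ∃ hd : (memLp_recSol hα0 hα1 hk).toLp ∈ (op α k)†.domain,
      (op α k)† ⟨_, hd⟩ = 0 ∧ HasCoeff α k ⟨_, hd⟩ 1 0 := by
  refine mem_adjoint_of_repSol hα0 hα1 hk ?_
  filter_upwards [(memLp_recSol hα0 hα1 hk).coeFn_toLp, ae_leb_of_forall (fun x hx => hx)]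
    with x h1 hx
  rw [h1, repSol_congr (Lp.coeFn_zero ℂ 2 leb) _ _ hx]
  simp [repSol]

theorem exists_adjoint_greenSol (hα0 : 0 ≤ α) (hα1 : α < 1) (hk : k ≠ 0) :
    ∃ hd : (memLp_greenSol hα0 hα1 hk).toLp ∈ (op α k)†.domain,
      (op α k)† ⟨_, hd⟩ = (memLp_recSol hα0 hα1 hk).toLp ∧
      HasCoeff α k ⟨_, hd⟩ 0 ((∫ t in Ioi 0, recSol α k t ^ 2 : ℝ) : ℂ) := by
  refine mem_adjoint_of_repSol hα0 hα1 hk ?_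
  filter_upwards [(memLp_greenSol hα0 hα1 hk).coeFn_toLp, ae_leb_of_forall (fun x hx => hx)]
    with x h1 hx
  rw [h1, repSol_congr (memLp_recSol hα0 hα1 hk).coeFn_toLp _ _ hx,
    greenSol_eq_repSol hα0 hα1 hk hx]

/-- Surjectivity holds because `recSol` has boundary values (1, 0) and `greenSol` has (0,
‖recSol‖²). -/
theorem isBoundaryPair (hα0 : 0 ≤ α) (hα1 : α < 1) (hk : k ≠ 0) :
    (op α k).IsBoundaryPair (coeffA hα0 hα1 hk) (coeffB hα0 hα1 hk) where
  dense := op_domain_dense α k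
  symm := (op_isNonnegSymm hα0 k).symm
  surj p q := by
    obtain ⟨hr, -, hr'⟩ := exists_adjoint_recSol hα0 hα1 hk
    obtain ⟨hs, -, hs'⟩ := exists_adjoint_greenSol hα0 hα1 hk
    obtain ⟨r1, r2⟩ := hr'.coeff_eq hα0 hα1 hk
    obtain ⟨s1, s2⟩ := hs'.coeff_eq hα0 hα1 hk
    have hI : ((∫ t in Ioi 0, recSol α k t ^ 2 : ℝ) : ℂ) ≠ 0 := by
      exact_mod_cast (integral_sq_recSol_pos hα0 hα1 hk).ne'
    refine ⟨p • ⟨_, hr⟩ + (q / ((∫ t in Ioi 0, recSol α k t ^ 2 : ℝ) : ℂ)) • ⟨_, hs⟩, ?_, ?_⟩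
    · rw [map_add, map_smul, map_smul, r1, s1]; simp
    · rw [map_add, map_smul, map_smul, r2, s2, smul_eq_mul, smul_eq_mul, div_mul_cancel₀ _ hI]
      simp
  green := green_identity hα0 hα1 hk

theorem asympZero_iff (hα0 : 0 ≤ α) (hα1 : α < 1) (hk : k ≠ 0) (g : (op α k)†.domain) (p q : ℂ) :
    AsympZero (g : L2) (fun x => p * (x ^ (-α / 2) : ℝ) + q * (x ^ (1 + α / 2) : ℝ)) ↔
      coeffA hα0 hα1 hk g = p ∧
        (coeffB hα0 hα1 hk g - coeffA hα0 hα1 hk g * |(k : ℝ)|) / (1 + α) = q := by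
  have hg := hasCoeff_coeff hα0 hα1 hk g
  constructor
  · rintro ⟨f, hf, hc, ho⟩
    exact coeff_eq_of_asymp hα0 hα1 hk (Lp.memLp _) hc (hf.symm.trans hg) ho
  · rintro ⟨h1, h2⟩
    refine ⟨_, hg, continuousOn_repSol hα0 hα1 hk (Lp.memLp _) _ _, ?_⟩
    have := repSol_asymp hα0 hα1 hk (Lp.memLp ((op α k)† g)) (coeffA hα0 hα1 hk g)
      (coeffB hα0 hα1 hk g)
    rw [h2, h1] at this
    rwa [h1]

theorem exists_asympZero_iff (hα0 : 0 ≤ α) (hα1 : α < 1) (hk : k ≠ 0) (g : (op α k)†.domain) :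
    (∃ g₁ : ℂ, AsympZero (g : L2) fun x => g₁ * (x ^ (1 + α / 2) : ℝ)) ↔
      coeffA hα0 hα1 hk g = 0 := by
  have key := fun q => asympZero_iff hα0 hα1 hk g 0 q
  simp only [zero_mul, zero_add] at key
  simp only [key]
  exact ⟨fun ⟨_, h, _⟩ => h, fun h => ⟨_, h, rfl⟩⟩

/-- Solving (b - a|k|)/(1 + α) = γ a gives b = (|k| + (1 + α)γ) a, a line with real slope, as
required for self-adjointness. -/
theorem mem_boundaryCond_iff (hα0 : 0 ≤ α) (hα1 : α < 1) (hk : k ≠ 0) (γ : ℝ)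
    (g : (op α k)†.domain) : (g : L2) ∈ boundaryCond α γ ↔
      ((-(|(k : ℝ)| + (1 + α) * γ) : ℝ) : ℂ) * coeffA hα0 hα1 hk g +
        ((1 : ℝ) : ℂ) * coeffB hα0 hα1 hk g = 0 := by
  have h2 : (1 + α : ℂ) ≠ 0 := by
    have : (1 + α : ℝ) ≠ 0 := by positivity
    exact_mod_cast this
  change (∃ g₀ : ℂ, AsympZero (g : L2) fun x =>
    g₀ * (x ^ (-α / 2) : ℝ) + γ * g₀ * (x ^ (1 + α / 2) : ℝ)) ↔ _
  simp only [asympZero_iff hα0 hα1 hk]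
  push_cast
  simp only [true_and, div_eq_iff h2]
  constructor <;> intro h <;> linear_combination h

theorem mem_closure_domain_iff (hα0 : 0 ≤ α) (hα1 : α < 1) (hk : k ≠ 0) (x : L2) :
    x ∈ (op α k).closure.domain ↔ ∃ h : x ∈ (op α k)†.domain,
      coeffA hα0 hα1 hk ⟨x, h⟩ = 0 ∧ coeffB hα0 hα1 hk ⟨x, h⟩ = 0 := by
  have hp := isBoundaryPair hα0 hα1 hk
  constructor
  · intro h
    have h' := (LinearPMap.closure_le_adjoint hp.dense hp.symm).1 h
    exact ⟨h', (hp.mem_closure_domain_iff ⟨x, h'⟩).1 h⟩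
  · rintro ⟨h, h'⟩
    exact (hp.mem_closure_domain_iff ⟨x, h⟩).2 h'

/-! ### `Φ` and `Ψ` -/

theorem Phi_ae_eq (hα0 : 0 ≤ α) (hk : k ≠ 0) : (fun x => (Phi α k x : ℂ)) =ᵐ[leb]
    (normConst α k : ℂ) • fun x => (recSol α k x : ℂ) :=
  ae_leb_of_forall fun x hx => by
    simp [Phi_eq hα0 hk hx]

theorem Psi_ae_eq (hα0 : 0 ≤ α) (hα1 : α < 1) (hk : k ≠ 0) : (fun x => (Psi α k x : ℂ)) =ᵐ[leb]
    (normConst α k : ℂ) • fun x => (greenSol α k x : ℂ) :=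
  ae_leb_of_forall fun x hx => by
    simp [Psi_eq hα0 hα1 hk hx]

theorem memLp_Phi (hα0 : 0 ≤ α) (hα1 : α < 1) (hk : k ≠ 0) :
    MemLp (fun x => (Phi α k x : ℂ)) 2 leb :=
  ((memLp_recSol hα0 hα1 hk).const_smul _).ae_eq (Phi_ae_eq hα0 hk).symm

theorem memLp_Psi (hα0 : 0 ≤ α) (hα1 : α < 1) (hk : k ≠ 0) :
    MemLp (fun x => (Psi α k x : ℂ)) 2 leb :=
  ((memLp_greenSol hα0 hα1 hk).const_smul _).ae_eq (Psi_ae_eq hα0 hα1 hk).symm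

theorem toLp_Phi (hα0 : 0 ≤ α) (hα1 : α < 1) (hk : k ≠ 0) :
    (memLp_Phi hα0 hα1 hk).toLp = (normConst α k : ℂ) • (memLp_recSol hα0 hα1 hk).toLp :=
  (MemLp.toLp_congr _ ((memLp_recSol hα0 hα1 hk).const_smul _) (Phi_ae_eq hα0 hk)).trans
    (MemLp.toLp_const_smul _ _)

theorem toLp_Psi (hα0 : 0 ≤ α) (hα1 : α < 1) (hk : k ≠ 0) :
    (memLp_Psi hα0 hα1 hk).toLp = (normConst α k : ℂ) • (memLp_greenSol hα0 hα1 hk).toLp :=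
  (MemLp.toLp_congr _ ((memLp_greenSol hα0 hα1 hk).const_smul _) (Psi_ae_eq hα0 hα1 hk)).trans
    (MemLp.toLp_const_smul _ _)

theorem exists_adjoint_Phi (hα0 : 0 ≤ α) (hα1 : α < 1) (hk : k ≠ 0) :
    ∃ hd : (memLp_Phi hα0 hα1 hk).toLp ∈ (op α k)†.domain,
      (op α k)† ⟨_, hd⟩ = 0 ∧ coeffA hα0 hα1 hk ⟨_, hd⟩ ≠ 0 ∧ coeffB hα0 hα1 hk ⟨_, hd⟩ = 0 := by
  have hn : (normConst α k : ℂ) ≠ 0 := by exact_mod_cast (normConst_pos hα0 hk).ne'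
  obtain ⟨hr, h0, hr'⟩ := exists_adjoint_recSol hα0 hα1 hk
  obtain ⟨r1, r2⟩ := (hr'.smul (normConst α k)).coeff_eq hα0 hα1 hk
  -- The domain membership depends on the vector, so the identity `toLp_Phi` is substituted through
  -- a variable.
  generalize hu : (memLp_Phi hα0 hα1 hk).toLp = u
  obtain rfl : u = _ := hu.symm.trans (toLp_Phi hα0 hα1 hk)
  refine ⟨Submodule.smul_mem _ _ hr, ?_, ?_, ?_⟩
  · have := LinearPMap.map_smul (op α k)† (normConst α k : ℂ) ⟨_, hr⟩
    rw [h0, smul_zero] at this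
    exact this
  · exact ne_of_eq_of_ne r1 (by simpa using hn)
  · exact r2.trans (by simp)

theorem exists_adjoint_Psi (hα0 : 0 ≤ α) (hα1 : α < 1) (hk : k ≠ 0) :
    ∃ hd : (memLp_Psi hα0 hα1 hk).toLp ∈ (op α k)†.domain,
      coeffA hα0 hα1 hk ⟨_, hd⟩ = 0 ∧ coeffB hα0 hα1 hk ⟨_, hd⟩ ≠ 0 := by
  have hn : (normConst α k : ℂ) ≠ 0 := by exact_mod_cast (normConst_pos hα0 hk).ne'
  obtain ⟨hr, h0, hr'⟩ := exists_adjoint_greenSol hα0 hα1 hk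
  obtain ⟨r1, r2⟩ := (hr'.smul (normConst α k)).coeff_eq hα0 hα1 hk
  have hI : ((∫ t in Ioi 0, recSol α k t ^ 2 : ℝ) : ℂ) ≠ 0 := by
    exact_mod_cast (integral_sq_recSol_pos hα0 hα1 hk).ne'
  generalize hu : (memLp_Psi hα0 hα1 hk).toLp = u
  obtain rfl : u = _ := hu.symm.trans (toLp_Psi hα0 hα1 hk)
  refine ⟨Submodule.smul_mem _ _ hr, ?_, ?_⟩
  · exact r1.trans (by simp)
  · exact ne_of_eq_of_ne r2 (mul_ne_zero hn hI)

/-- Green's identity of f with Φ, both annihilated by the adjoint, gives b f = 0 since Φ has a ≠ 0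
and b = 0. What remains is a multiple of Φ with the same coefficient a. -/
theorem ker_adjoint (hα0 : 0 ≤ α) (hα1 : α < 1) (hk : k ≠ 0) :
    (LinearMap.ker (op α k)†.toFun).map (op α k)†.domain.subtype =
      Submodule.span ℂ {(memLp_Phi hα0 hα1 hk).toLp} := by
  have hp := isBoundaryPair hα0 hα1 hk
  obtain ⟨hr, h0, hr1, hr2⟩ := exists_adjoint_Phi hα0 hα1 hk
  ext x
  simp only [Submodule.mem_map, LinearMap.mem_ker, Submodule.mem_span_singleton]
  constructor
  · rintro ⟨f, hf, rfl⟩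
    have hf : (op α k)† f = 0 := hf
    have hb : coeffB hα0 hα1 hk f = 0 := by
      have e := hp.green f ⟨_, hr⟩
      rw [hf, h0, inner_zero_left, inner_zero_right, sub_zero, hr2, mul_zero, sub_zero, eq_comm,
        mul_eq_zero, or_iff_left hr1] at e
      simpa using e
    have h1 := hasCoeff_coeff hα0 hα1 hk f
    have h2 := (hasCoeff_coeff hα0 hα1 hk ⟨_, hr⟩).smul
      (coeffA hα0 hα1 hk f / coeffA hα0 hα1 hk ⟨_, hr⟩)
    rw [div_mul_cancel₀ _ hr1, hr2, mul_zero] at h2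
    rw [hb] at h1
    rw [HasCoeff, hf] at h1
    rw [HasCoeff, LinearPMap.map_smul, h0, smul_zero] at h2
    exact ⟨_, Lp.ext (h2.trans h1.symm)⟩
  · rintro ⟨c, rfl⟩
    refine ⟨c • ⟨_, hr⟩, ?_, rfl⟩
    have := LinearPMap.map_smul (op α k)† c ⟨_, hr⟩
    rw [h0, smul_zero] at this
    exact this


variable {α : ℝ} {k : ℤ} {x : ℝ}

/-! ### Integral inequalities for test functions -/

theorem integrableOn_weight_mul {w : ℝ → ℝ} (hw : ContinuousOn w (Ioi 0)) {f : ℝ → ℝ}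
    (hf : Continuous f) (φ : 𝓓(posReals, ℂ)) (hs : Function.support f ⊆ tsupport φ) :
    IntegrableOn (fun x => w x * f x) (Ioi 0) := by
  have hK : IsCompact (tsupport φ) := φ.hasCompactSupport
  have h1 : IntegrableOn (fun x => w x * f x) (tsupport φ) :=
    ((hw.mono φ.tsupport_subset).mul hf.continuousOn).integrableOn_compact hK
  exact ((integrableOn_iff_integrable_of_support_subset
    ((Function.support_mul_subset_right _ _).trans hs)).1 h1).integrableOn

theorem integrableOn_weight_mul_sq {w : ℝ → ℝ} (hw : ContinuousOn w (Ioi 0)) (φ : 𝓓(posReals, ℂ))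
    (m : ℕ) : IntegrableOn (fun x => w x * ‖iteratedDeriv m φ x‖ ^ 2) (Ioi 0) :=
  integrableOn_weight_mul hw ((continuous_iteratedDeriv φ m).norm.pow 2) φ fun x hx =>
    support_iteratedDeriv φ m fun h => hx (by simp [h])

/-- The total derivative of a function supported in the support of a test function integrates to
zero. -/
theorem integral_deriv_eq_zero (φ : 𝓓(posReals, ℂ)) {G G' : ℝ → ℝ}
    (hG : ∀ x, 0 < x → HasDerivAt G (G' x) x) (hc : ContinuousOn G' (Ioi 0))
    (hs : ∀ x, x ∉ tsupport φ → G x = 0) (hs' : ∀ x, x ∉ tsupport φ → G' x = 0) :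
    IntegrableOn G' (Ioi 0) ∧ ∫ x in Ioi 0, G' x = 0 := by
  obtain ⟨ε, R, hε, hεR, hsub⟩ := exists_tsupport_subset_Icc φ
  have hle : ε / 2 ≤ R + 1 := by linarith
  have h1 : IntegrableOn G' (Ioc (ε / 2) (R + 1)) :=
    (ContinuousOn.integrableOn_Icc (hc.mono fun x hx => lt_of_lt_of_le (half_pos hε) hx.1)).mono_set
      Ioc_subset_Icc_self
  have hs1 : Function.support G' ⊆ Ioc (ε / 2) (R + 1) := fun x hx => by
    have : x ∈ Icc ε R := hsub (by by_contra h; exact hx (hs' x h))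
    exact ⟨by linarith [this.1], by linarith [this.2]⟩
  have h2 : Integrable G' := (integrableOn_iff_integrable_of_support_subset hs1).1 h1
  refine ⟨h2.integrableOn, ?_⟩
  rw [setIntegral_eq_integral_of_forall_compl_eq_zero, ← setIntegral_eq_integral_of_forall_compl_eq_zero
    (s := Ioc (ε / 2) (R + 1)), ← intervalIntegral.integral_of_le hle,
    intervalIntegral.integral_eq_sub_of_hasDerivAt (f := G), hs, hs, sub_zero]
  · intro h
    linarith [(hsub h).1]
  · intro h
    linarith [(hsub h).2]
  · intro x hx
    rw [uIcc_of_le hle] at hx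
    exact hG x (lt_of_lt_of_le (half_pos hε) hx.1)
  · exact (intervalIntegrable_iff_integrableOn_Ioc_of_le hle).2 h1
  · intro x hx
    by_contra h
    exact hx (hs1 h)
  · intro x hx
    exact hs' x fun h => hx (φ.tsupport_subset h)

/-- A pointwise inequality up to a total derivative gives an inequality of integrals. -/
theorem integral_le_of_deriv (φ : 𝓓(posReals, ℂ)) {f g G G' : ℝ → ℝ}
    (hG : ∀ x, 0 < x → HasDerivAt G (G' x) x) (hc : ContinuousOn G' (Ioi 0))
    (hs : ∀ x, x ∉ tsupport φ → G x = 0) (hs' : ∀ x, x ∉ tsupport φ → G' x = 0)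
    (hf : IntegrableOn f (Ioi 0)) (hg : IntegrableOn g (Ioi 0))
    (hle : ∀ x, 0 < x → f x + G' x ≤ g x) : ∫ x in Ioi 0, f x ≤ ∫ x in Ioi 0, g x := by
  obtain ⟨h1, h2⟩ := integral_deriv_eq_zero φ hG hc hs hs'
  calc _ = ∫ x in Ioi 0, (f x + G' x) := by rw [integral_add hf h1, h2, add_zero]
    _ ≤ _ := setIntegral_mono_on (hf.add h1) hg measurableSet_Ioi hle

theorem iteratedDeriv_eq_zero (φ : 𝓓(posReals, ℂ)) {x : ℝ} (hx : x ∉ tsupport φ) (m : ℕ) :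
    iteratedDeriv m φ x = 0 := by
  by_contra h
  exact hx (support_iteratedDeriv φ m h)

theorem hasDerivAt_norm_sq_iteratedDeriv (φ : 𝓓(posReals, ℂ)) (m : ℕ) (x : ℝ) :
    HasDerivAt (fun x => ‖iteratedDeriv m φ x‖ ^ 2)
      (2 * inner ℝ (iteratedDeriv m φ x) (iteratedDeriv (m + 1) φ x)) x :=
  (hasDerivAt_iteratedDeriv φ m x).norm_sq

theorem continuous_inner_iteratedDeriv (φ : 𝓓(posReals, ℂ)) (m l : ℕ) :
    Continuous fun x => inner ℝ (iteratedDeriv m φ x) (iteratedDeriv l φ x) :=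
  (continuous_iteratedDeriv φ m).inner (continuous_iteratedDeriv φ l)

/-- The completed square behind all the integral inequalities below; each differs from such a square
only by a total derivative. -/
theorem norm_sub_smul_sq (z w : ℂ) (t : ℝ) :
    ‖w - t • z‖ ^ 2 = ‖w‖ ^ 2 - 2 * t * inner ℝ z w + t ^ 2 * ‖z‖ ^ 2 := by
  rw [norm_sub_sq_real, inner_smul_right, norm_smul, mul_pow, Real.norm_eq_abs, sq_abs,
    real_inner_comm]
  ring

theorem continuousOn_const_div_pow (c : ℝ) (n : ℕ) : ContinuousOn (fun x : ℝ => c / x ^ n) (Ioi 0) :=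
  continuousOn_const.div (by fun_prop) fun _ hx => pow_ne_zero _ (ne_of_gt hx)

theorem hasDerivAt_const_div_pow (c : ℝ) (n : ℕ) (hx : 0 < x) :
    HasDerivAt (fun x : ℝ => c / x ^ n) (-(n * c) / x ^ (n + 1)) x := by
  have h := (hasDerivAt_const x c).div (hasDerivAt_pow n x) (pow_ne_zero _ hx.ne')
  refine h.congr_deriv ?_
  rcases n with _ | n
  · simp
  · rw [Nat.add_sub_cancel]
    field_simp
    ring

/-- Hardy's inequality with the weight `x⁻²`. -/
theorem hardy (φ : 𝓓(posReals, ℂ)) (m : ℕ) :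
    ∫ x in Ioi 0, 1 / x ^ 2 * ‖iteratedDeriv m φ x‖ ^ 2 ≤
      ∫ x in Ioi 0, 4 * ‖iteratedDeriv (m + 1) φ x‖ ^ 2 := by
  -- With this total derivative the pointwise defect is 4|u' - u/(2x)|², where u is the m-th
  -- derivative.
  refine integral_le_of_deriv φ (G := fun x => 2 / x ^ 1 * ‖iteratedDeriv m φ x‖ ^ 2)
    (G' := fun x => -((1 : ℕ) * 2) / x ^ 2 * ‖iteratedDeriv m φ x‖ ^ 2 + 2 / x ^ 1 *
      (2 * inner ℝ (iteratedDeriv m φ x) (iteratedDeriv (m + 1) φ x)))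
    (fun x hx => (hasDerivAt_const_div_pow 2 1 hx).mul (hasDerivAt_norm_sq_iteratedDeriv φ m x))
    (((continuousOn_const_div_pow _ _).mul
      ((continuous_iteratedDeriv φ m).norm.pow 2).continuousOn).add
      ((continuousOn_const_div_pow _ _).mul
      ((continuous_inner_iteratedDeriv φ m (m + 1)).const_mul 2).continuousOn))
    (fun x hx => by simp [iteratedDeriv_eq_zero φ hx])
    (fun x hx => by simp [iteratedDeriv_eq_zero φ hx])
    (integrableOn_weight_mul_sq (continuousOn_const_div_pow _ _) φ m)
    (integrableOn_weight_mul_sq continuousOn_const φ (m + 1)) fun x hx => ?_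
  have h := norm_sub_smul_sq (iteratedDeriv m φ x) (iteratedDeriv (m + 1) φ x) (1 / (2 * x))
  have h' := sq_nonneg ‖iteratedDeriv (m + 1) φ x - (1 / (2 * x)) • iteratedDeriv m φ x‖
  rw [h] at h'
  rw [← sub_nonneg]
  refine (mul_nonneg (by norm_num : (0 : ℝ) ≤ 4) h').trans_eq ?_
  field_simp
  push_cast
  ring

/-- Hardy's inequality with the weight `x⁻⁴`. -/
theorem hardy_four (φ : 𝓓(posReals, ℂ)) (m : ℕ) :
    ∫ x in Ioi 0, 9 / x ^ 4 * ‖iteratedDeriv m φ x‖ ^ 2 ≤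
      ∫ x in Ioi 0, 4 / x ^ 2 * ‖iteratedDeriv (m + 1) φ x‖ ^ 2 := by
  -- Here the defect is (4/x²)|u' - 3u/(2x)|².
  refine integral_le_of_deriv φ (G := fun x => 6 / x ^ 3 * ‖iteratedDeriv m φ x‖ ^ 2)
    (G' := fun x => -((3 : ℕ) * 6) / x ^ 4 * ‖iteratedDeriv m φ x‖ ^ 2 + 6 / x ^ 3 *
      (2 * inner ℝ (iteratedDeriv m φ x) (iteratedDeriv (m + 1) φ x)))
    (fun x hx => (hasDerivAt_const_div_pow 6 3 hx).mul (hasDerivAt_norm_sq_iteratedDeriv φ m x))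
    (((continuousOn_const_div_pow _ _).mul
      ((continuous_iteratedDeriv φ m).norm.pow 2).continuousOn).add
      ((continuousOn_const_div_pow _ _).mul
      ((continuous_inner_iteratedDeriv φ m (m + 1)).const_mul 2).continuousOn))
    (fun x hx => by simp [iteratedDeriv_eq_zero φ hx])
    (fun x hx => by simp [iteratedDeriv_eq_zero φ hx])
    (integrableOn_weight_mul_sq (continuousOn_const_div_pow _ _) φ m)
    (integrableOn_weight_mul_sq (continuousOn_const_div_pow _ _) φ (m + 1)) fun x hx => ?_
  have h := norm_sub_smul_sq (iteratedDeriv m φ x) (iteratedDeriv (m + 1) φ x) (3 / (2 * x))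
  have h' := sq_nonneg ‖iteratedDeriv (m + 1) φ x - (3 / (2 * x)) • iteratedDeriv m φ x‖
  rw [h] at h'
  rw [← sub_nonneg]
  refine (mul_nonneg (by positivity : (0 : ℝ) ≤ 4 / x ^ 2) h').trans_eq ?_
  field_simp
  push_cast
  ring

/-- The first derivative is controlled by the function and its second derivative. -/
theorem integral_sq_deriv_le (φ : 𝓓(posReals, ℂ)) :
    ∫ x in Ioi 0, 2 * ‖iteratedDeriv 1 φ x‖ ^ 2 ≤
      ∫ x in Ioi 0, (1 * ‖iteratedDeriv 0 φ x‖ ^ 2 + 1 * ‖iteratedDeriv 2 φ x‖ ^ 2) := by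
  -- The defect is |φ + φ''|².
  refine integral_le_of_deriv φ
    (G := fun x => -(2 * inner ℝ (iteratedDeriv 0 φ x) (iteratedDeriv 1 φ x)))
    (G' := fun x => -(2 * (inner ℝ (iteratedDeriv 0 φ x) (iteratedDeriv 2 φ x) +
      inner ℝ (iteratedDeriv 1 φ x) (iteratedDeriv 1 φ x))))
    (fun x _ => (((hasDerivAt_iteratedDeriv φ 0 x).inner ℝ
      (hasDerivAt_iteratedDeriv φ 1 x)).const_mul 2).neg)
    (((continuous_inner_iteratedDeriv φ 0 2).add
      (continuous_inner_iteratedDeriv φ 1 1)).const_mul 2).neg.continuousOn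
    (fun x hx => by simp [iteratedDeriv_eq_zero φ hx])
    (fun x hx => by simp [iteratedDeriv_eq_zero φ hx])
    (integrableOn_weight_mul_sq continuousOn_const φ 1)
    ((integrableOn_weight_mul_sq continuousOn_const φ 0).add
      (integrableOn_weight_mul_sq continuousOn_const φ 2)) fun x _ => ?_
  have h := norm_sub_smul_sq (iteratedDeriv 0 φ x) (iteratedDeriv 2 φ x) (-1)
  have h' := sq_nonneg ‖iteratedDeriv 2 φ x - (-1 : ℝ) • iteratedDeriv 0 φ x‖
  rw [h] at h'
  rw [real_inner_self_eq_norm_sq]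
  linarith

/-! ### The graph norm of the operator -/

/-- The first derivative of the potential. -/
def potentialDeriv (α : ℝ) (k : ℤ) (x : ℝ) : ℝ :=
  (k : ℝ) ^ 2 * (2 * α * x ^ (2 * α - 1)) + -((2 : ℕ) * (α * (2 + α) / 4)) / x ^ 3

/-- The second derivative of the potential. -/
def potentialDeriv₂ (α : ℝ) (k : ℤ) (x : ℝ) : ℝ :=
  (k : ℝ) ^ 2 * (2 * α * ((2 * α - 1) * x ^ (2 * α - 1 - 1))) +
    -((3 : ℕ) * -((2 : ℕ) * (α * (2 + α) / 4))) / x ^ 4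

theorem potential_eq (x : ℝ) :
    potential α k x = (k : ℝ) ^ 2 * x ^ (2 * α) + α * (2 + α) / 4 / x ^ 2 := by
  rw [potential, div_div]

theorem hasDerivAt_potential (hx : 0 < x) :
    HasDerivAt (potential α k) (potentialDeriv α k x) x := by
  have := ((Real.hasDerivAt_rpow_const (p := 2 * α) (Or.inl hx.ne')).const_mul ((k : ℝ) ^ 2)).add
    (hasDerivAt_const_div_pow (α * (2 + α) / 4) 2 hx)
  exact this.congr_of_eventuallyEq (Eventually.of_forall fun y => potential_eq y)

theorem hasDerivAt_potentialDeriv (hx : 0 < x) :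
    HasDerivAt (potentialDeriv α k) (potentialDeriv₂ α k x) x :=
  (((Real.hasDerivAt_rpow_const (p := 2 * α - 1) (Or.inl hx.ne')).const_mul
    (2 * α)).const_mul ((k : ℝ) ^ 2)).add (hasDerivAt_const_div_pow _ 3 hx)

theorem continuousOn_potentialDeriv : ContinuousOn (potentialDeriv α k) (Ioi 0) := fun _ hx =>
  (hasDerivAt_potentialDeriv hx).continuousAt.continuousWithinAt

theorem continuousOn_potentialDeriv₂ : ContinuousOn (potentialDeriv₂ α k) (Ioi 0) := by
  unfold potentialDeriv₂
  exact (continuousOn_const.mul (continuousOn_const.mul (continuousOn_const.mul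
    (continuousOn_id.rpow_const fun x hx => Or.inl (ne_of_gt hx))))).add
    (continuousOn_const_div_pow _ _)

/-- `∫ |Aφ|²` after integration by parts. -/
theorem integral_graph_le (φ : 𝓓(posReals, ℂ)) :
    ∫ x in Ioi 0, (1 * ‖iteratedDeriv 2 φ x‖ ^ 2 + 2 * potential α k x * ‖iteratedDeriv 1 φ x‖ ^ 2 +
      (potential α k x ^ 2 - potentialDeriv₂ α k x) * ‖iteratedDeriv 0 φ x‖ ^ 2) ≤
    ∫ x in Ioi 0, 1 * ‖diffOp α k φ x‖ ^ 2 := by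
  have hV := continuousOn_potential α k
  -- For G = -2V⟨φ, φ'⟩ + V'|φ|² the terms with V' cancel in the derivative, and the pointwise
  -- relation is an equality with |φ'' - Vφ|².
  refine integral_le_of_deriv φ
    (G := fun x => -(2 * (potential α k x *
      inner ℝ (iteratedDeriv 0 φ x) (iteratedDeriv 1 φ x))) +
      potentialDeriv α k x * ‖iteratedDeriv 0 φ x‖ ^ 2)
    (G' := fun x => -(2 * (potentialDeriv α k x *
      inner ℝ (iteratedDeriv 0 φ x) (iteratedDeriv 1 φ x) +
      potential α k x * (inner ℝ (iteratedDeriv 0 φ x) (iteratedDeriv 2 φ x) +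
      inner ℝ (iteratedDeriv 1 φ x) (iteratedDeriv 1 φ x)))) +
      (potentialDeriv₂ α k x * ‖iteratedDeriv 0 φ x‖ ^ 2 + potentialDeriv α k x *
        (2 * inner ℝ (iteratedDeriv 0 φ x) (iteratedDeriv 1 φ x))))
    (fun x hx => ((((hasDerivAt_potential hx).mul ((hasDerivAt_iteratedDeriv φ 0 x).inner ℝ
      (hasDerivAt_iteratedDeriv φ 1 x))).const_mul 2).neg).add
      ((hasDerivAt_potentialDeriv hx).mul (hasDerivAt_norm_sq_iteratedDeriv φ 0 x)))
    (((continuousOn_const.mul ((continuousOn_potentialDeriv.mul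
      (continuous_inner_iteratedDeriv φ 0 1).continuousOn).add (hV.mul
      ((continuous_inner_iteratedDeriv φ 0 2).add
      (continuous_inner_iteratedDeriv φ 1 1)).continuousOn))).neg).add
      ((continuousOn_potentialDeriv₂.mul
      ((continuous_iteratedDeriv φ 0).norm.pow 2).continuousOn).add
      (continuousOn_potentialDeriv.mul
      ((continuous_inner_iteratedDeriv φ 0 1).const_mul 2).continuousOn)))
    (fun x hx => by simp only [iteratedDeriv_eq_zero φ hx]; simp)
    (fun x hx => by simp only [iteratedDeriv_eq_zero φ hx]; simp)
    (((integrableOn_weight_mul_sq continuousOn_const φ 2).add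
      (integrableOn_weight_mul_sq (continuousOn_const.mul hV) φ 1)).add
      (integrableOn_weight_mul_sq ((hV.pow 2).sub continuousOn_potentialDeriv₂) φ 0))
    (integrableOn_weight_mul continuousOn_const ((continuous_diffOp α k φ).norm.pow 2) φ
      fun x hx => support_diffOp (α := α) (k := k) φ fun h => hx (by simp [h])) fun x _ => ?_
  have h := norm_sub_smul_sq (iteratedDeriv 0 φ x) (iteratedDeriv 2 φ x) (potential α k x)
  have e : diffOp α k φ x = -(iteratedDeriv 2 φ x - potential α k x • iteratedDeriv 0 φ x) := by
    rw [diffOp, Complex.real_smul, iteratedDeriv_zero]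
    ring
  rw [e, norm_neg, h, real_inner_self_eq_norm_sq]
  linarith


/-! ### Coercivity of the graph norm. -/

variable {α : ℝ} {k : ℤ} {x : ℝ}

/-- The bound 3/4 is the value at α = 1 and also the coupling at which the Hardy constant in
`exists_graph_estimate` degenerates. -/
theorem coupling_lt (hα0 : 0 ≤ α) (hα1 : α < 1) : α * (2 + α) / 4 < 3 / 4 := by nlinarith

/-- The left side is the contribution of k² x^(2α) to V''. It is less singular than x^(-4), so near
the origin it fits into an arbitrarily small multiple of x^(-4), and elsewhere it is bounded above.
-/
theorem exists_rpow_le (hα0 : 0 ≤ α) (hα1 : α < 1) (k : ℤ) {ε : ℝ} (hε : 0 < ε) :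
    ∃ M, 0 ≤ M ∧ ∀ x, 0 < x → (k : ℝ) ^ 2 * (2 * α * ((2 * α - 1) * x ^ (2 * α - 1 - 1))) ≤
      ε / x ^ 4 + M := by
  -- Since 2α(2α - 1) ≤ 2, the term 2k² suffices; the added 1 keeps `K` positive even for k = 0.
  set K : ℝ := 2 * (k : ℝ) ^ 2 + 1 with hK
  have hK0 : 0 < K := by positivity
  have hle : ∀ x : ℝ, 0 < x → (k : ℝ) ^ 2 * (2 * α * ((2 * α - 1) * x ^ (2 * α - 1 - 1))) ≤
      K * x ^ (2 * α - 2) := by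
    intro x hx
    have hy : 0 < x ^ (2 * α - 2) := by positivity
    rw [show 2 * α - 1 - 1 = 2 * α - 2 by ring]
    have h1 : 2 * α * (2 * α - 1) ≤ 2 := by nlinarith
    have h2 : (k : ℝ) ^ 2 * (2 * α * (2 * α - 1)) ≤ K := by
      nlinarith [sq_nonneg (k : ℝ)]
    nlinarith
  set x₀ : ℝ := min 1 √(ε / K) with hx₀
  have h0 : 0 < x₀ := lt_min one_pos (Real.sqrt_pos.2 (by positivity))
  have hx₀' : K * x₀ ^ (2 * α + 2) ≤ ε := by
    have : x₀ ^ (2 * α + 2) ≤ ε / K := by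
      calc x₀ ^ (2 * α + 2) ≤ x₀ ^ (2 : ℝ) :=
            Real.rpow_le_rpow_of_exponent_ge h0 (min_le_left _ _) (by linarith)
        _ ≤ √(ε / K) ^ (2 : ℝ) := Real.rpow_le_rpow h0.le (min_le_right _ _) (by norm_num)
        _ = ε / K := by
            rw [show (2 : ℝ) = ((2 : ℕ) : ℝ) by norm_num, Real.rpow_natCast,
              Real.sq_sqrt (by positivity)]
    calc _ ≤ K * (ε / K) := by gcongr
      _ = ε := by field_simp
  refine ⟨K * x₀ ^ (2 * α - 2), by positivity, fun x hx => (hle x hx).trans ?_⟩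
  rcases le_or_gt x x₀ with h | h
  · refine le_add_of_le_of_nonneg ?_ (by positivity)
    rw [le_div_iff₀ (by positivity), mul_assoc, ← Real.rpow_natCast x 4, ← Real.rpow_add hx]
    refine le_trans ?_ hx₀'
    gcongr
    rw [show 2 * α - 2 + ((4 : ℕ) : ℝ) = 2 * α + 2 by push_cast; ring]
    exact Real.rpow_le_rpow hx.le h (by linarith)
  · refine le_add_of_nonneg_of_le (by positivity) ?_
    gcongr K * ?_
    exact Real.rpow_le_rpow_of_nonpos h0 h.le (by linarith)

/-- The graph norm of the operator controls second derivatives and the confining potential. -/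
theorem exists_graph_estimate (hα0 : 0 ≤ α) (hα1 : α < 1) (k : ℤ) :
    ∃ C, 0 ≤ C ∧ ∀ φ : 𝓓(posReals, ℂ),
      (∫ x in Ioi 0, ‖iteratedDeriv 2 φ x‖ ^ 2 ≤
        C * ((∫ x in Ioi 0, ‖diffOp α k φ x‖ ^ 2) + ∫ x in Ioi 0, ‖iteratedDeriv 0 φ x‖ ^ 2)) ∧
      ∫ x in Ioi 0, ((k : ℝ) ^ 2 * x ^ (2 * α)) ^ 2 * ‖iteratedDeriv 0 φ x‖ ^ 2 ≤
        C * ((∫ x in Ioi 0, ‖diffOp α k φ x‖ ^ 2) + ∫ x in Ioi 0, ‖iteratedDeriv 0 φ x‖ ^ 2) := by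
  set c : ℝ := α * (2 + α) / 4 with hc
  have hc0 : 0 ≤ c := by positivity
  have hc1 : c < 3 / 4 := coupling_lt hα0 hα1
  -- Hardy's inequalities give ∫|φ''|² ≥ (1/4)∫|φ'|²/x² and ∫|φ'|²/x² ≥ (9/4)∫|φ|²/x⁴. The total
  -- coefficient of ∫|φ|²/x⁴ is then at least 9/16 + 9c/2 + c² - 6c, which is `d`.
  set d : ℝ := (3 / 4 - c) ^ 2 with hd
  have hd0 : 0 < d := by
    have : 0 < 3 / 4 - c := by linarith
    positivity
  obtain ⟨M, hM, hM'⟩ := exists_rpow_le hα0 hα1 k (show 0 < d / 4 by positivity)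
  -- Of the available margin, d/4 of the second-derivative term is retained and d/4 pays for the
  -- singular part of V''.
  have main : ∀ φ : 𝓓(posReals, ℂ),
      d / 4 * (∫ x in Ioi 0, ‖iteratedDeriv 2 φ x‖ ^ 2) +
        ∫ x in Ioi 0, ((k : ℝ) ^ 2 * x ^ (2 * α)) ^ 2 * ‖iteratedDeriv 0 φ x‖ ^ 2 ≤
      (∫ x in Ioi 0, ‖diffOp α k φ x‖ ^ 2) + M * ∫ x in Ioi 0, ‖iteratedDeriv 0 φ x‖ ^ 2 := by
    intro φ
    have hq : ContinuousOn (fun x : ℝ => ((k : ℝ) ^ 2 * x ^ (2 * α)) ^ 2) (Ioi 0) :=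
      (continuousOn_const.mul (continuousOn_id.rpow_const fun x hx => Or.inl (ne_of_gt hx))).pow 2
    have hV := continuousOn_potential α k
    have i2 := integrableOn_weight_mul_sq (w := fun _ => 1) continuousOn_const φ 2
    have i1 := integrableOn_weight_mul_sq (continuousOn_const_div_pow 1 2) φ 1
    have i0 := integrableOn_weight_mul_sq (continuousOn_const_div_pow 1 4) φ 0
    have iq := integrableOn_weight_mul_sq hq φ 0
    have iN := integrableOn_weight_mul_sq (w := fun _ => 1) continuousOn_const φ 0
    have j2 := i1.const_mul (2 * c)
    have j3 := i0.const_mul (c ^ 2 - 6 * c - d / 4)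
    have j5 := iN.const_mul M
    have h1 := hardy φ 1
    have h2 := hardy_four φ 0
    have h3 := integral_graph_le (α := α) (k := k) φ
    have h4 : (∫ x in Ioi 0, 1 * ‖iteratedDeriv 2 φ x‖ ^ 2) +
        2 * c * (∫ x in Ioi 0, 1 / x ^ 2 * ‖iteratedDeriv 1 φ x‖ ^ 2) +
        (c ^ 2 - 6 * c - d / 4) * (∫ x in Ioi 0, 1 / x ^ 4 * ‖iteratedDeriv 0 φ x‖ ^ 2) +
        (∫ x in Ioi 0, ((k : ℝ) ^ 2 * x ^ (2 * α)) ^ 2 * ‖iteratedDeriv 0 φ x‖ ^ 2) -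
        M * (∫ x in Ioi 0, 1 * ‖iteratedDeriv 0 φ x‖ ^ 2) ≤
        ∫ x in Ioi 0, (1 * ‖iteratedDeriv 2 φ x‖ ^ 2 +
        2 * potential α k x * ‖iteratedDeriv 1 φ x‖ ^ 2 +
        (potential α k x ^ 2 - potentialDeriv₂ α k x) * ‖iteratedDeriv 0 φ x‖ ^ 2) := by
      have s1 := i2.add j2
      have s2 := s1.add j3
      have s3 := s2.add iq
      rw [← integral_const_mul, ← integral_const_mul, ← integral_const_mul,
        ← integral_add' i2 j2, ← integral_add' s1 j3, ← integral_add' s2 iq,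
        ← integral_sub' s3 j5]
      refine setIntegral_mono_on (s3.sub j5)
        ((i2.add (integrableOn_weight_mul_sq (continuousOn_const.mul hV) φ 1)).add
        (integrableOn_weight_mul_sq ((hV.pow 2).sub continuousOn_potentialDeriv₂) φ 0))
        measurableSet_Ioi fun x hx => ?_
      have hx : 0 < x := hx
      have hM'' := hM' x hx
      set q : ℝ := (k : ℝ) ^ 2 * x ^ (2 * α) with hqdef
      have hq0 : 0 ≤ q := by positivity
      have hVx : potential α k x = q + c / x ^ 2 := by rw [potential_eq]
      have e1 : c / x ^ 2 ≤ potential α k x := by rw [hVx]; linarith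
      have e2 : (c ^ 2 - 6 * c - d / 4) * (1 / x ^ 4) + q ^ 2 - M ≤
          potential α k x ^ 2 - potentialDeriv₂ α k x := by
        have e3 : potentialDeriv₂ α k x = (k : ℝ) ^ 2 * (2 * α * ((2 * α - 1) *
            x ^ (2 * α - 1 - 1))) + 6 * c / x ^ 4 := by
          rw [potentialDeriv₂, ← hc]
          push_cast
          ring
        have e4 : 0 ≤ 2 * q * (c / x ^ 2) := by positivity
        have e5 : (q + c / x ^ 2) ^ 2 = q ^ 2 + 2 * q * (c / x ^ 2) + c ^ 2 * (1 / x ^ 4) := by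
          field_simp
          ring
        rw [e3, hVx, e5]
        have e6 : (c ^ 2 - 6 * c - d / 4) * (1 / x ^ 4) =
          c ^ 2 * (1 / x ^ 4) - 6 * c / x ^ 4 - d / 4 / x ^ 4 := by ring
        linarith
      have n1 := mul_le_mul_of_nonneg_right e1 (sq_nonneg ‖iteratedDeriv 1 φ x‖)
      have n2 := mul_le_mul_of_nonneg_right e2 (sq_nonneg ‖iteratedDeriv 0 φ x‖)
      have n3 : 2 * c * (1 / x ^ 2 * ‖iteratedDeriv 1 φ x‖ ^ 2) =
        2 * (c / x ^ 2 * ‖iteratedDeriv 1 φ x‖ ^ 2) := by ring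
      simp only [Pi.add_apply, Pi.sub_apply]
      rw [n3]
      linarith
    have t1 : ∫ x in Ioi 0, 4 * ‖iteratedDeriv (1 + 1) φ x‖ ^ 2 =
        4 * ∫ x in Ioi 0, ‖iteratedDeriv 2 φ x‖ ^ 2 := integral_const_mul _ _
    have t2 : ∫ x in Ioi 0, 9 / x ^ 4 * ‖iteratedDeriv 0 φ x‖ ^ 2 =
        9 * ∫ x in Ioi 0, 1 / x ^ 4 * ‖iteratedDeriv 0 φ x‖ ^ 2 := by
      rw [← integral_const_mul]
      exact integral_congr_ae (ae_of_all _ fun x => by ring)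
    have t3 : ∫ x in Ioi 0, 4 / x ^ 2 * ‖iteratedDeriv (0 + 1) φ x‖ ^ 2 =
        4 * ∫ x in Ioi 0, 1 / x ^ 2 * ‖iteratedDeriv 1 φ x‖ ^ 2 := by
      rw [← integral_const_mul]
      exact integral_congr_ae (ae_of_all _ fun x => by ring)
    have hJ0 : 0 ≤ ∫ x in Ioi 0, 1 / x ^ 4 * ‖iteratedDeriv 0 φ x‖ ^ 2 :=
      setIntegral_nonneg measurableSet_Ioi fun x _ => by positivity
    rw [t1] at h1
    rw [t2, t3] at h2
    simp only [one_mul] at h3 h4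
    generalize (∫ x in Ioi 0, ‖iteratedDeriv 2 φ x‖ ^ 2) = I2 at *
    generalize (∫ x in Ioi 0, 1 / x ^ 2 * ‖iteratedDeriv 1 φ x‖ ^ 2) = J1 at *
    generalize (∫ x in Ioi 0, 1 / x ^ 4 * ‖iteratedDeriv 0 φ x‖ ^ 2) = J0 at *
    have hd1 : d ≤ 9 / 16 := by rw [hd]; nlinarith
    -- Only the fraction 1 - d/4 of `I2` passes through Hardy; it is nonnegative because d ≤ 9/16.
    -- The balance in `k3` is what remains of `d`.
    have k1 : (1 - d / 4) / 4 * J1 ≤ (1 - d / 4) * I2 := by nlinarith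
    have k2 : 9 / 4 * ((1 - d / 4) / 4 + 2 * c) * J0 ≤ ((1 - d / 4) / 4 + 2 * c) * J1 := by
      nlinarith
    have k3 : 9 / 4 * ((1 - d / 4) / 4 + 2 * c) + (c ^ 2 - 6 * c - d / 4) =
      d * (1 - 9 / 64 - 1 / 4) := by rw [hd]; ring
    have k4 : 0 ≤ d * (1 - 9 / 64 - 1 / 4) * J0 := by
      refine mul_nonneg (mul_nonneg hd0.le (by norm_num)) hJ0
    rw [← k3] at k4
    linarith
  -- The summand 4/d serves the second derivative and 1 the weighted term.
  refine ⟨(4 / d + 1) * (M + 1), by positivity, fun φ => ?_⟩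
  have h := main φ
  have n2 : 0 ≤ ∫ x in Ioi 0, ‖iteratedDeriv 2 φ x‖ ^ 2 :=
    setIntegral_nonneg measurableSet_Ioi fun x _ => by positivity
  have nq : 0 ≤ ∫ x in Ioi 0, ((k : ℝ) ^ 2 * x ^ (2 * α)) ^ 2 * ‖iteratedDeriv 0 φ x‖ ^ 2 :=
    setIntegral_nonneg measurableSet_Ioi fun x _ => by positivity
  have nT : 0 ≤ ∫ x in Ioi 0, ‖diffOp α k φ x‖ ^ 2 :=
    setIntegral_nonneg measurableSet_Ioi fun x _ => by positivity
  have nN : 0 ≤ ∫ x in Ioi 0, ‖iteratedDeriv 0 φ x‖ ^ 2 :=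
    setIntegral_nonneg measurableSet_Ioi fun x _ => by positivity
  generalize (∫ x in Ioi 0, ‖iteratedDeriv 2 φ x‖ ^ 2) = I2 at *
  generalize (∫ x in Ioi 0, ((k : ℝ) ^ 2 * x ^ (2 * α)) ^ 2 * ‖iteratedDeriv 0 φ x‖ ^ 2) = Q at *
  generalize (∫ x in Ioi 0, ‖diffOp α k φ x‖ ^ 2) = T at *
  generalize (∫ x in Ioi 0, ‖iteratedDeriv 0 φ x‖ ^ 2) = N at *
  have hR : T + M * N ≤ (M + 1) * (T + N) := by nlinarith
  have hR0 : 0 ≤ (M + 1) * (T + N) := by positivity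
  have hd4 : 0 ≤ 4 / d * ((M + 1) * (T + N)) := by positivity
  constructor
  · have : I2 ≤ 4 / d * ((M + 1) * (T + N)) := by
      rw [div_mul_eq_mul_div, le_div_iff₀ hd0]
      linarith
    linarith
  · have : 0 ≤ d / 4 * I2 := by positivity
    linarith


variable {α : ℝ} {k : ℤ} {x : ℝ}

/-! ### Limits of test functions in Sobolev spaces -/

theorem norm_sq_eq_integral (u : L2) : ‖u‖ ^ 2 = ∫ x in Ioi 0, ‖u x‖ ^ 2 := by
  have h : inner ℂ u u = ((‖u‖ ^ 2 : ℝ) : ℂ) := by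
    rw [inner_self_eq_norm_sq_to_K]
    push_cast
    rfl
  have h2 : inner ℂ u u = ((∫ x in Ioi 0, ‖u x‖ ^ 2 : ℝ) : ℂ) := by
    rw [L2.inner_def, ← integral_complex_ofReal]
    refine integral_congr_ae (ae_of_all _ fun x => ?_)
    simp only
    rw [inner_self_eq_norm_sq_to_K]
    push_cast
    rfl
  exact_mod_cast h.symm.trans h2

theorem norm_toLp_sq {f : ℝ → ℂ} (hf : MemLp f 2 leb) :
    ‖hf.toLp f‖ ^ 2 = ∫ x in Ioi 0, ‖f x‖ ^ 2 := by
  rw [norm_sq_eq_integral]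
  refine integral_congr_ae ?_
  filter_upwards [hf.coeFn_toLp] with x hx
  rw [hx]

theorem memLp_iteratedDeriv (φ : 𝓓(posReals, ℂ)) (m : ℕ) : MemLp (iteratedDeriv m φ) 2 leb :=
  (continuous_iteratedDeriv φ m).memLp_of_hasCompactSupport (hasCompactSupport_iteratedDeriv φ m)

theorem iteratedDeriv_test_add (φ ψ : 𝓓(posReals, ℂ)) (m : ℕ) :
    iteratedDeriv m (φ + ψ : 𝓓(posReals, ℂ)) = iteratedDeriv m φ + iteratedDeriv m ψ := by
  ext x
  exact iteratedDeriv_add (φ.contDiff.contDiffAt.of_le (WithTop.coe_le_coe.2 le_top))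
    (ψ.contDiff.contDiffAt.of_le (WithTop.coe_le_coe.2 le_top))

theorem iteratedDeriv_test_smul (c : ℂ) (φ : 𝓓(posReals, ℂ)) (m : ℕ) :
    iteratedDeriv m (c • φ : 𝓓(posReals, ℂ)) = c • iteratedDeriv m φ := by
  ext x
  exact iteratedDeriv_const_smul (φ.contDiff.contDiffAt.of_le (WithTop.coe_le_coe.2 le_top)) c

/-- Differentiation of test functions as a linear map to `L²(ℝ⁺)`. -/
def derivToL2 (m : ℕ) : 𝓓(posReals, ℂ) →ₗ[ℂ] L2 where
  toFun φ := (memLp_iteratedDeriv φ m).toLp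
  map_add' φ ψ := by
    rw [← MemLp.toLp_add]
    exact MemLp.toLp_congr _ _ (by rw [iteratedDeriv_test_add])
  map_smul' c φ := by
    rw [RingHom.id_apply, ← MemLp.toLp_const_smul]
    exact MemLp.toLp_congr _ _ (by rw [iteratedDeriv_test_smul])

theorem derivToL2_zero (φ : 𝓓(posReals, ℂ)) : derivToL2 0 φ = testToL2 φ :=
  MemLp.toLp_congr (memLp_iteratedDeriv φ 0) (memLp_test φ) (by rw [iteratedDeriv_zero])

theorem norm_derivToL2_sq (m : ℕ) (φ : 𝓓(posReals, ℂ)) :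
    ‖derivToL2 m φ‖ ^ 2 = ∫ x in Ioi 0, ‖iteratedDeriv m φ x‖ ^ 2 :=
  norm_toLp_sq (memLp_iteratedDeriv φ m)

theorem norm_testToL2_sq (φ : 𝓓(posReals, ℂ)) :
    ‖testToL2 φ‖ ^ 2 = ∫ x in Ioi 0, ‖iteratedDeriv 0 φ x‖ ^ 2 := by
  rw [← derivToL2_zero, norm_derivToL2_sq]

theorem norm_diffOpToL2_sq (φ : 𝓓(posReals, ℂ)) :
    ‖diffOpToL2 α k φ‖ ^ 2 = ∫ x in Ioi 0, ‖diffOp α k φ x‖ ^ 2 :=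
  norm_toLp_sq (memLp_diffOp α k φ)

theorem integral_mul_eq_inner (u : L2) {f : ℝ → ℂ} (hf : MemLp (fun x => conj (f x)) 2 leb) :
    ∫ x in Ioi 0, u x * f x = inner ℂ hf.toLp u := by
  rw [← inner_conj_symm, inner_toLp_right, Complex.conj_conj]
  simp

theorem tendsto_integral_mul {u : ℕ → L2} {v : L2} (hu : Tendsto u atTop (𝓝 v)) {f : ℝ → ℂ}
    (hf : MemLp f 2 leb) :
    Tendsto (fun n => ∫ x in Ioi 0, u n x * f x) atTop (𝓝 (∫ x in Ioi 0, v x * f x)) := by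
  have hf' : MemLp (fun x => conj (f x)) 2 leb := hf.star
  simp only [fun u => integral_mul_eq_inner u hf']
  exact tendsto_const_nhds.inner hu

theorem integral_iteratedDeriv_mul (φ ψ : 𝓓(posReals, ℂ)) (m : ℕ) :
    ∫ x in Ioi 0, φ x * iteratedDeriv m ψ x =
      (-1) ^ m * ∫ x in Ioi 0, iteratedDeriv m φ x * ψ x := by
  have hglob : ∀ i j : ℕ, ∫ x in Ioi 0, iteratedDeriv i φ x * iteratedDeriv j ψ x =
      ∫ x, iteratedDeriv i φ x * iteratedDeriv j ψ x := by
    intro i j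
    refine setIntegral_eq_integral_of_forall_compl_eq_zero fun x hx => ?_
    rw [deriv_eq_zero_of_notMem φ hx, zero_mul]
  have hint : ∀ i j : ℕ, Integrable fun x => iteratedDeriv i φ x * iteratedDeriv j ψ x :=
    fun i j => ((continuous_iteratedDeriv φ i).mul
      (continuous_iteratedDeriv ψ j)).integrable_of_hasCompactSupport
      (hasCompactSupport_iteratedDeriv ψ j).mul_left
  have key : ∀ i : ℕ, ∫ x, iteratedDeriv i φ x * iteratedDeriv m ψ x =
      (-1) ^ m * ∫ x, iteratedDeriv (i + m) φ x * iteratedDeriv 0 ψ x := by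
    induction m with
    | zero => intro i; simp
    | succ m ih =>
      intro i
      rw [integral_mul_deriv_eq_deriv_mul_of_integrable
        (fun x _ => hasDerivAt_iteratedDeriv φ i x) (fun x _ => hasDerivAt_iteratedDeriv ψ m x)
        (hint _ _) (hint _ _) (hint _ _), ih, pow_succ, show i + 1 + m = i + (m + 1) by ring]
      ring
  have h := key 0
  rw [← hglob, ← hglob, zero_add] at h
  simpa only [iteratedDeriv_zero] using h

/-- Weak derivatives are stable under limits. -/
theorem hasWeakDeriv_of_tendsto {φ : ℕ → 𝓓(posReals, ℂ)} {u v : L2} {m : ℕ}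
    (hu : Tendsto (fun n => testToL2 (φ n)) atTop (𝓝 u))
    (hv : Tendsto (fun n => derivToL2 m (φ n)) atTop (𝓝 v)) : HasWeakDeriv m u v := by
  refine ⟨locallyIntegrableOn_L2 u, locallyIntegrableOn_L2 v, fun ψ => ?_⟩
  have h1 := tendsto_integral_mul hu (memLp_iteratedDeriv ψ m)
  have h2 := (tendsto_integral_mul hv (memLp_test ψ)).const_mul ((-1) ^ m)
  refine tendsto_nhds_unique h1 (h2.congr fun n => ?_)
  have e1 : ∫ x in Ioi 0, testToL2 (φ n) x * iteratedDeriv m ψ x =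
      ∫ x in Ioi 0, φ n x * iteratedDeriv m ψ x := by
    refine integral_congr_ae ?_
    filter_upwards [(memLp_test (φ n)).coeFn_toLp] with x hx
    exact congrArg (· * iteratedDeriv m ψ x) hx
  have e2 : ∫ x in Ioi 0, derivToL2 m (φ n) x * ψ x =
      ∫ x in Ioi 0, iteratedDeriv m (φ n) x * ψ x := by
    refine integral_congr_ae ?_
    filter_upwards [(memLp_iteratedDeriv (φ n) m).coeFn_toLp] with x hx
    exact congrArg (· * ψ x) hx
  rw [e1, e2, integral_iteratedDeriv_mul]

theorem eLpNorm_sub_iteratedDeriv (v : L2) (φ : 𝓓(posReals, ℂ)) (m : ℕ) :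
    eLpNorm (fun x => v x - iteratedDeriv m φ x) 2 leb = ENNReal.ofReal ‖v - derivToL2 m φ‖ := by
  rw [Lp.norm_def, ENNReal.ofReal_toReal (Lp.eLpNorm_ne_top _)]
  refine eLpNorm_congr_ae ?_
  filter_upwards [Lp.coeFn_sub v (derivToL2 m φ), (memLp_iteratedDeriv φ m).coeFn_toLp]
    with x h1 h2
  rw [h1, Pi.sub_apply]
  exact congrArg (v x - ·) h2.symm

theorem mem_sobolevZero_of_cauchySeq {φ : ℕ → 𝓓(posReals, ℂ)} {u : L2} {N : ℕ}
    (hu : Tendsto (fun n => testToL2 (φ n)) atTop (𝓝 u))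
    (hc : ∀ m ≤ N, CauchySeq fun n => derivToL2 m (φ n)) : u ∈ sobolevZero N := by
  have h : ∀ m : ℕ, ∃ v : L2, m ≤ N → Tendsto (fun n => derivToL2 m (φ n)) atTop (𝓝 v) := by
    intro m
    by_cases hm : m ≤ N
    · obtain ⟨v, hv⟩ := cauchySeq_tendsto_of_complete (hc m hm)
      exact ⟨v, fun _ => hv⟩
    -- Orders above `N` are not constrained, so any value will do.
    · exact ⟨0, fun h => absurd h hm⟩
  choose v hv using h
  refine ⟨v, fun m hm => hasWeakDeriv_of_tendsto hu (hv m hm), fun ε hε => ?_⟩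
  have h1 : ∀ᶠ n in atTop, ∀ m ∈ Finset.range (N + 1), ‖v m - derivToL2 m (φ n)‖ < ε := by
    rw [Filter.eventually_all_finset]
    intro m hm
    have := (hv m (Nat.lt_succ_iff.1 (Finset.mem_range.1 hm))).const_sub (v m)
    rw [sub_self] at this
    exact this.norm.eventually_lt_const (by simpa using hε)
  obtain ⟨n, hn⟩ := h1.exists
  refine ⟨φ n, fun m hm => ?_⟩
  rw [eLpNorm_sub_iteratedDeriv]
  exact (ENNReal.ofReal_lt_ofReal_iff hε).2 (hn m (Finset.mem_range.2 (Nat.lt_succ_of_le hm)))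

/-- The definition of the space does not identify the zeroth weak derivative with u; the fundamental
lemma does. -/
theorem exists_seq_of_mem_sobolevZero {u : L2} {N : ℕ} (hu : u ∈ sobolevZero N) :
    ∃ (v : ℕ → L2) (φ : ℕ → 𝓓(posReals, ℂ)), v 0 = u ∧ (∀ m ≤ N, HasWeakDeriv m u (v m)) ∧
      ∀ m ≤ N, Tendsto (fun n => derivToL2 m (φ n)) atTop (𝓝 (v m)) := by
  obtain ⟨v, hv, happ⟩ := hu
  have hpos : ∀ n : ℕ, (0 : ℝ) < 1 / ((n : ℝ) + 1) := fun n => by positivity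
  choose φ hφ using fun n : ℕ => happ _ (hpos n)
  refine ⟨v, φ, ?_, hv, fun m hm => ?_⟩
  · obtain ⟨h1, h2, h3⟩ := hv 0 (Nat.zero_le N)
    have h4 := ae_eq_zero_of_forall_test (h1.sub h2) fun ψ => by
      have e := h3 ψ
      rw [pow_zero, one_mul, iteratedDeriv_zero] at e
      simp only [Pi.sub_apply, sub_mul]
      rw [integral_sub (integrable_mul_test h1 ψ).integrableOn
        (integrable_mul_test h2 ψ).integrableOn, e, sub_self]
    refine Lp.ext ?_
    filter_upwards [h4] with x hx
    exact (sub_eq_zero.1 hx).symm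
  · rw [tendsto_iff_norm_sub_tendsto_zero]
    refine squeeze_zero (fun _ => norm_nonneg _) (fun n => ?_) tendsto_one_div_add_atTop_nhds_zero_nat
    have := hφ n m hm
    rw [eLpNorm_sub_iteratedDeriv, ENNReal.ofReal_lt_ofReal_iff (hpos n)] at this
    rw [norm_sub_rev]
    exact this.le

/-- Fatou's lemma for weighted integrals along a convergent sequence. -/
theorem integrable_weight_of_tendsto {φ : ℕ → 𝓓(posReals, ℂ)} {u : L2}
    (hu : Tendsto (fun n => testToL2 (φ n)) atTop (𝓝 u)) {w : ℝ → ℝ}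
    (hw : ContinuousOn w (Ioi 0)) (hw0 : ∀ x, 0 < x → 0 ≤ w x) {C : ℝ}
    (hC : ∀ n, ∫ x in Ioi 0, w x * ‖iteratedDeriv 0 (φ n) x‖ ^ 2 ≤ C) :
    Integrable (fun x => w x * ‖u x‖ ^ 2) leb := by
  obtain ⟨ns, -, hns⟩ := (tendstoInMeasure_of_tendsto_Lp hu).exists_seq_tendsto_ae
  have hw' : AEStronglyMeasurable w leb := hw.aestronglyMeasurable measurableSet_Ioi
  have hm : AEStronglyMeasurable (fun x => w x * ‖u x‖ ^ 2) leb :=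
    hw'.mul ((Lp.aestronglyMeasurable u).norm.pow 2)
  have hae : ∀ᵐ x ∂leb, ∀ n, testToL2 (φ n) x = iteratedDeriv 0 (φ n) x := by
    rw [ae_all_iff]
    intro n
    rw [iteratedDeriv_zero]
    exact (memLp_test (φ n)).coeFn_toLp
  have hle : ∫⁻ x, ENNReal.ofReal (w x * ‖u x‖ ^ 2) ∂leb ≤
      liminf (fun n => ∫⁻ x, ENNReal.ofReal (w x * ‖iteratedDeriv 0 (φ (ns n)) x‖ ^ 2) ∂leb)
        atTop := by
    refine le_trans (lintegral_mono_ae ?_) (lintegral_liminf_le' fun n => ?_)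
    · filter_upwards [hns, hae] with x h1 h2
      simp only [h2] at h1
      have h3 := ENNReal.tendsto_ofReal ((h1.norm.pow 2).const_mul (w x))
      exact h3.liminf_eq.ge
    · exact (integrableOn_weight_mul_sq hw (φ (ns n)) 0).aestronglyMeasurable.aemeasurable.ennreal_ofReal
  refine ⟨hm, ?_⟩
  rw [hasFiniteIntegral_iff_ofReal (ae_leb_of_forall fun x hx =>
    mul_nonneg (hw0 x hx) (sq_nonneg _))]
  refine lt_of_le_of_lt hle (lt_of_le_of_lt (b := ENNReal.ofReal C) ?_ ENNReal.ofReal_lt_top)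
  refine liminf_le_of_le (by isBoundedDefault) fun b hb => ?_
  obtain ⟨n, hn⟩ := hb.exists
  refine hn.trans ?_
  rw [← ofReal_integral_eq_lintegral_ofReal (integrableOn_weight_mul_sq hw (φ (ns n)) 0)
    (ae_leb_of_forall fun x hx => mul_nonneg (hw0 x hx) (sq_nonneg _))]
  exact ENNReal.ofReal_le_ofReal (hC _)


variable {α : ℝ} {k : ℤ} {x : ℝ}

/-! ### Integrability at the origin and boundary values -/

theorem not_integrable_of_inv_le {f : ℝ → ℝ} {c : ℝ} (hc : 0 < c)
    (h : ∀ᶠ x in 𝓝[>] (0 : ℝ), c * x⁻¹ ≤ f x) : ¬ Integrable f leb := by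
  intro hf
  obtain ⟨t, ht, hsub⟩ := mem_nhdsGT_iff_exists_Ioo_subset.1 h
  have ht : 0 < t := ht
  have h1 : IntegrableOn (fun x : ℝ => x ^ (-1 : ℝ)) (Ioo 0 t) := by
    have hf' : IntegrableOn f (Ioo 0 t) :=
      (show IntegrableOn f (Ioi 0) volume from hf).mono_set Ioo_subset_Ioi_self
    refine Integrable.mono' (hf'.const_mul c⁻¹) ?_ ?_
    · exact (continuousOn_id.rpow_const fun x hx => Or.inl (ne_of_gt hx.1)).aestronglyMeasurable
        measurableSet_Ioo
    · refine (ae_restrict_mem measurableSet_Ioo).mono fun x hx => ?_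
      have hx0 : 0 < x := hx.1
      have h2 : c * x⁻¹ ≤ f x := hsub hx
      rw [Real.norm_of_nonneg (by positivity), Real.rpow_neg_one, ← div_eq_inv_mul,
        le_div_iff₀ hc, mul_comm]
      exact h2
  rw [intervalIntegral.integrableOn_Ioo_rpow_iff ht] at h1
  exact lt_irrefl _ h1

/-- Near the origin x^(-α/2) ≥ 1, while the other terms tend to zero. -/
theorem eventually_le_norm_of_ne_zero (hα0 : 0 ≤ α) {f : ℝ → ℂ} {p q : ℂ} (hp : p ≠ 0)
    (ho : (fun x => f x - (p * (x ^ (-α / 2) : ℝ) + q * (x ^ (1 + α / 2) : ℝ)))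
      =o[𝓝[>] (0 : ℝ)] fun x : ℝ => x ^ (3 / 2 : ℝ)) :
    ∃ c : ℝ, 0 < c ∧ ∀ᶠ x in 𝓝[>] (0 : ℝ), c ≤ ‖f x‖ := by
  have hp0 : 0 < ‖p‖ := norm_pos_iff.2 hp
  refine ⟨‖p‖ / 2, by positivity, ?_⟩
  have h0 : ∀ r : ℝ, 0 < r → Tendsto (fun x : ℝ => x ^ r) (𝓝[>] 0) (𝓝 0) := fun r hr => by
    have := (Real.continuousAt_rpow_const 0 r (Or.inr hr.le)).tendsto
    rw [Real.zero_rpow hr.ne'] at this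
    exact this.mono_left nhdsWithin_le_nhds
  have h1 := ((h0 (1 + α / 2) (by positivity)).const_mul ‖q‖).add (h0 (3 / 2) (by norm_num))
  rw [mul_zero, add_zero] at h1
  filter_upwards [ho.bound one_pos, h1.eventually_lt_const (show 0 < ‖p‖ / 2 by positivity),
    Ioc_mem_nhdsGT (show (0 : ℝ) < 1 by norm_num)] with x h2 h3 hx
  have hx0 : 0 < x := hx.1
  have h4 : 1 ≤ x ^ (-α / 2) := Real.one_le_rpow_of_pos_of_le_one_of_nonpos hx0 hx.2 (by linarith)
  have e : p * (x ^ (-α / 2) : ℝ) = f x - q * (x ^ (1 + α / 2) : ℝ) -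
    (f x - (p * (x ^ (-α / 2) : ℝ) + q * (x ^ (1 + α / 2) : ℝ))) := by ring
  have h5 : ‖p * (x ^ (-α / 2) : ℝ)‖ = ‖p‖ * x ^ (-α / 2) := by
    rw [norm_mul, Complex.norm_real, Real.norm_of_nonneg (by positivity)]
  have h6 : ‖q * (x ^ (1 + α / 2) : ℝ)‖ = ‖q‖ * x ^ (1 + α / 2) := by
    rw [norm_mul, Complex.norm_real, Real.norm_of_nonneg (by positivity)]
  rw [one_mul, Real.norm_of_nonneg (by positivity)] at h2
  have h7 : ‖p‖ * x ^ (-α / 2) ≤ ‖f x‖ + ‖q‖ * x ^ (1 + α / 2) + x ^ (3 / 2 : ℝ) := by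
    rw [← h5, ← h6, e]
    exact (norm_sub_le _ _).trans (add_le_add (norm_sub_le _ _) h2)
  nlinarith

/-- Since 1 + α/2 < 3/2, the leading power dominates x^(3/2) on (0, 1], and half of it absorbs the
remainder. -/
theorem eventually_rpow_le_norm_of_ne_zero (hα1 : α < 1) {f : ℝ → ℂ} {q : ℂ} (hq : q ≠ 0)
    (ho : (fun x => f x - q * (x ^ (1 + α / 2) : ℝ)) =o[𝓝[>] (0 : ℝ)] fun x : ℝ => x ^ (3 / 2 : ℝ)) :
    ∃ c : ℝ, 0 < c ∧ ∀ᶠ x in 𝓝[>] (0 : ℝ), c * x ^ (3 / 2 : ℝ) ≤ ‖f x‖ := by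
  have hq0 : 0 < ‖q‖ := norm_pos_iff.2 hq
  refine ⟨‖q‖ / 2, by positivity, ?_⟩
  filter_upwards [ho.bound (show 0 < ‖q‖ / 2 by positivity),
    Ioc_mem_nhdsGT (show (0 : ℝ) < 1 by norm_num)] with x h2 hx
  have hx0 : 0 < x := hx.1
  have h4 : x ^ (3 / 2 : ℝ) ≤ x ^ (1 + α / 2) :=
    Real.rpow_le_rpow_of_exponent_ge hx0 hx.2 (by linarith)
  have e : q * (x ^ (1 + α / 2) : ℝ) = f x - (f x - q * (x ^ (1 + α / 2) : ℝ)) := by ring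
  have h6 : ‖q * (x ^ (1 + α / 2) : ℝ)‖ = ‖q‖ * x ^ (1 + α / 2) := by
    rw [norm_mul, Complex.norm_real, Real.norm_of_nonneg (by positivity)]
  rw [Real.norm_of_nonneg (by positivity)] at h2
  have h7 : ‖q‖ * x ^ (1 + α / 2) ≤ ‖f x‖ + ‖q‖ / 2 * x ^ (3 / 2 : ℝ) := by
    rw [← h6, e]
    exact (norm_sub_le _ _).trans (by gcongr)
  nlinarith

/-- The continuous representative of an element of the domain of the adjoint. -/
theorem coeff_asymp (hα0 : 0 ≤ α) (hα1 : α < 1) (hk : k ≠ 0) (g : (op α k)†.domain) :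
    ∃ f : ℝ → ℂ, (g : L2) =ᵐ[leb] f ∧
      (fun x => f x - (coeffA hα0 hα1 hk g * (x ^ (-α / 2) : ℝ) +
        (coeffB hα0 hα1 hk g - coeffA hα0 hα1 hk g * |(k : ℝ)|) / (1 + α) *
          (x ^ (1 + α / 2) : ℝ))) =o[𝓝[>] (0 : ℝ)] fun x : ℝ => x ^ (3 / 2 : ℝ) :=
  ⟨_, hasCoeff_coeff hα0 hα1 hk g, repSol_asymp hα0 hα1 hk (Lp.memLp _) _ _⟩

/-- A nonzero a keeps |g| away from zero at the origin, so the integrand would exceed a positive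
multiple of 1/x. The exponent n = 2 serves the domain of x⁻¹, and n = 4 serves H²_0. -/
theorem coeffA_eq_zero_of_integrable (hα0 : 0 ≤ α) (hα1 : α < 1) (hk : k ≠ 0)
    (g : (op α k)†.domain) {n : ℕ} (hn : n ≠ 0)
    (hi : Integrable (fun x => 1 / x ^ n * ‖(g : L2) x‖ ^ 2) leb) :
    coeffA hα0 hα1 hk g = 0 := by
  by_contra hne
  obtain ⟨f, hf, ho⟩ := coeff_asymp hα0 hα1 hk g
  obtain ⟨c, hc, hc'⟩ := eventually_le_norm_of_ne_zero hα0 hne ho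
  refine not_integrable_of_inv_le (f := fun x => 1 / x ^ n * ‖f x‖ ^ 2) (c := c ^ 2)
    (by positivity) ?_ (hi.congr ?_)
  · filter_upwards [hc', Ioc_mem_nhdsGT (show (0 : ℝ) < 1 by norm_num)] with x h1 hx
    have hx0 : 0 < x := hx.1
    have h2 : x⁻¹ ≤ 1 / x ^ n := by
      rw [← one_div]
      exact one_div_le_one_div_of_le (by positivity) (pow_le_of_le_one hx0.le hx.2 hn)
    rw [mul_comm]
    gcongr
  · filter_upwards [hf] with x hx
    rw [hx]

/-- Once a = 0, a nonzero b makes |g|² at least a multiple of x³ near the origin, and x^(-4) x³ =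
1/x is just non-integrable. -/
theorem coeff_eq_zero_of_integrable (hα0 : 0 ≤ α) (hα1 : α < 1) (hk : k ≠ 0)
    (g : (op α k)†.domain) (hi : Integrable (fun x => 1 / x ^ 4 * ‖(g : L2) x‖ ^ 2) leb) :
    coeffA hα0 hα1 hk g = 0 ∧ coeffB hα0 hα1 hk g = 0 := by
  have ha := coeffA_eq_zero_of_integrable hα0 hα1 hk g four_ne_zero hi
  refine ⟨ha, ?_⟩
  by_contra hne
  have h2 : (1 + α : ℂ) ≠ 0 := by
    have : (1 + α : ℝ) ≠ 0 := by positivity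
    exact_mod_cast this
  obtain ⟨f, hf, ho⟩ := coeff_asymp hα0 hα1 hk g
  simp only [ha, zero_mul, zero_add, sub_zero] at ho
  obtain ⟨c, hc, hc'⟩ := eventually_rpow_le_norm_of_ne_zero hα1 (div_ne_zero hne h2) ho
  refine not_integrable_of_inv_le (f := fun x => 1 / x ^ 4 * ‖f x‖ ^ 2) (c := c ^ 2)
    (by positivity) ?_ (hi.congr ?_)
  · filter_upwards [hc', self_mem_nhdsWithin] with x h1 hx
    have hx0 : 0 < x := hx
    have h3 : (c * x ^ (3 / 2 : ℝ)) ^ 2 = c ^ 2 * x ^ 3 := by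
      rw [mul_pow, ← Real.rpow_natCast (x ^ (3 / 2 : ℝ)) 2, ← Real.rpow_mul hx0.le,
        show (3 / 2 : ℝ) * ((2 : ℕ) : ℝ) = ((3 : ℕ) : ℝ) by norm_num, Real.rpow_natCast]
    calc c ^ 2 * x⁻¹ = 1 / x ^ 4 * (c * x ^ (3 / 2 : ℝ)) ^ 2 := by
          rw [h3]
          field_simp
      _ ≤ _ := by gcongr
  · filter_upwards [hf] with x hx
    rw [hx]

theorem mem_domInvX_iff (u : L2) :
    u ∈ domInvX ↔ Integrable (fun x => 1 / x ^ 2 * ‖u x‖ ^ 2) leb := by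
  have hm : AEStronglyMeasurable (fun x : ℝ => (x : ℂ)⁻¹ * u x) leb :=
    ((Complex.measurable_ofReal.inv).aestronglyMeasurable).mul (Lp.aestronglyMeasurable u)
  rw [domInvX, mem_ofPred_eq, ← memLp_norm_iff hm, memLp_two_iff_integrable_sq hm.norm]
  refine integrable_congr (ae_of_all _ fun x => ?_)
  simp only [norm_mul, norm_inv, Complex.norm_real, Real.norm_eq_abs, mul_pow, inv_pow, sq_abs,
    one_div]

theorem coeffA_eq_zero_of_mem_domInvX (hα0 : 0 ≤ α) (hα1 : α < 1) (hk : k ≠ 0)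
    (g : (op α k)†.domain) (hg : (g : L2) ∈ domInvX) : coeffA hα0 hα1 hk g = 0 :=
  coeffA_eq_zero_of_integrable hα0 hα1 hk g two_ne_zero ((mem_domInvX_iff _).1 hg)

/-! ### The domain of the closure -/

theorem cauchySeq_of_sq_le {E : Type*} [NormedAddCommGroup E] {u : ℕ → E} {r : ℕ × ℕ → ℝ}
    (h : ∀ p : ℕ × ℕ, ‖u p.1 - u p.2‖ ^ 2 ≤ r p) (hr : Tendsto r atTop (𝓝 0)) : CauchySeq u := by
  rw [cauchySeq_iff_tendsto_dist_atTop_0]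
  refine squeeze_zero (fun _ => dist_nonneg) (fun p => ?_)
    (by simpa using hr.sqrt : Tendsto (fun p => √(r p)) atTop (𝓝 0))
  rw [dist_eq_norm]
  exact Real.le_sqrt_of_sq_le (h p)

theorem tendsto_norm_sub_sq {E : Type*} [NormedAddCommGroup E] {u : ℕ → E} {v : E}
    (hu : Tendsto u atTop (𝓝 v)) :
    Tendsto (fun p : ℕ × ℕ => ‖u p.1 - u p.2‖ ^ 2) atTop (𝓝 0) := by
  have h1 : Tendsto (fun p : ℕ × ℕ => p.1) atTop atTop := LinearPMap.tendsto_fst_atTop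
  have h2 : Tendsto (fun p : ℕ × ℕ => p.2) atTop atTop := LinearPMap.tendsto_snd_atTop
  have := (((hu.comp h1).sub (hu.comp h2)).norm.pow 2)
  simpa using this

theorem exists_test_seq (x : ℕ → (op α k).domain) :
    ∃ φ : ℕ → 𝓓(posReals, ℂ), ∀ n, (x n : L2) = testToL2 (φ n) ∧
      op α k (x n) = diffOpToL2 α k (φ n) := by
  choose φ h hx using fun n => exists_test_of_mem α k (x n)
  refine ⟨φ, fun n => ⟨by rw [hx], by rw [hx, op_apply]⟩⟩

/-- Here k is a nonzero integer, so k² ≥ 1; comparing on both sides of x = 1 costs only 2^(2α) ≤ 4.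
-/
theorem japaneseBracket_rpow_le (hα0 : 0 ≤ α) (hα1 : α < 1) (hk : k ≠ 0) (hx : 0 < x) :
    japaneseBracket x ^ (4 * α) ≤ 4 * (1 + ((k : ℝ) ^ 2 * x ^ (2 * α)) ^ 2) := by
  have hk1 : 1 ≤ (k : ℝ) ^ 2 := by
    have : 1 ≤ k ^ 2 := by have := sq_pos_of_ne_zero hk; omega
    exact_mod_cast this
  have e1 : japaneseBracket x ^ (4 * α) = (1 + x ^ 2) ^ (2 * α) := by
    rw [japaneseBracket, Real.sqrt_eq_rpow, ← Real.rpow_mul (by positivity)]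
    ring_nf
  have e2 : (x ^ 2) ^ (2 * α) = (x ^ (2 * α)) ^ 2 := by
    rw [← Real.rpow_natCast x 2, ← Real.rpow_natCast (x ^ (2 * α)) 2, ← Real.rpow_mul hx.le,
      ← Real.rpow_mul hx.le, mul_comm]
  have e3 : (2 : ℝ) ^ (2 * α) ≤ 4 := by
    calc (2 : ℝ) ^ (2 * α) ≤ 2 ^ (2 : ℝ) :=
          Real.rpow_le_rpow_of_exponent_le (by norm_num) (by linarith)
      _ = 4 := by norm_num
  have hy : 0 ≤ (x ^ (2 * α)) ^ 2 := by positivity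
  have e4 : (x ^ (2 * α)) ^ 2 ≤ ((k : ℝ) ^ 2 * x ^ (2 * α)) ^ 2 := by
    rw [mul_pow]
    nlinarith [one_le_pow₀ hk1 (n := 2)]
  rw [e1]
  rcases le_total x 1 with h | h
  · calc (1 + x ^ 2) ^ (2 * α) ≤ 2 ^ (2 * α) :=
          Real.rpow_le_rpow (by positivity) (by nlinarith) (by positivity)
      _ ≤ 4 := e3
      _ ≤ _ := by nlinarith
  · calc (1 + x ^ 2) ^ (2 * α) ≤ (2 * x ^ 2) ^ (2 * α) :=
          Real.rpow_le_rpow (by positivity) (by nlinarith) (by positivity)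
      _ = 2 ^ (2 * α) * (x ^ (2 * α)) ^ 2 := by rw [Real.mul_rpow (by positivity) (by positivity), e2]
      _ ≤ 4 * (x ^ (2 * α)) ^ 2 := by gcongr
      _ ≤ _ := by nlinarith

theorem continuousOn_japaneseBracket_rpow :
    Continuous fun x => japaneseBracket x ^ (4 * α) := by
  unfold japaneseBracket
  refine Continuous.rpow_const (by fun_prop) fun x => Or.inl ?_
  positivity

/-- The graph estimate, applied to differences of approximating test functions, makes their second
derivatives Cauchy. The first derivatives follow by interpolation, and Fatou's lemma carries the
weighted bound to the limit. -/
theorem closure_domain_subset (hα0 : 0 ≤ α) (hα1 : α < 1) (hk : k ≠ 0) :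
    ((op α k).closure.domain : Set L2) ⊆
      sobolevZero 2 ∩ weightedL2 (fun x => japaneseBracket x ^ (4 * α)) := by
  intro u hu
  have hp := isBoundaryPair hα0 hα1 hk
  obtain ⟨y, hy, hy'⟩ := LinearPMap.exists_seq_of_mem_closure
    (LinearPMap.isClosable_of_symm hp.dense hp.symm) ⟨u, hu⟩
  obtain ⟨φ, hφ⟩ := exists_test_seq y
  simp only [fun n => (hφ n).1, fun n => (hφ n).2] at hy hy'
  obtain ⟨C, hC, hest⟩ := exists_graph_estimate hα0 hα1 k
  simp only [← norm_derivToL2_sq, ← norm_diffOpToL2_sq, derivToL2_zero] at hest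
  have hr := ((tendsto_norm_sub_sq hy').add (tendsto_norm_sub_sq hy))
  have c0 : CauchySeq fun n => derivToL2 0 (φ n) := by
    simp only [derivToL2_zero]
    exact hy.cauchySeq
  have c2 : CauchySeq fun n => derivToL2 2 (φ n) := by
    refine cauchySeq_of_sq_le (r := fun p => C * (‖diffOpToL2 α k (φ p.1) -
      diffOpToL2 α k (φ p.2)‖ ^ 2 + ‖testToL2 (φ p.1) - testToL2 (φ p.2)‖ ^ 2)) (fun p => ?_)
      (by simpa using hr.const_mul C)
    have := (hest (φ p.1 - φ p.2)).1
    simpa only [map_sub] using this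
  have c1 : CauchySeq fun n => derivToL2 1 (φ n) := by
    obtain ⟨v, hv⟩ := cauchySeq_tendsto_of_complete c2
    refine cauchySeq_of_sq_le (r := fun p => (‖testToL2 (φ p.1) - testToL2 (φ p.2)‖ ^ 2 +
      ‖derivToL2 2 (φ p.1) - derivToL2 2 (φ p.2)‖ ^ 2)) (fun p => ?_)
      (by simpa using (tendsto_norm_sub_sq hy).add (tendsto_norm_sub_sq hv))
    have h1 := integral_sq_deriv_le (φ p.1 - φ p.2)
    rw [integral_const_mul, integral_add
      (integrableOn_weight_mul_sq (w := fun _ => 1) continuousOn_const _ 0)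
      (integrableOn_weight_mul_sq (w := fun _ => 1) continuousOn_const _ 2)] at h1
    simp only [one_mul, ← norm_derivToL2_sq, derivToL2_zero, map_sub] at h1
    nlinarith [sq_nonneg ‖derivToL2 1 (φ p.1) - derivToL2 1 (φ p.2)‖]
  refine ⟨mem_sobolevZero_of_cauchySeq hy fun m hm => ?_, ?_⟩
  · interval_cases m
    exacts [c0, c1, c2]
  · obtain ⟨M₁, hM₁⟩ := ((hy.norm.pow 2)).bddAbove_range
    obtain ⟨M₂, hM₂⟩ := ((hy'.norm.pow 2)).bddAbove_range
    refine integrable_weight_of_tendsto hy continuousOn_japaneseBracket_rpow.continuousOn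
      (fun x _ => Real.rpow_nonneg (Real.sqrt_nonneg _) _) (C := 4 * (M₁ + C * (M₂ + M₁)))
      fun n => ?_
    have b1 : ‖testToL2 (φ n)‖ ^ 2 ≤ M₁ := hM₁ ⟨n, rfl⟩
    have b2 : ‖diffOpToL2 α k (φ n)‖ ^ 2 ≤ M₂ := hM₂ ⟨n, rfl⟩
    have b3 := (hest (φ n)).2
    have hq : ContinuousOn (fun x : ℝ => ((k : ℝ) ^ 2 * x ^ (2 * α)) ^ 2) (Ioi 0) :=
      (continuousOn_const.mul (continuousOn_id.rpow_const fun x hx => Or.inl (ne_of_gt hx))).pow 2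
    have i0 := integrableOn_weight_mul_sq (w := fun _ => 1) continuousOn_const (φ n) 0
    have iq := integrableOn_weight_mul_sq hq (φ n) 0
    calc _ ≤ ∫ x in Ioi 0, 4 * (1 * ‖iteratedDeriv 0 (φ n) x‖ ^ 2 +
          ((k : ℝ) ^ 2 * x ^ (2 * α)) ^ 2 * ‖iteratedDeriv 0 (φ n) x‖ ^ 2) := by
          refine setIntegral_mono_on (integrableOn_weight_mul_sq
            continuousOn_japaneseBracket_rpow.continuousOn _ 0) ((i0.add iq).const_mul 4)
            measurableSet_Ioi fun x hx => ?_
          have := mul_le_mul_of_nonneg_right (japaneseBracket_rpow_le hα0 hα1 hk hx)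
            (sq_nonneg ‖iteratedDeriv 0 (φ n) x‖)
          linarith
      _ ≤ _ := by
          rw [integral_const_mul, integral_add i0 iq]
          simp only [one_mul, ← norm_derivToL2_sq, derivToL2_zero] at b3 ⊢
          nlinarith

/-- Two Hardy inequalities and Fatou make x^(-4)|u|² integrable. Together with the weight this gives
V u in L², so u lies in the domain of the adjoint; the same integrability makes both boundary values
vanish. -/
theorem subset_closure_domain (hα0 : 0 ≤ α) (hα1 : α < 1) (hk : k ≠ 0) :
    sobolevZero 2 ∩ weightedL2 (fun x => japaneseBracket x ^ (4 * α)) ⊆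
      ((op α k).closure.domain : Set L2) := by
  rintro u ⟨hu, hw⟩
  obtain ⟨v, φ, rfl, hv, hφ⟩ := exists_seq_of_mem_sobolevZero hu
  have h0 := hφ 0 (by norm_num)
  simp only [derivToL2_zero] at h0
  have hi4 : Integrable (fun x => 1 / x ^ 4 * ‖v 0 x‖ ^ 2) leb := by
    obtain ⟨M, hM⟩ := ((hφ 2 le_rfl).norm.pow 2).bddAbove_range
    refine integrable_weight_of_tendsto h0 (continuousOn_const_div_pow 1 4)
      (fun x hx => by positivity) (C := 16 / 9 * M) fun n => ?_
    have b1 : ‖derivToL2 2 (φ n)‖ ^ 2 ≤ M := hM ⟨n, rfl⟩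
    have b2 := hardy_four (φ n) 0
    have b3 := hardy (φ n) 1
    have t1 : ∫ x in Ioi 0, 4 * ‖iteratedDeriv (1 + 1) (φ n) x‖ ^ 2 =
        4 * ∫ x in Ioi 0, ‖iteratedDeriv 2 (φ n) x‖ ^ 2 := integral_const_mul _ _
    have t2 : ∫ x in Ioi 0, 9 / x ^ 4 * ‖iteratedDeriv 0 (φ n) x‖ ^ 2 =
        9 * ∫ x in Ioi 0, 1 / x ^ 4 * ‖iteratedDeriv 0 (φ n) x‖ ^ 2 := by
      rw [← integral_const_mul]
      exact integral_congr_ae (ae_of_all _ fun x => by ring)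
    have t3 : ∫ x in Ioi 0, 4 / x ^ 2 * ‖iteratedDeriv (0 + 1) (φ n) x‖ ^ 2 =
        4 * ∫ x in Ioi 0, 1 / x ^ 2 * ‖iteratedDeriv 1 (φ n) x‖ ^ 2 := by
      rw [← integral_const_mul]
      exact integral_congr_ae (ae_of_all _ fun x => by ring)
    rw [t2, t3] at b2
    rw [t1, ← norm_derivToL2_sq] at b3
    linarith
  have hm : AEStronglyMeasurable (fun x => (potential α k x : ℂ) * v 0 x) leb :=
    ((Complex.continuous_ofReal.comp_continuousOn
      (continuousOn_potential α k)).aestronglyMeasurable measurableSet_Ioi).mul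
      (Lp.aestronglyMeasurable _)
  have hV : MemLp (fun x => (potential α k x : ℂ) * v 0 x) 2 leb := by
    rw [← memLp_norm_iff hm, memLp_two_iff_integrable_sq hm.norm]
    have hw : Integrable (fun x => japaneseBracket x ^ (4 * α) * ‖v 0 x‖ ^ 2) leb := hw
    refine Integrable.mono' ((hw.const_mul (2 * (k : ℝ) ^ 4)).add
      (hi4.const_mul (2 * (α * (2 + α) / 4) ^ 2))) (hm.norm.pow 2)
      (ae_leb_of_forall fun x hx => ?_)
    rw [Real.norm_of_nonneg (by positivity), norm_mul, mul_pow, Complex.norm_real,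
      Real.norm_eq_abs, sq_abs, Pi.add_apply]
    have e1 : potential α k x ^ 2 ≤ 2 * (k : ℝ) ^ 4 * japaneseBracket x ^ (4 * α) +
        2 * (α * (2 + α) / 4) ^ 2 * (1 / x ^ 4) := by
      have e2 : (x ^ (2 * α)) ^ 2 ≤ japaneseBracket x ^ (4 * α) := by
        rw [← Real.rpow_natCast (x ^ (2 * α)) 2, ← Real.rpow_mul hx.le,
          show 2 * α * ((2 : ℕ) : ℝ) = 4 * α by push_cast; ring]
        refine Real.rpow_le_rpow hx.le ?_ (by positivity)
        exact Real.le_sqrt_of_sq_le (by linarith)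
      have e3 : 2 * (k : ℝ) ^ 4 * (x ^ (2 * α)) ^ 2 ≤
          2 * (k : ℝ) ^ 4 * japaneseBracket x ^ (4 * α) := by gcongr
      refine le_trans ?_ (add_le_add_left e3 _)
      rw [potential_eq]
      refine (add_sq_le (a := (k : ℝ) ^ 2 * x ^ (2 * α))).trans (le_of_eq ?_)
      field_simp
    have := mul_le_mul_of_nonneg_right e1 (sq_nonneg ‖v 0 x‖)
    linarith
  have hwd : WeakDiffOp α k (v 0) ((Lp.memLp (v 2)).neg.add hV).toLp := by
    refine ⟨v 2, hv 2 le_rfl, ?_⟩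
    filter_upwards [((Lp.memLp (v 2)).neg.add hV).coeFn_toLp] with x hx
    rw [hx]
    rfl
  have hs := (weakDiffOp_iff_isSol _ _).1 hwd
  have hd := mem_adjoint_domain_of_isSol hs
  exact (mem_closure_domain_iff hα0 hα1 hk _).2 ⟨hd,
    coeff_eq_zero_of_integrable hα0 hα1 hk ⟨_, hd⟩ hi4⟩


variable {α : ℝ} {k : ℤ} {x : ℝ}

/-! ### The quadratic form on test functions -/

theorem testToL2_mem (α : ℝ) (k : ℤ) (φ : 𝓓(posReals, ℂ)) : testToL2 φ ∈ (op α k).domain :=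
  ⟨φ, rfl⟩

theorem quadForm_test (φ : 𝓓(posReals, ℂ)) (h : testToL2 φ ∈ (op α k).domain) :
    (op α k).quadForm ⟨testToL2 φ, h⟩ = (∫ x in Ioi 0, ‖iteratedDeriv 1 φ x‖ ^ 2) +
      ∫ x in Ioi 0, potential α k x * ‖iteratedDeriv 0 φ x‖ ^ 2 := by
  have i1 := integrableOn_weight_mul_sq (w := fun _ => 1) continuousOn_const φ 1
  simp only [one_mul] at i1
  rw [LinearPMap.quadForm, op_apply, inner_diffOp, ← integral_add i1
    (integrableOn_weight_mul_sq (continuousOn_potential α k) φ 0), ← Complex.ofReal_re (integral _ _),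
    ← integral_complex_ofReal]
  congr 1
  refine integral_congr_ae (ae_of_all _ fun x => ?_)
  simp only [iteratedDeriv_zero]
  rw [Complex.conj_mul', Complex.conj_mul']
  push_cast
  ring

theorem integral_potential_nonneg (hα0 : 0 ≤ α) (φ : 𝓓(posReals, ℂ)) :
    0 ≤ ∫ x in Ioi 0, potential α k x * ‖iteratedDeriv 0 φ x‖ ^ 2 :=
  setIntegral_nonneg measurableSet_Ioi fun _ hx =>
    mul_nonneg (potential_nonneg hα0 k hx) (sq_nonneg _)

theorem quadForm_sub_test {x : ℕ → (op α k).domain} {φ : ℕ → 𝓓(posReals, ℂ)}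
    (hφ : ∀ n, (x n : L2) = testToL2 (φ n)) (m n : ℕ) :
    (op α k).quadForm (x m - x n) = (∫ x in Ioi 0, ‖iteratedDeriv 1 (φ m - φ n) x‖ ^ 2) +
      ∫ x in Ioi 0, potential α k x * ‖iteratedDeriv 0 (φ m - φ n) x‖ ^ 2 := by
  have e : x m - x n = ⟨testToL2 (φ m - φ n), testToL2_mem α k _⟩ := by
    refine Subtype.ext ?_
    change (x m : L2) - x n = testToL2 (φ m - φ n)
    rw [map_sub, hφ, hφ]
  rw [e, quadForm_test]

theorem japaneseBracket_le (hk : k ≠ 0) (hα0 : 0 ≤ α) (hx : 0 < x) :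
    japaneseBracket (x ^ (2 * α)) ≤ 1 + potential α k x := by
  have hk1 : 1 ≤ (k : ℝ) ^ 2 := by
    have : 1 ≤ k ^ 2 := by have := sq_pos_of_ne_zero hk; omega
    exact_mod_cast this
  have h1 : x ^ (2 * α) ≤ potential α k x := by
    have hy : 0 ≤ x ^ (2 * α) := by positivity
    have : 0 ≤ α * (2 + α) / (4 * x ^ 2) := by positivity
    rw [potential]
    nlinarith
  have hy : 0 ≤ x ^ (2 * α) := by positivity
  refine (Real.sqrt_le_left (by positivity)).2 ?_ |>.trans (add_le_add_right h1 1)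
  nlinarith

theorem continuousOn_japaneseBracket (hα0 : 0 ≤ α) :
    Continuous fun x : ℝ => japaneseBracket (x ^ (2 * α)) := by
  unfold japaneseBracket
  have : Continuous fun x : ℝ => x ^ (2 * α) := Real.continuous_rpow_const (by positivity)
  fun_prop

/-- The form is a sum of two nonnegative terms, one controlling the first derivative and the other
the weight. -/
theorem formDomain_subset (hα0 : 0 ≤ α) (hk : k ≠ 0) :
    ((op α k).formDomain (op_isNonnegSymm hα0 k) : Set L2) ⊆
      sobolevZero 1 ∩ weightedL2 (fun x => japaneseBracket (x ^ (2 * α))) := by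
  rintro u ⟨y, hy, hq⟩
  obtain ⟨φ, hφ⟩ := exists_test_seq y
  have hφ' := fun n => (hφ n).1
  have hy' := hy
  simp only [hφ'] at hy
  have c0 : CauchySeq fun n => derivToL2 0 (φ n) := by
    simp only [derivToL2_zero]
    exact hy.cauchySeq
  have c1 : CauchySeq fun n => derivToL2 1 (φ n) := by
    refine cauchySeq_of_sq_le (fun p => ?_) hq
    rw [← map_sub, norm_derivToL2_sq, quadForm_sub_test hφ']
    exact le_add_of_nonneg_right (integral_potential_nonneg hα0 _)
  refine ⟨mem_sobolevZero_of_cauchySeq hy fun m hm => ?_, ?_⟩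
  · interval_cases m
    exacts [c0, c1]
  -- Past the index `K` all terms are within form distance 1 of `y K`, which bounds their forms
  -- uniformly.
  · obtain ⟨⟨N, N'⟩, hN⟩ := eventually_atTop.1 (hq.eventually_lt_const one_pos)
    set K := max N N'
    have hb : ∀ n, (op α k).quadForm (y (n + K)) ≤ 2 + 2 * (op α k).quadForm (y K) := by
      intro n
      have h1 := hN (n + K, K) ⟨(le_max_left N N').trans (Nat.le_add_left _ _), le_max_right N N'⟩
      have h2 := LinearPMap.quadForm_add_le (op_isNonnegSymm hα0 k) (y (n + K) - y K) (y K)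
      rw [sub_add_cancel] at h2
      linarith
    have hyK : Tendsto (fun n => testToL2 (φ (n + K))) atTop (𝓝 u) :=
      hy.comp (tendsto_add_atTop_nat K)
    obtain ⟨M, hM⟩ := (hyK.norm.pow 2).bddAbove_range
    refine integrable_weight_of_tendsto hyK (continuousOn_japaneseBracket hα0).continuousOn
      (fun x _ => Real.sqrt_nonneg _) (C := M + (2 + 2 * (op α k).quadForm (y K))) fun n => ?_
    have b1 : ‖testToL2 (φ (n + K))‖ ^ 2 ≤ M := hM ⟨n, rfl⟩
    have b2 := hb n
    have e : y (n + K) = ⟨testToL2 (φ (n + K)), testToL2_mem α k _⟩ := Subtype.ext (hφ' _)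
    rw [e, quadForm_test] at b2
    have i0 := integrableOn_weight_mul_sq (w := fun _ => 1) continuousOn_const (φ (n + K)) 0
    have iV := integrableOn_weight_mul_sq (continuousOn_potential α k) (φ (n + K)) 0
    calc _ ≤ ∫ x in Ioi 0, (1 * ‖iteratedDeriv 0 (φ (n + K)) x‖ ^ 2 +
          potential α k x * ‖iteratedDeriv 0 (φ (n + K)) x‖ ^ 2) := by
          refine setIntegral_mono_on (integrableOn_weight_mul_sq
            (continuousOn_japaneseBracket hα0).continuousOn _ 0) (i0.add iV)
            measurableSet_Ioi fun x hx => ?_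
          have := mul_le_mul_of_nonneg_right (japaneseBracket_le hk hα0 hx)
            (sq_nonneg ‖iteratedDeriv 0 (φ (n + K)) x‖)
          linarith
      _ ≤ _ := by
          rw [integral_add i0 iV]
          simp only [one_mul]
          rw [← norm_testToL2_sq]
          have : 0 ≤ ∫ x in Ioi 0, ‖iteratedDeriv 1 (φ (n + K)) x‖ ^ 2 :=
            setIntegral_nonneg measurableSet_Ioi fun x _ => by positivity
          linarith

theorem sobolevZero_one_subset_domInvX : sobolevZero 1 ⊆ domInvX := by
  intro u hu
  obtain ⟨v, φ, rfl, hv, hφ⟩ := exists_seq_of_mem_sobolevZero hu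
  have h0 := hφ 0 zero_le_one
  simp only [derivToL2_zero] at h0
  obtain ⟨M, hM⟩ := ((hφ 1 le_rfl).norm.pow 2).bddAbove_range
  rw [mem_domInvX_iff]
  refine integrable_weight_of_tendsto h0 (continuousOn_const_div_pow 1 2)
    (fun x hx => by positivity) (C := 4 * M) fun n => ?_
  have b1 : ‖derivToL2 1 (φ n)‖ ^ 2 ≤ M := hM ⟨n, rfl⟩
  have b3 := hardy (φ n) 0
  have t1 : ∫ x in Ioi 0, 4 * ‖iteratedDeriv (0 + 1) (φ n) x‖ ^ 2 =
      4 * ∫ x in Ioi 0, ‖iteratedDeriv 1 (φ n) x‖ ^ 2 := integral_const_mul _ _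
  rw [t1, ← norm_derivToL2_sq] at b3
  linarith

/-! ### Multiplication by bounded functions -/

theorem memLp_bounded_mul {b : ℝ → ℝ} (hb : ContinuousOn b (Ioi 0)) {M : ℝ}
    (hM : ∀ x, 0 < x → |b x| ≤ M) (f : L2) : MemLp (fun x => (b x : ℂ) * f x) 2 leb := by
  refine (Lp.memLp f).of_le_mul (c := M) (((Complex.continuous_ofReal.comp_continuousOn
    hb).aestronglyMeasurable measurableSet_Ioi).mul (Lp.aestronglyMeasurable _))
    (ae_leb_of_forall fun x hx => ?_)
  rw [norm_mul, Complex.norm_real, Real.norm_eq_abs]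
  exact mul_le_mul_of_nonneg_right (hM x hx) (norm_nonneg _)

theorem norm_le_of_ae_eq_mul {b : ℝ → ℝ} {M : ℝ} (hM : ∀ x, 0 < x → |b x| ≤ M) {f g : L2}
    (h : g =ᵐ[leb] fun x => (b x : ℂ) * f x) : ‖g‖ ≤ M * ‖f‖ := by
  refine Lp.norm_le_mul_norm_of_ae_le_mul ?_
  filter_upwards [h, ae_leb_of_forall hM] with x h1 h2
  rw [h1, norm_mul, Complex.norm_real, Real.norm_eq_abs]
  exact mul_le_mul_of_nonneg_right h2 (norm_nonneg _)

theorem tendsto_of_ae_eq_mul {b : ℝ → ℝ} {M : ℝ} (hM : ∀ x, 0 < x → |b x| ≤ M) {f g : ℕ → L2}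
    {F G : L2} (hf : Tendsto f atTop (𝓝 F)) (h : ∀ n, g n =ᵐ[leb] fun x => (b x : ℂ) * f n x)
    (hG : G =ᵐ[leb] fun x => (b x : ℂ) * F x) : Tendsto g atTop (𝓝 G) := by
  rw [tendsto_iff_norm_sub_tendsto_zero] at hf ⊢
  refine squeeze_zero (fun _ => norm_nonneg _) (fun n => norm_le_of_ae_eq_mul hM (f := f n - F) ?_)
    (by simpa using hf.const_mul M)
  filter_upwards [h n, hG, Lp.coeFn_sub (g n) G, Lp.coeFn_sub (f n) F] with x h1 h2 h3 h4
  rw [h3, h4, Pi.sub_apply, Pi.sub_apply, h1, h2]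
  ring

theorem tendsto_mul_of_tendsto_one {b : ℕ → ℝ → ℝ} (hb : ∀ n, ContinuousOn (b n) (Ioi 0)) {M : ℝ}
    (hM : ∀ n x, 0 < x → |b n x| ≤ M) {l : ℝ}
    (hl : ∀ x, 0 < x → Tendsto (fun n => b n x) atTop (𝓝 l))
    {F G : L2} (hG : G =ᵐ[leb] fun x => (l : ℂ) * F x) {g : ℕ → L2}
    (h : ∀ n, g n =ᵐ[leb] fun x => (b n x : ℂ) * F x) : Tendsto g atTop (𝓝 G) := by
  have hlM : |l| ≤ M := le_of_tendsto (hl 1 one_pos).abs (Eventually.of_forall fun n =>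
    hM n 1 one_pos)
  have e : ∀ n, ‖g n - G‖ ^ 2 = ∫ x in Ioi 0, (b n x - l) ^ 2 * ‖F x‖ ^ 2 := by
    intro n
    rw [norm_sq_eq_integral]
    refine integral_congr_ae ?_
    filter_upwards [h n, hG, Lp.coeFn_sub (g n) G] with x h1 h2 h3
    rw [h3, Pi.sub_apply, h1, h2, ← sub_mul, norm_mul, mul_pow, ← Complex.ofReal_sub,
      Complex.norm_real, Real.norm_eq_abs, sq_abs]
  have h0 : Tendsto (fun n => ‖g n - G‖ ^ 2) atTop (𝓝 0) := by
    simp only [e]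
    have := tendsto_integral_of_dominated_convergence (μ := leb)
      (F := fun n x => (b n x - l) ^ 2 * ‖F x‖ ^ 2) (f := fun _ => (0 : ℝ))
      (fun x => (M + M) ^ 2 * ‖F x‖ ^ 2)
      (fun n => ((((hb n).sub continuousOn_const).pow 2).aestronglyMeasurable
        measurableSet_Ioi).mul ((Lp.aestronglyMeasurable F).norm.pow 2))
      ((integrableOn_norm_sq (Lp.memLp F)).const_mul _)
      (fun n => ae_leb_of_forall fun x hx => ?_) (ae_leb_of_forall fun x hx => ?_)
    · simpa using this
    · rw [Real.norm_of_nonneg (by positivity)]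
      gcongr ?_ * _
      rw [← sq_abs]
      have := (abs_sub (b n x) l).trans (add_le_add (hM n x hx) hlM)
      gcongr
    · have := (((hl x hx).sub_const l).pow 2).mul_const (‖F x‖ ^ 2)
      simpa using this
  rw [tendsto_iff_norm_sub_tendsto_zero]
  have := h0.sqrt
  simpa [Real.sqrt_sq] using this

/-! ### Approximation in the form norm -/

theorem continuous_rpow_mul_test (hα0 : 0 ≤ α) (φ : 𝓓(posReals, ℂ)) :
    Continuous fun x => ((x ^ α : ℝ) : ℂ) * φ x :=
  (Complex.continuous_ofReal.comp (Real.continuous_rpow_const hα0)).mul φ.continuous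

theorem memLp_rpow_mul_test (hα0 : 0 ≤ α) (φ : 𝓓(posReals, ℂ)) :
    MemLp (fun x => ((x ^ α : ℝ) : ℂ) * φ x) 2 leb :=
  (continuous_rpow_mul_test hα0 φ).memLp_of_hasCompactSupport φ.hasCompactSupport.mul_left

/-- A test function with its first derivative and its product with `x ^ α`. -/
def formVec (hα0 : 0 ≤ α) (φ : 𝓓(posReals, ℂ)) : L2 × L2 × L2 :=
  (testToL2 φ, derivToL2 1 φ, (memLp_rpow_mul_test hα0 φ).toLp)

theorem toLp_rpow_mul_test_sub (hα0 : 0 ≤ α) (φ ψ : 𝓓(posReals, ℂ)) :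
    (memLp_rpow_mul_test hα0 (φ - ψ)).toLp =
      (memLp_rpow_mul_test hα0 φ).toLp - (memLp_rpow_mul_test hα0 ψ).toLp := by
  rw [← MemLp.toLp_sub]
  refine MemLp.toLp_congr _ _ (ae_of_all _ fun x => ?_)
  exact mul_sub _ (φ x) (ψ x)

theorem norm_toLp_rpow_mul_test_sq (hα0 : 0 ≤ α) (ψ : 𝓓(posReals, ℂ)) :
    ‖(memLp_rpow_mul_test hα0 ψ).toLp‖ ^ 2 =
      ∫ x in Ioi 0, (x ^ α) ^ 2 * ‖iteratedDeriv 0 ψ x‖ ^ 2 := by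
  rw [norm_toLp_sq]
  refine integral_congr_ae (ae_leb_of_forall fun x hx => ?_)
  simp only [iteratedDeriv_zero]
  rw [norm_mul, mul_pow, Complex.norm_real, Real.norm_eq_abs, sq_abs]

/-- Hardy absorbs the inverse-square part of the potential into the first derivative: the factor 4
in Hardy's inequality cancels the 4 in the coupling. -/
theorem integral_form_le (hα0 : 0 ≤ α) (k : ℤ) (ψ : 𝓓(posReals, ℂ)) :
    (∫ x in Ioi 0, ‖iteratedDeriv 1 ψ x‖ ^ 2) +
      (∫ x in Ioi 0, potential α k x * ‖iteratedDeriv 0 ψ x‖ ^ 2) ≤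
    (1 + α * (2 + α)) * ‖derivToL2 1 ψ‖ ^ 2 +
      (k : ℝ) ^ 2 * ‖(memLp_rpow_mul_test hα0 ψ).toLp‖ ^ 2 := by
  have hc : ContinuousOn (fun x : ℝ => (x ^ α) ^ 2) (Ioi 0) :=
    ((Real.continuous_rpow_const hα0).pow 2).continuousOn
  have hV : ∫ x in Ioi 0, potential α k x * ‖iteratedDeriv 0 ψ x‖ ^ 2 =
      (k : ℝ) ^ 2 * (∫ x in Ioi 0, (x ^ α) ^ 2 * ‖iteratedDeriv 0 ψ x‖ ^ 2) +
      α * (2 + α) / 4 * ∫ x in Ioi 0, 1 / x ^ 2 * ‖iteratedDeriv 0 ψ x‖ ^ 2 := by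
    rw [← integral_const_mul, ← integral_const_mul, ← integral_add
      ((integrableOn_weight_mul_sq hc ψ 0).const_mul _)
      ((integrableOn_weight_mul_sq (continuousOn_const_div_pow 1 2) ψ 0).const_mul _)]
    refine setIntegral_congr_fun measurableSet_Ioi fun x hx => ?_
    have hx : 0 < x := hx
    rw [potential_eq, ← Real.rpow_natCast (x ^ α) 2, ← Real.rpow_mul hx.le,
      show α * ((2 : ℕ) : ℝ) = 2 * α by push_cast; ring]
    ring
  have hh := hardy ψ 0
  have t1 : ∫ x in Ioi 0, 4 * ‖iteratedDeriv (0 + 1) ψ x‖ ^ 2 =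
      4 * ∫ x in Ioi 0, ‖iteratedDeriv 1 ψ x‖ ^ 2 := integral_const_mul _ _
  rw [t1] at hh
  rw [hV, norm_derivToL2_sq, norm_toLp_rpow_mul_test_sq hα0]
  have := mul_le_mul_of_nonneg_left hh (show 0 ≤ α * (2 + α) / 4 by positivity)
  linarith

theorem mem_formDomain_of_tendsto (hα0 : 0 ≤ α) {φ : ℕ → 𝓓(posReals, ℂ)} {u : L2}
    (hu : Tendsto (fun n => testToL2 (φ n)) atTop (𝓝 u)) {r : ℕ × ℕ → ℝ}
    (h : ∀ p : ℕ × ℕ, (∫ x in Ioi 0, ‖iteratedDeriv 1 (φ p.1 - φ p.2 : 𝓓(posReals, ℂ)) x‖ ^ 2) +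
      (∫ x in Ioi 0, potential α k x * ‖iteratedDeriv 0 (φ p.1 - φ p.2 : 𝓓(posReals, ℂ)) x‖ ^ 2) ≤ r p)
    (hr : Tendsto r atTop (𝓝 0)) : u ∈ (op α k).formDomain (op_isNonnegSymm hα0 k) := by
  let y : ℕ → (op α k).domain := fun n => ⟨testToL2 (φ n), testToL2_mem α k (φ n)⟩
  have hy : ∀ n, (y n : L2) = testToL2 (φ n) := fun _ => rfl
  have hlim : Tendsto (fun p : ℕ × ℕ => (op α k).quadForm (y p.1 - y p.2)) atTop (𝓝 0) := by
    refine squeeze_zero (fun p => (op_isNonnegSymm hα0 k).nonneg _) (fun p => ?_) hr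
    rw [quadForm_sub_test hy]
    exact h p
  exact ⟨y, hu, hlim⟩

/-- Convergence of the first derivatives and of the products with x^α controls the form norm by
`integral_form_le`. -/
theorem mem_formDomain_of_mem_closure (hα0 : 0 ≤ α) {u v w : L2}
    (h : (u, v, w) ∈ closure (range (formVec hα0))) :
    u ∈ (op α k).formDomain (op_isNonnegSymm hα0 k) := by
  obtain ⟨z, hz, hlim⟩ := mem_closure_iff_seq_limit.1 h
  choose φ hφ using hz
  obtain rfl : (fun n => formVec hα0 (φ n)) = z := funext hφ
  have l1 : Tendsto (fun n => testToL2 (φ n)) atTop (𝓝 u) := (continuous_fst.tendsto _).comp hlim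
  have l2 : Tendsto (fun n => derivToL2 1 (φ n)) atTop (𝓝 v) :=
    ((continuous_fst.comp continuous_snd).tendsto _).comp hlim
  have l3 : Tendsto (fun n => (memLp_rpow_mul_test hα0 (φ n)).toLp) atTop (𝓝 w) :=
    ((continuous_snd.comp continuous_snd).tendsto _).comp hlim
  have hr := ((tendsto_norm_sub_sq l2).const_mul (1 + α * (2 + α))).add
    ((tendsto_norm_sub_sq l3).const_mul ((k : ℝ) ^ 2))
  rw [mul_zero, mul_zero, add_zero] at hr
  refine mem_formDomain_of_tendsto hα0 l1 (fun p => ?_) hr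
  rw [← map_sub, ← toLp_rpow_mul_test_sub hα0]
  exact integral_form_le hα0 k _

/-- It follows from x^α ≤ 1 + x and t x ≤ exp(t x). -/
theorem rpow_mul_exp_le (hα0 : 0 ≤ α) (hα1 : α < 1) {t : ℝ} (ht : 0 < t) (hx : 0 < x) :
    |x ^ α * Real.exp (-(t * x))| ≤ 1 + 1 / t := by
  rw [abs_of_nonneg (by positivity)]
  have h1 : x ^ α ≤ 1 + x := by
    rcases le_total x 1 with h | h
    · exact (Real.rpow_le_one hx.le h hα0).trans (by linarith)
    · calc x ^ α ≤ x ^ (1 : ℝ) := Real.rpow_le_rpow_of_exponent_le h hα1.le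
        _ ≤ _ := by rw [Real.rpow_one]; linarith
  have h2 : 1 ≤ Real.exp (t * x) := Real.one_le_exp (by positivity)
  have h3 : t * x ≤ Real.exp (t * x) := by linarith [Real.add_one_le_exp (t * x)]
  rw [Real.exp_neg, ← div_eq_mul_inv, div_le_iff₀ (Real.exp_pos _)]
  refine h1.trans ?_
  rw [add_mul, one_mul, one_div, ← div_eq_inv_mul]
  exact add_le_add h2 ((le_div_iff₀ ht).2 (by linarith))

theorem contDiff_exp_neg_mul (t : ℝ) :
    ContDiff ℝ ∞ fun x : ℝ => ((Real.exp (-(t * x)) : ℝ) : ℂ) :=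
  Complex.ofRealCLM.contDiff.comp
    (Real.contDiff_exp.comp ((contDiff_const.mul contDiff_id).neg))

/-- A test function multiplied by `exp (-t x)`. -/
def expTest (t : ℝ) (φ : 𝓓(posReals, ℂ)) : 𝓓(posReals, ℂ) :=
  mulTest (fun x => ((Real.exp (-(t * x)) : ℝ) : ℂ)) (contDiff_exp_neg_mul t).contDiffOn φ

theorem iteratedDeriv_one_mulTest {f : ℝ → ℂ} (hf : ContDiffOn ℝ ∞ f (Ioi 0)) {f' : ℂ}
    (hf' : HasDerivAt f f' x) (φ : 𝓓(posReals, ℂ)) :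
    iteratedDeriv 1 (mulTest f hf φ) x = f' * φ x + f x * iteratedDeriv 1 φ x := by
  rw [iteratedDeriv_one]
  have h := hasDerivAt_iteratedDeriv φ 0 x
  rw [iteratedDeriv_zero] at h
  exact (hf'.mul h).deriv

/-- Test functions approximating u in H¹ need not converge in the weighted norm. After
multiplication by exp(-t x) they do, because x^α exp(-t x) is bounded. This places the damped triple
in the closure of `range (formVec hα0)`, and dominated convergence then lets t tend to 0 inside that
closure. -/
theorem mem_formDomain (hα0 : 0 ≤ α) (hα1 : α < 1) :
    sobolevZero 1 ∩ weightedL2 (fun x => japaneseBracket (x ^ (2 * α))) ⊆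
      ((op α k).formDomain (op_isNonnegSymm hα0 k) : Set L2) := by
  rintro u ⟨hu, hw⟩
  obtain ⟨v, φ, rfl, hv, hφ⟩ := exists_seq_of_mem_sobolevZero hu
  have h0 := hφ 0 zero_le_one
  simp only [derivToL2_zero] at h0
  have h1 := hφ 1 le_rfl
  have hw : Integrable (fun x => japaneseBracket (x ^ (2 * α)) * ‖v 0 x‖ ^ 2) leb := hw
  have hm : AEStronglyMeasurable (fun x : ℝ => ((x ^ α : ℝ) : ℂ) * v 0 x) leb :=
    (Complex.continuous_ofReal.comp (Real.continuous_rpow_const hα0)).aestronglyMeasurable.mul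
      (Lp.aestronglyMeasurable _)
  have hW : MemLp (fun x : ℝ => ((x ^ α : ℝ) : ℂ) * v 0 x) 2 leb := by
    rw [← memLp_norm_iff hm, memLp_two_iff_integrable_sq hm.norm]
    refine Integrable.mono' hw (hm.norm.pow 2) (ae_leb_of_forall fun x hx => ?_)
    rw [Real.norm_of_nonneg (by positivity), norm_mul, mul_pow, Complex.norm_real,
      Real.norm_eq_abs, sq_abs]
    gcongr
    rw [← Real.rpow_natCast (x ^ α) 2, ← Real.rpow_mul hx.le,
      show α * ((2 : ℕ) : ℝ) = 2 * α by push_cast; ring]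
    exact Real.le_sqrt_of_sq_le (by linarith)
  have hE : ∀ t : ℝ, Continuous fun x : ℝ => Real.exp (-(t * x)) := fun t => by fun_prop
  have hE1 : ∀ t : ℝ, 0 < t → ∀ x, 0 < x → |Real.exp (-(t * x))| ≤ 1 := fun t ht x hx => by
    rw [abs_of_pos (Real.exp_pos _), Real.exp_le_one_iff, neg_nonpos]
    positivity
  let mE : ∀ t : ℝ, 0 < t → ∀ f : L2, MemLp (fun x => ((Real.exp (-(t * x)) : ℝ) : ℂ) * f x) 2 leb :=
    fun t ht f => memLp_bounded_mul (hE t).continuousOn (hE1 t ht) f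
  have step : ∀ (t : ℝ) (ht : 0 < t), ((mE t ht (v 0)).toLp, (mE t ht (v 1)).toLp -
      (t : ℂ) • (mE t ht (v 0)).toLp, (mE t ht hW.toLp).toLp) ∈ closure (range (formVec hα0)) := by
    intro t ht
    have a0 : Tendsto (fun n => testToL2 (expTest t (φ n))) atTop (𝓝 (mE t ht (v 0)).toLp) := by
      refine tendsto_of_ae_eq_mul (hE1 t ht) h0 (fun n => ?_) (MemLp.coeFn_toLp _)
      filter_upwards [(memLp_test (φ n)).coeFn_toLp, (memLp_test (expTest t (φ n))).coeFn_toLp]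
        with x e1 e2
      have e1 : testToL2 (φ n) x = φ n x := e1
      rw [e1]
      exact e2
    -- The damped function has derivative exp(-t x)(φ' - t φ); adding t times the function itself
    -- leaves a bounded multiple of φ'.
    have a1 : Tendsto (fun n => derivToL2 1 (expTest t (φ n)) +
        (t : ℂ) • testToL2 (expTest t (φ n))) atTop (𝓝 (mE t ht (v 1)).toLp) := by
      refine tendsto_of_ae_eq_mul (hE1 t ht) h1 (fun n => ?_) (MemLp.coeFn_toLp _)
      filter_upwards [Lp.coeFn_add (derivToL2 1 (expTest t (φ n)))
        ((t : ℂ) • testToL2 (expTest t (φ n))), Lp.coeFn_smul (t : ℂ) (testToL2 (expTest t (φ n))),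
        (memLp_iteratedDeriv (φ n) 1).coeFn_toLp, (memLp_test (expTest t (φ n))).coeFn_toLp,
        (memLp_iteratedDeriv (expTest t (φ n)) 1).coeFn_toLp] with x e1 e2 e3 e4 e5
      have e3 : derivToL2 1 (φ n) x = iteratedDeriv 1 (φ n) x := e3
      have e4 : testToL2 (expTest t (φ n)) x = ((Real.exp (-(t * x)) : ℝ) : ℂ) * φ n x := e4
      have e5 : derivToL2 1 (expTest t (φ n)) x = iteratedDeriv 1 (expTest t (φ n)) x := e5
      have hd : HasDerivAt (fun x : ℝ => ((Real.exp (-(t * x)) : ℝ) : ℂ))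
          ((Real.exp (-(t * x)) * -(t * 1) : ℝ) : ℂ) x :=
        (((hasDerivAt_id x).const_mul t).neg.exp).ofReal_comp
      rw [e1, Pi.add_apply, e2, Pi.smul_apply, e3, e4, e5, expTest,
        iteratedDeriv_one_mulTest _ hd]
      push_cast
      rw [smul_eq_mul]
      ring
    have a2 : Tendsto (fun n => (memLp_rpow_mul_test hα0 (expTest t (φ n))).toLp) atTop
        (𝓝 (mE t ht hW.toLp).toLp) := by
      refine tendsto_of_ae_eq_mul (b := fun x => x ^ α * Real.exp (-(t * x)))
        (fun x hx => rpow_mul_exp_le hα0 hα1 ht hx) h0 (fun n => ?_) ?_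
      · filter_upwards [(memLp_test (φ n)).coeFn_toLp,
          (memLp_rpow_mul_test hα0 (expTest t (φ n))).coeFn_toLp] with x e1 e2
        have e1 : testToL2 (φ n) x = φ n x := e1
        rw [e2, e1]
        change ((x ^ α : ℝ) : ℂ) * (((Real.exp (-(t * x)) : ℝ) : ℂ) * φ n x) = _
        push_cast
        ring
      · filter_upwards [(mE t ht hW.toLp).coeFn_toLp, hW.coeFn_toLp] with x e1 e2
        rw [e1, e2]
        push_cast
        ring
    refine mem_closure_of_tendsto (f := fun n => formVec hα0 (expTest t (φ n))) (b := atTop) ?_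
      (Eventually.of_forall fun n => ⟨_, rfl⟩)
    refine a0.prodMk_nhds (Tendsto.prodMk_nhds ?_ a2)
    have := a1.sub (a0.const_smul (t : ℂ))
    simpa using this
  have ht : ∀ n : ℕ, (0 : ℝ) < 1 / ((n : ℝ) + 1) := fun n => by positivity
  have ht0 := tendsto_one_div_add_atTop_nhds_zero_nat (𝕜 := ℝ)
  have hE0 : ∀ f : L2, Tendsto (fun n : ℕ => (mE _ (ht n) f).toLp) atTop (𝓝 f) := by
    intro f
    refine tendsto_mul_of_tendsto_one (b := fun (n : ℕ) x => Real.exp (-(1 / ((n : ℝ) + 1) * x)))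
      (l := 1) (F := f) (fun n => (hE _).continuousOn) (fun n => hE1 _ (ht n)) (fun x hx => ?_) ?_
      fun n => (mE _ (ht n) f).coeFn_toLp
    · have := (Real.continuous_exp.tendsto _).comp (ht0.mul_const x).neg
      simpa [Function.comp_def] using this
    · exact ae_of_all _ fun x => by simp
  -- The zero multiple is the limit of t times the damped function; it is kept as produced, since
  -- only the first component matters afterwards.
  have hlim : (v 0, v 1 - (0 : ℂ) • v 0, hW.toLp) ∈ closure (range (formVec hα0)) := by
    refine isClosed_closure.mem_of_tendsto (Tendsto.prodMk_nhds (hE0 (v 0))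
      (Tendsto.prodMk_nhds ((hE0 (v 1)).sub (Tendsto.smul ?_ (hE0 (v 0)))) (hE0 hW.toLp)))
      (Eventually.of_forall fun n => step _ (ht n))
    exact (Complex.continuous_ofReal.tendsto 0).comp ht0
  exact mem_formDomain_of_mem_closure hα0 hlim

theorem formDomain_op (hα0 : 0 ≤ α) (hα1 : α < 1) (hk : k ≠ 0) :
    ((op α k).formDomain (op_isNonnegSymm hα0 k) : Set L2) =
      sobolevZero 1 ∩ weightedL2 (fun x => japaneseBracket (x ^ (2 * α))) :=
  Subset.antisymm (formDomain_subset hα0 hk) (mem_formDomain hα0 hα1)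


variable {α : ℝ} {k : ℤ} {x : ℝ}

/-! ### Cutoff functions -/

theorem deriv_smoothTransition_of_neg {t : ℝ} (ht : t < 0) : deriv Real.smoothTransition t = 0 := by
  have h : Real.smoothTransition =ᶠ[𝓝 t] fun _ => 0 := by
    filter_upwards [Iio_mem_nhds ht] with s hs
    exact Real.smoothTransition.zero_of_nonpos (le_of_lt hs)
  rw [h.deriv_eq, deriv_const]

theorem deriv_smoothTransition_of_one_lt {t : ℝ} (ht : 1 < t) :
    deriv Real.smoothTransition t = 0 := by
  have h : Real.smoothTransition =ᶠ[𝓝 t] fun _ => 1 := by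
    filter_upwards [Ioi_mem_nhds ht] with s hs
    exact Real.smoothTransition.one_of_one_le (le_of_lt hs)
  rw [h.deriv_eq, deriv_const]

theorem contDiff_smoothTransition : ContDiff ℝ ∞ Real.smoothTransition :=
  Real.smoothTransition.contDiff (n := ⊤)

theorem exists_abs_deriv_smoothTransition_le :
    ∃ M : ℝ, 0 ≤ M ∧ ∀ t, |deriv Real.smoothTransition t| ≤ M := by
  have hc : Continuous (deriv Real.smoothTransition) :=
    contDiff_smoothTransition.continuous_deriv (by norm_num)
  obtain ⟨M, hM⟩ := (isCompact_Icc (a := (0 : ℝ)) (b := 1)).exists_bound_of_continuousOn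
    hc.continuousOn
  have hM0 : 0 ≤ M := (norm_nonneg _).trans (hM 0 ⟨le_rfl, zero_le_one⟩)
  refine ⟨M, hM0, fun t => ?_⟩
  rcases lt_or_ge t 0 with h0 | h0
  · rwa [deriv_smoothTransition_of_neg h0, abs_zero]
  rcases lt_or_ge 1 t with h1 | h1
  · rwa [deriv_smoothTransition_of_one_lt h1, abs_zero]
  exact hM t ⟨h0, h1⟩

/-- A cutoff function which tends to `1` on the half-line. -/
def cutoff (n : ℕ) (x : ℝ) : ℝ :=
  Real.smoothTransition (((n : ℝ) + 1) * x - 1) * Real.smoothTransition (2 - x / ((n : ℝ) + 1))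

/-- The derivative of `cutoff`. -/
def cutoffDeriv (n : ℕ) (x : ℝ) : ℝ :=
  deriv Real.smoothTransition (((n : ℝ) + 1) * x - 1) * ((n : ℝ) + 1) *
      Real.smoothTransition (2 - x / ((n : ℝ) + 1)) +
    Real.smoothTransition (((n : ℝ) + 1) * x - 1) *
      (deriv Real.smoothTransition (2 - x / ((n : ℝ) + 1)) * -(1 / ((n : ℝ) + 1)))

theorem contDiff_cutoff (n : ℕ) : ContDiff ℝ ∞ (cutoff n) := by
  unfold cutoff
  exact (contDiff_smoothTransition.comp (by fun_prop)).mul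
    (contDiff_smoothTransition.comp (by fun_prop))

theorem hasDerivAt_cutoff (n : ℕ) (x : ℝ) : HasDerivAt (cutoff n) (cutoffDeriv n x) x := by
  have hs : ∀ t, HasDerivAt Real.smoothTransition (deriv Real.smoothTransition t) t := fun t =>
    (contDiff_smoothTransition.differentiable (by norm_num) t).hasDerivAt
  have h1 : HasDerivAt (fun x : ℝ => ((n : ℝ) + 1) * x - 1) ((n : ℝ) + 1) x := by
    simpa using ((hasDerivAt_id x).const_mul ((n : ℝ) + 1)).sub_const 1
  have h2 : HasDerivAt (fun x : ℝ => 2 - x / ((n : ℝ) + 1)) (-(1 / ((n : ℝ) + 1))) x :=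
    ((hasDerivAt_id x).div_const ((n : ℝ) + 1)).const_sub 2
  exact ((hs _).comp x h1).mul ((hs _).comp x h2)

theorem continuous_cutoffDeriv (n : ℕ) : Continuous (cutoffDeriv n) := by
  have : cutoffDeriv n = deriv (cutoff n) := funext fun x => (hasDerivAt_cutoff n x).deriv.symm
  rw [this]
  exact (contDiff_cutoff n).continuous_deriv (by norm_num)

theorem cutoff_nonneg (n : ℕ) (x : ℝ) : 0 ≤ cutoff n x :=
  mul_nonneg (Real.smoothTransition.nonneg _) (Real.smoothTransition.nonneg _)

theorem cutoff_le_one (n : ℕ) (x : ℝ) : cutoff n x ≤ 1 :=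
  mul_le_one₀ (Real.smoothTransition.le_one _) (Real.smoothTransition.nonneg _)
    (Real.smoothTransition.le_one _)

theorem support_cutoff_subset (n : ℕ) :
    Function.support (cutoff n) ⊆ Icc (1 / ((n : ℝ) + 1)) (2 * ((n : ℝ) + 1)) := by
  have hn : (0 : ℝ) < (n : ℝ) + 1 := by positivity
  intro x hx
  by_contra h
  apply hx
  rw [mem_Icc, not_and_or, not_le, not_le] at h
  rw [cutoff]
  rcases h with h | h
  · rw [Real.smoothTransition.zero_of_nonpos, zero_mul]
    rw [lt_div_iff₀ hn] at h
    linarith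
  · rw [Real.smoothTransition.zero_of_nonpos (x := 2 - x / ((n : ℝ) + 1)), mul_zero]
    have : 2 < x / ((n : ℝ) + 1) := by rwa [lt_div_iff₀ hn]
    linarith

theorem eventually_lt_mul (hx : 0 < x) :
    ∀ᶠ n : ℕ in atTop, 1 < ((n : ℝ) + 1) * x - 1 ∧ 1 < 2 - x / ((n : ℝ) + 1) := by
  filter_upwards [(tendsto_natCast_atTop_atTop (R := ℝ)).eventually_gt_atTop (2 / x),
    (tendsto_natCast_atTop_atTop (R := ℝ)).eventually_gt_atTop x] with n h1 h2
  have hn : (0 : ℝ) < (n : ℝ) + 1 := by positivity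
  rw [div_lt_iff₀ hx] at h1
  constructor
  · linarith
  · have : x / ((n : ℝ) + 1) < 1 := by
      rw [div_lt_one hn]
      linarith
    linarith

theorem tendsto_cutoff (hx : 0 < x) : Tendsto (fun n => cutoff n x) atTop (𝓝 1) := by
  refine tendsto_const_nhds.congr' ?_
  filter_upwards [eventually_lt_mul hx] with n hn
  rw [cutoff, Real.smoothTransition.one_of_one_le hn.1.le,
    Real.smoothTransition.one_of_one_le hn.2.le, one_mul]

theorem tendsto_cutoffDeriv (hx : 0 < x) : Tendsto (fun n => cutoffDeriv n x) atTop (𝓝 0) := by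
  refine tendsto_const_nhds.congr' ?_
  filter_upwards [eventually_lt_mul hx] with n hn
  rw [cutoffDeriv, deriv_smoothTransition_of_one_lt hn.1, deriv_smoothTransition_of_one_lt hn.2]
  ring

/-- The derivative of the transition function is supported in [0, 1], where (n+1)x ≤ 2 for the inner
cutoff and x/(n+1) ≤ 2 for the outer one; multiplying by x therefore removes the dependence on n. -/
theorem exists_abs_cutoffDeriv_le :
    ∃ M : ℝ, 0 ≤ M ∧ ∀ (n : ℕ) (x : ℝ), 0 < x → |cutoffDeriv n x| ≤ M / x := by
  obtain ⟨M, hM0, hM⟩ := exists_abs_deriv_smoothTransition_le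
  refine ⟨4 * M, by positivity, fun n x hx => ?_⟩
  have hn : (0 : ℝ) < (n : ℝ) + 1 := by positivity
  have hs : ∀ t, |Real.smoothTransition t| ≤ 1 := fun t => by
    rw [abs_of_nonneg (Real.smoothTransition.nonneg t)]
    exact Real.smoothTransition.le_one t
  have key : ∀ t y : ℝ, 0 ≤ y → (t ∈ Icc (0 : ℝ) 1 → y ≤ 2) →
      |deriv Real.smoothTransition t| * y ≤ 2 * M := by
    intro t y hy h
    by_cases ht : t ∈ Icc (0 : ℝ) 1
    · calc _ ≤ M * 2 := mul_le_mul (hM t) (h ht) hy hM0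
        _ = 2 * M := mul_comm _ _
    · have : deriv Real.smoothTransition t = 0 := by
        rw [mem_Icc, not_and_or, not_le, not_le] at ht
        exact ht.elim deriv_smoothTransition_of_neg deriv_smoothTransition_of_one_lt
      rw [this, abs_zero, zero_mul]
      positivity
  have h1 := key (((n : ℝ) + 1) * x - 1) (((n : ℝ) + 1) * x) (by positivity)
    fun h => by linarith [h.2]
  have h2 := key (2 - x / ((n : ℝ) + 1)) (x / ((n : ℝ) + 1)) (by positivity)
    fun h => by linarith [h.1]
  rw [le_div_iff₀ hx, ← abs_of_pos hx, ← abs_mul, cutoffDeriv, abs_of_pos hx, add_mul]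
  refine (abs_add_le _ _).trans ?_
  simp only [abs_mul, abs_neg, abs_of_pos hn, abs_of_pos hx, abs_of_pos (one_div_pos.2 hn)]
  have e1 : |deriv Real.smoothTransition (((n : ℝ) + 1) * x - 1)| * ((n : ℝ) + 1) *
      |Real.smoothTransition (2 - x / ((n : ℝ) + 1))| * x ≤ 2 * M := by
    calc _ = |deriv Real.smoothTransition (((n : ℝ) + 1) * x - 1)| * (((n : ℝ) + 1) * x) *
          |Real.smoothTransition (2 - x / ((n : ℝ) + 1))| := by ring
      _ ≤ 2 * M * 1 := mul_le_mul h1 (hs _) (abs_nonneg _) (by positivity)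
      _ = _ := mul_one _
  have e2 : |Real.smoothTransition (((n : ℝ) + 1) * x - 1)| *
      (|deriv Real.smoothTransition (2 - x / ((n : ℝ) + 1))| * (1 / ((n : ℝ) + 1))) * x ≤ 2 * M := by
    calc _ = |Real.smoothTransition (((n : ℝ) + 1) * x - 1)| *
          (|deriv Real.smoothTransition (2 - x / ((n : ℝ) + 1))| * (x / ((n : ℝ) + 1))) := by
          field_simp
      _ ≤ 1 * (2 * M) := mul_le_mul (hs _) h2 (by positivity) zero_le_one
      _ = _ := one_mul _
  linarith

/-- The cutoff as a test function. -/
def cutoffTest (n : ℕ) : 𝓓(posReals, ℂ) where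
  toFun x := (cutoff n x : ℂ)
  contDiff' := Complex.ofRealCLM.contDiff.comp (contDiff_cutoff n)
  hasCompactSupport' := HasCompactSupport.intro
    (isCompact_Icc (a := 1 / ((n : ℝ) + 1)) (b := 2 * ((n : ℝ) + 1))) fun x hx => by
      have : cutoff n x = 0 := by
        by_contra h
        exact hx (support_cutoff_subset n h)
      rw [this, Complex.ofReal_zero]
  tsupport_subset' := by
    have h1 : tsupport (fun x => (cutoff n x : ℂ)) ⊆
        Icc (1 / ((n : ℝ) + 1)) (2 * ((n : ℝ) + 1)) :=
      closure_minimal (fun x hx => support_cutoff_subset n fun h => hx (by simp [h])) isClosed_Icc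
    exact h1.trans fun x hx => lt_of_lt_of_le (by positivity) hx.1

/-! ### The Green solution belongs to the form domain -/

theorem contDiffOn_ofReal_greenSol (hα0 : 0 ≤ α) (hα1 : α < 1) (hk : k ≠ 0) :
    ContDiffOn ℝ ∞ (fun x => (greenSol α k x : ℂ)) (Ioi 0) :=
  Complex.ofRealCLM.contDiff.comp_contDiffOn (contDiffOn_greenSol hα0 hα1 hk)

/-- A test function times the Green solution. -/
def greenTest (hα0 : 0 ≤ α) (hα1 : α < 1) (hk : k ≠ 0) (η : 𝓓(posReals, ℂ)) : 𝓓(posReals, ℂ) :=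
  mulTest (fun x => (greenSol α k x : ℂ)) (contDiffOn_ofReal_greenSol hα0 hα1 hk) η

theorem greenTest_sub (hα0 : 0 ≤ α) (hα1 : α < 1) (hk : k ≠ 0) (η ζ : 𝓓(posReals, ℂ)) :
    greenTest hα0 hα1 hk (η - ζ) = greenTest hα0 hα1 hk η - greenTest hα0 hα1 hk ζ := by
  ext x
  exact mul_sub _ (η x) (ζ x)

/-- The localization identity: for g = `greenSol`, which solves -g'' + V g = `recSol`, the form
density of ηg equals g·`recSol`·|η|² + g²|η'|² up to the derivative of |η|² g g'. Derivatives of g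
thus disappear from the bound. -/
theorem integral_form_greenTest_le (hα0 : 0 ≤ α) (hα1 : α < 1) (hk : k ≠ 0) (η : 𝓓(posReals, ℂ)) :
    (∫ x in Ioi 0, ‖iteratedDeriv 1 (greenTest hα0 hα1 hk η) x‖ ^ 2) +
      (∫ x in Ioi 0, potential α k x * ‖iteratedDeriv 0 (greenTest hα0 hα1 hk η) x‖ ^ 2) ≤
    ∫ x in Ioi 0, (greenSol α k x * recSol α k x * ‖iteratedDeriv 0 η x‖ ^ 2 +
      greenSol α k x ^ 2 * ‖iteratedDeriv 1 η x‖ ^ 2) := by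
  set φ := greenTest hα0 hα1 hk η with hφ
  have hV := continuousOn_potential α k
  have hg : ContinuousOn (greenSol α k) (Ioi 0) := fun x hx =>
    (hasDerivAt_greenSol hα0 hα1 hk hx).continuousAt.continuousWithinAt
  have hg' : ContinuousOn (greenSolDeriv α k) (Ioi 0) := fun x hx =>
    (hasDerivAt_greenSolDeriv hα0 hα1 hk hx).continuousAt.continuousWithinAt
  have i1 := integrableOn_weight_mul_sq (w := fun _ => 1) continuousOn_const φ 1
  have iV := integrableOn_weight_mul_sq hV φ 0
  have e1 : ∫ x in Ioi 0, ‖iteratedDeriv 1 φ x‖ ^ 2 = ∫ x in Ioi 0, 1 * ‖iteratedDeriv 1 φ x‖ ^ 2 := by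
    simp only [one_mul]
  rw [e1, ← integral_add i1 iV]
  refine integral_le_of_deriv η
    (G := fun x => -(‖iteratedDeriv 0 η x‖ ^ 2 * (greenSol α k x * greenSolDeriv α k x)))
    (G' := fun x => -((2 * inner ℝ (iteratedDeriv 0 η x) (iteratedDeriv 1 η x)) *
      (greenSol α k x * greenSolDeriv α k x) + ‖iteratedDeriv 0 η x‖ ^ 2 *
      (greenSolDeriv α k x * greenSolDeriv α k x + greenSol α k x *
        (potential α k x * greenSol α k x - recSol α k x))))
    (fun x hx => ((hasDerivAt_norm_sq_iteratedDeriv η 0 x).mul ((hasDerivAt_greenSol hα0 hα1 hk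
      hx).mul (hasDerivAt_greenSolDeriv hα0 hα1 hk hx))).neg)
    ((((continuous_inner_iteratedDeriv η 0 1).const_mul 2).continuousOn.mul (hg.mul hg')).add
      (((continuous_iteratedDeriv η 0).norm.pow 2).continuousOn.mul ((hg'.mul hg').add
      (hg.mul ((hV.mul hg).sub continuousOn_recSol))))).neg
    (fun x hx => by simp only [iteratedDeriv_eq_zero η hx]; simp)
    (fun x hx => by simp only [iteratedDeriv_eq_zero η hx]; simp)
    (i1.add iV)
    ((integrableOn_weight_mul_sq (hg.mul continuousOn_recSol) η 0).add
      (integrableOn_weight_mul_sq (hg.pow 2) η 1)) fun x hx => ?_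
  have e2 : iteratedDeriv 1 φ x = greenSolDeriv α k x • iteratedDeriv 0 η x +
      greenSol α k x • iteratedDeriv 1 η x := by
    rw [hφ, greenTest, iteratedDeriv_one_mulTest _ (hasDerivAt_greenSol hα0 hα1 hk hx).ofReal_comp,
      Complex.real_smul, Complex.real_smul, iteratedDeriv_zero]
  have e3 : iteratedDeriv 0 φ x = greenSol α k x • iteratedDeriv 0 η x := by
    rw [iteratedDeriv_zero, iteratedDeriv_zero, Complex.real_smul]
    rfl
  rw [e2, e3, norm_add_sq_real, inner_smul_left, inner_smul_right, norm_smul, norm_smul, norm_smul,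
    mul_pow, mul_pow, mul_pow, Real.norm_eq_abs, Real.norm_eq_abs, sq_abs, sq_abs]
  simp only [conj_trivial]
  apply le_of_eq
  ring

/-- Linear growth at the origin bounds the quotient on (0, 1]; beyond 1 the weight is at most 1. -/
theorem integrable_greenSol_div_sq (hα0 : 0 ≤ α) (hα1 : α < 1) (hk : k ≠ 0) :
    Integrable (fun x => 1 / x ^ 2 * greenSol α k x ^ 2) leb := by
  obtain ⟨C, hC, hC'⟩ := greenSol_le_mul hα0 hα1 hk
  have hg : ContinuousOn (greenSol α k) (Ioi 0) := (contDiffOn_greenSol hα0 hα1 hk).continuousOn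
  have hi : Integrable (fun x => greenSol α k x ^ 2) leb := by
    have h := integrableOn_norm_sq (memLp_greenSol hα0 hα1 hk)
    simp only [Complex.norm_real, Real.norm_eq_abs, sq_abs] at h
    exact h
  have hb : Integrable (indicator (Ioc 0 1) fun _ : ℝ => C ^ 2) leb := by
    rw [integrable_indicator_iff measurableSet_Ioc]
    exact (show IntegrableOn (fun _ : ℝ => C ^ 2) (Ioc 0 1) by simp).mono_measure
      Measure.restrict_le_self
  refine Integrable.mono' (hb.add hi) (((continuousOn_const_div_pow 1 2).mul
    (hg.pow 2)).aestronglyMeasurable measurableSet_Ioi) (ae_leb_of_forall fun x hx => ?_)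
  rw [Real.norm_of_nonneg (by positivity), Pi.add_apply]
  rcases le_or_gt x 1 with h | h
  · rw [indicator_of_mem (show x ∈ Ioc (0 : ℝ) 1 from ⟨hx, h⟩)]
    refine le_add_of_le_of_nonneg ?_ (sq_nonneg _)
    rw [one_div_mul_eq_div, div_le_iff₀ (by positivity), ← mul_pow]
    exact pow_le_pow_left₀ (greenSol_nonneg hα0 hx) (hC' x hx h) 2
  · rw [indicator_of_notMem (fun h' : x ∈ Ioc (0 : ℝ) 1 => not_lt.2 h'.2 h), zero_add]
    refine mul_le_of_le_one_left (sq_nonneg _) ?_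
    rw [div_le_one (by positivity)]
    exact one_le_pow₀ h.le

/-- Cut off with η_n. In the localization identity the error g²|η_n'|² is at most M² g²/x², which is
integrable, so dominated convergence makes the truncations Cauchy in the form norm. -/
theorem greenSol_mem_formDomain (hα0 : 0 ≤ α) (hα1 : α < 1) (hk : k ≠ 0) :
    (memLp_greenSol hα0 hα1 hk).toLp ∈ (op α k).formDomain (op_isNonnegSymm hα0 k) := by
  obtain ⟨M, hM0, hM⟩ := exists_abs_cutoffDeriv_le
  have hg : ContinuousOn (greenSol α k) (Ioi 0) := (contDiffOn_greenSol hα0 hα1 hk).continuousOn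
  let F : ℕ → ℝ → ℝ := fun n x => greenSol α k x * recSol α k x * (cutoff n x - 1) ^ 2 +
    greenSol α k x ^ 2 * cutoffDeriv n x ^ 2
  have hFm : ∀ n, AEStronglyMeasurable (F n) leb := fun n =>
    (((hg.mul continuousOn_recSol).mul ((((contDiff_cutoff n).continuous).sub
      continuous_const).pow 2).continuousOn).add ((hg.pow 2).mul
      ((continuous_cutoffDeriv n).pow 2).continuousOn)).aestronglyMeasurable measurableSet_Ioi
  have hi1 : Integrable (fun x => greenSol α k x * recSol α k x) leb := by
    have h1 := (memLp_greenSol hα0 hα1 hk).norm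
    have h2 := (memLp_recSol hα0 hα1 hk).norm
    refine (h1.integrable_mul h2).congr (ae_leb_of_forall fun x hx => ?_)
    simp only [Pi.mul_apply, Complex.norm_real]
    rw [Real.norm_of_nonneg (greenSol_nonneg hα0 hx), Real.norm_of_nonneg (recSol_pos hx).le]
  have hdom : Integrable (fun x => greenSol α k x * recSol α k x +
      M ^ 2 * (1 / x ^ 2 * greenSol α k x ^ 2)) leb :=
    hi1.add ((integrable_greenSol_div_sq hα0 hα1 hk).const_mul _)
  have hF0 : ∀ n x, 0 < x → 0 ≤ F n x := fun n x hx => by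
    have := greenSol_nonneg (k := k) hα0 hx
    have := (recSol_pos (α := α) (k := k) hx).le
    positivity
  have hFle : ∀ n x, 0 < x → F n x ≤ greenSol α k x * recSol α k x +
      M ^ 2 * (1 / x ^ 2 * greenSol α k x ^ 2) := fun n x hx => by
    have h1 := greenSol_nonneg (k := k) hα0 hx
    have h2 := (recSol_pos (α := α) (k := k) hx).le
    have h3 : (cutoff n x - 1) ^ 2 ≤ 1 := by
      have := cutoff_nonneg n x
      have := cutoff_le_one n x
      nlinarith
    have h4 : cutoffDeriv n x ^ 2 ≤ (M / x) ^ 2 := by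
      rw [← sq_abs]
      exact pow_le_pow_left₀ (abs_nonneg _) (hM n x hx) 2
    refine add_le_add (mul_le_of_le_one_right (mul_nonneg h1 h2) h3) ?_
    calc _ ≤ greenSol α k x ^ 2 * (M / x) ^ 2 := by gcongr
      _ = _ := by field_simp
  have hFi : ∀ n, Integrable (F n) leb := fun n =>
    hdom.mono' (hFm n) (ae_leb_of_forall fun x hx => by
      rw [Real.norm_of_nonneg (hF0 n x hx)]
      exact hFle n x hx)
  have hlim : Tendsto (fun n => ∫ x in Ioi 0, F n x) atTop (𝓝 0) := by
    have := tendsto_integral_of_dominated_convergence (μ := leb) (F := F) (f := fun _ => (0 : ℝ)) _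
      hFm hdom (fun n => ae_leb_of_forall fun x hx => by
        rw [Real.norm_of_nonneg (hF0 n x hx)]
        exact hFle n x hx) (ae_leb_of_forall fun x hx => by
        have h1 := (((tendsto_cutoff hx).sub_const 1).pow 2).const_mul
          (greenSol α k x * recSol α k x)
        have h2 := ((tendsto_cutoffDeriv hx).pow 2).const_mul (greenSol α k x ^ 2)
        simpa using h1.add h2)
    simpa using this
  have hr := ((hlim.comp LinearPMap.tendsto_fst_atTop).const_mul 2).add
    ((hlim.comp LinearPMap.tendsto_snd_atTop).const_mul 2)
  rw [mul_zero, add_zero] at hr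
  refine mem_formDomain_of_tendsto hα0 (φ := fun n => greenTest hα0 hα1 hk (cutoffTest n)) ?_
    (fun p => ?_) hr
  · refine tendsto_mul_of_tendsto_one (b := cutoff) (M := 1) (l := 1)
      (F := (memLp_greenSol hα0 hα1 hk).toLp) (fun n => (contDiff_cutoff n).continuous.continuousOn)
      (fun n x _ => ?_) (fun x hx => tendsto_cutoff hx) (ae_of_all _ fun x => by simp) fun n => ?_
    · rw [abs_of_nonneg (cutoff_nonneg n x)]
      exact cutoff_le_one n x
    · filter_upwards [(memLp_greenSol hα0 hα1 hk).coeFn_toLp,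
        (memLp_test (greenTest hα0 hα1 hk (cutoffTest n))).coeFn_toLp] with x h1 h2
      have h2 : testToL2 (greenTest hα0 hα1 hk (cutoffTest n)) x =
        greenSol α k x * (cutoff n x : ℂ) := h2
      rw [h1, h2, mul_comm]
  · rw [← greenTest_sub]
    refine (integral_form_greenTest_le hα0 hα1 hk _).trans ?_
    simp only [Function.comp_apply]
    rw [← integral_const_mul, ← integral_const_mul, ← integral_add ((hFi _).const_mul 2)
      ((hFi _).const_mul 2)]
    refine setIntegral_mono_on ((integrableOn_weight_mul_sq (hg.mul continuousOn_recSol) _ 0).add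
      (integrableOn_weight_mul_sq (hg.pow 2) _ 1)) (((hFi _).const_mul 2).add
      ((hFi _).const_mul 2)) measurableSet_Ioi fun x hx => ?_
    have e0 : ‖iteratedDeriv 0 (cutoffTest p.1 - cutoffTest p.2 : 𝓓(posReals, ℂ)) x‖ ^ 2 =
        (cutoff p.1 x - cutoff p.2 x) ^ 2 := by
      rw [iteratedDeriv_zero]
      change ‖(cutoff p.1 x : ℂ) - (cutoff p.2 x : ℂ)‖ ^ 2 = _
      rw [← Complex.ofReal_sub, Complex.norm_real, Real.norm_eq_abs, sq_abs]
    have e1 : ‖iteratedDeriv 1 (cutoffTest p.1 - cutoffTest p.2 : 𝓓(posReals, ℂ)) x‖ ^ 2 =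
        (cutoffDeriv p.1 x - cutoffDeriv p.2 x) ^ 2 := by
      have h := ((hasDerivAt_cutoff p.1 x).ofReal_comp.sub
        (hasDerivAt_cutoff p.2 x).ofReal_comp).deriv
      rw [iteratedDeriv_one]
      refine (congrArg (fun z : ℂ => ‖z‖ ^ 2) h).trans ?_
      rw [← Complex.ofReal_sub, Complex.norm_real, Real.norm_eq_abs, sq_abs]
    rw [e0, e1]
    have h1 := mul_nonneg (greenSol_nonneg (k := k) hα0 hx) (recSol_pos (α := α) (k := k) hx).le
    have h2 := sq_nonneg (greenSol α k x)
    have h3 : (cutoff p.1 x - cutoff p.2 x) ^ 2 ≤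
        2 * (cutoff p.1 x - 1) ^ 2 + 2 * (cutoff p.2 x - 1) ^ 2 := by
      nlinarith [sq_nonneg ((cutoff p.1 x - 1) + (cutoff p.2 x - 1))]
    have h4 : (cutoffDeriv p.1 x - cutoffDeriv p.2 x) ^ 2 ≤
        2 * cutoffDeriv p.1 x ^ 2 + 2 * cutoffDeriv p.2 x ^ 2 := by
      nlinarith [sq_nonneg (cutoffDeriv p.1 x + cutoffDeriv p.2 x)]
    have h5 := mul_le_mul_of_nonneg_left h3 h1
    have h6 := mul_le_mul_of_nonneg_left h4 h2
    simp only [F]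
    linarith


variable {α : ℝ} {k : ℤ} {x : ℝ}

/-! ### Self-adjoint extensions -/

theorem formDomain_subset_domInvX (hα0 : 0 ≤ α) (hk : k ≠ 0) :
    ((op α k).formDomain (op_isNonnegSymm hα0 k) : Set L2) ⊆ domInvX :=
  (formDomain_subset hα0 hk).trans (inter_subset_left.trans sobolevZero_one_subset_domInvX)

/-- Vectors of the form domain satisfy x⁻¹u in L² by Hardy, which excludes a ≠ 0. Conversely, the
kernel of a is the domain of the closure plus the span of `greenSol`, and both lie in the form
domain. -/
theorem mem_formDomain_iff (hα0 : 0 ≤ α) (hα1 : α < 1) (hk : k ≠ 0) (f : (op α k)†.domain) :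
    (f : L2) ∈ (op α k).formDomain (op_isNonnegSymm hα0 k) ↔ coeffA hα0 hα1 hk f = 0 := by
  have hp := isBoundaryPair hα0 hα1 hk
  constructor
  · exact fun h => coeffA_eq_zero_of_mem_domInvX hα0 hα1 hk f (formDomain_subset_domInvX hα0 hk h)
  · intro h
    obtain ⟨hs, -, hs'⟩ := exists_adjoint_greenSol hα0 hα1 hk
    obtain ⟨s1, s2⟩ := hs'.coeff_eq hα0 hα1 hk
    have hI : ((∫ t in Ioi 0, recSol α k t ^ 2 : ℝ) : ℂ) ≠ 0 := by
      exact_mod_cast (integral_sq_recSol_pos hα0 hα1 hk).ne'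
    have h1 := (Submodule.mem_sup_span_iff_of_functionals (mem_closure_domain_iff hα0 hα1 hk) s1
      (ne_of_eq_of_ne s2 hI) (f : L2)).2 ⟨f.2, h⟩
    refine sup_le (LinearPMap.closure_domain_le_formDomain (op_isNonnegSymm hα0 k)
      (LinearPMap.isClosable_of_symm hp.dense hp.symm)) ?_ h1
    rw [Submodule.span_singleton_le_iff_mem]
    exact greenSol_mem_formDomain hα0 hα1 hk

theorem mem_formDomain_iff' (hα0 : 0 ≤ α) (hα1 : α < 1) (hk : k ≠ 0) (f : (op α k)†.domain) :
    (f : L2) ∈ (op α k).formDomain (op_isNonnegSymm hα0 k) ↔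
      ((1 : ℝ) : ℂ) * coeffA hα0 hα1 hk f + ((0 : ℝ) : ℂ) * coeffB hα0 hα1 hk f = 0 := by
  rw [mem_formDomain_iff hα0 hα1 hk]
  simp

theorem mem_opF_domain_iff (hα0 : 0 ≤ α) (hα1 : α < 1) (hk : k ≠ 0) (g : L2) :
    g ∈ (opF hα0 k).domain ↔ ∃ h : g ∈ (op α k)†.domain, coeffA hα0 hα1 hk ⟨g, h⟩ = 0 :=
  ⟨fun h => ⟨h.2, (mem_formDomain_iff hα0 hα1 hk ⟨g, h.2⟩).1 h.1⟩,
    fun ⟨h, h'⟩ => ⟨(mem_formDomain_iff hα0 hα1 hk ⟨g, h⟩).2 h', h⟩⟩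

theorem op_le_opF (hα0 : 0 ≤ α) (hα1 : α < 1) (hk : k ≠ 0) : op α k ≤ opF hα0 k :=
  (isBoundaryPair hα0 hα1 hk).le_domRestrict _ _ (mem_formDomain_iff' hα0 hα1 hk)

theorem isSelfAdjoint_opF (hα0 : 0 ≤ α) (hα1 : α < 1) (hk : k ≠ 0) : IsSelfAdjoint (opF hα0 k) :=
  (isBoundaryPair hα0 hα1 hk).isSelfAdjoint_domRestrict 1 0 (Or.inl one_ne_zero)
    (mem_formDomain_iff' hα0 hα1 hk)

theorem op_le_opBC (hα0 : 0 ≤ α) (hα1 : α < 1) (hk : k ≠ 0) (γ : ℝ) : op α k ≤ opBC α k γ :=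
  (isBoundaryPair hα0 hα1 hk).le_domRestrict _ _ (mem_boundaryCond_iff hα0 hα1 hk γ)

theorem isSelfAdjoint_opBC (hα0 : 0 ≤ α) (hα1 : α < 1) (hk : k ≠ 0) (γ : ℝ) :
    IsSelfAdjoint (opBC α k γ) :=
  (isBoundaryPair hα0 hα1 hk).isSelfAdjoint_domRestrict _ 1 (Or.inr one_ne_zero)
    (mem_boundaryCond_iff hα0 hα1 hk γ)

theorem eq_opF_of_forall (hα0 : 0 ≤ α) (hα1 : α < 1) (hk : k ≠ 0) {B : L2 →ₗ.[ℂ] L2}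
    (hB : op α k ≤ B) (hB' : IsSelfAdjoint B)
    (h : ∀ f : (op α k)†.domain, (f : L2) ∈ B.domain → coeffA hα0 hα1 hk f = 0) :
    B = opF hα0 k :=
  (isBoundaryPair hα0 hα1 hk).eq_domRestrict_of_forall hB hB' 1 0 (Or.inl one_ne_zero)
    (mem_formDomain_iff' hα0 hα1 hk) fun f hf => by rw [h f hf]; simp

theorem eq_opBC_of_forall (hα0 : 0 ≤ α) (hα1 : α < 1) (hk : k ≠ 0) {B : L2 →ₗ.[ℂ] L2}
    (hB : op α k ≤ B) (hB' : IsSelfAdjoint B) (t : ℝ)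
    (h : ∀ f : (op α k)†.domain, (f : L2) ∈ B.domain →
      coeffB hα0 hα1 hk f = t * coeffA hα0 hα1 hk f) :
    -- The parameter solves t = |k| + (1 + α)γ, the slope found in `mem_boundaryCond_iff`.
    B = opBC α k ((t - |(k : ℝ)|) / (1 + α)) := by
  refine (isBoundaryPair hα0 hα1 hk).eq_domRestrict_of_forall hB hB' _ 1 (Or.inr one_ne_zero)
    (mem_boundaryCond_iff hα0 hα1 hk _) fun f hf => ?_
  have : (1 + α) ≠ 0 := by positivity
  rw [h f hf, mul_div_cancel₀ _ this]
  push_cast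
  ring

theorem opF_domain_subset_domInvX (hα0 : 0 ≤ α) (hk : k ≠ 0) :
    ((opF hα0 k).domain : Set L2) ⊆ domInvX := fun _ hg =>
  formDomain_subset_domInvX hα0 hk hg.1

theorem opF_isNonnegSymm (hα0 : 0 ≤ α) (hα1 : α < 1) (hk : k ≠ 0) : (opF hα0 k).IsNonnegSymm :=
  LinearPMap.friedrichs_isNonnegSymm (op_isNonnegSymm hα0 k) (op_domain_dense α k)
    (isSelfAdjoint_opF hα0 hα1 hk)

theorem formDomain_opF (hα0 : 0 ≤ α) (hα1 : α < 1) (hk : k ≠ 0) (hF : (opF hα0 k).IsNonnegSymm) :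
    ((opF hα0 k).formDomain hF : Set L2) =
      sobolevZero 1 ∩ weightedL2 (fun x => japaneseBracket (x ^ (2 * α))) := by
  have h : (opF hα0 k).formDomain hF = (op α k).formDomain (op_isNonnegSymm hα0 k) :=
    LinearPMap.formDomain_friedrichs (op_isNonnegSymm hα0 k) (op_domain_dense α k) hF
  rw [h, formDomain_op hα0 hα1 hk]

end HalfLine

end

/-! ### Assembly of the theorem. -/

theorem mainTheorem4 (α : ℝ) (hα0 : 0 ≤ α) (hα1 : α < 1) (k : ℤ) (hk : k ≠ 0) :
    -- `A_α(k)` is densely defined and closable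
    Dense ((HalfLine.op α k).domain : Set HalfLine.L2) ∧ (HalfLine.op α k).IsClosable ∧
    -- (i) the domain of the closure
    ((HalfLine.op α k).closure.domain : Set HalfLine.L2) =
      HalfLine.sobolevZero 2 ∩
        HalfLine.weightedL2 (fun x => HalfLine.japaneseBracket x ^ (4 * α)) ∧
    -- (ii) the adjoint
    ((HalfLine.op α k)†.domain : Set HalfLine.L2) =
      {g | ∃ h : HalfLine.L2, HalfLine.WeakDiffOp α k g h} ∧
    (∀ g : (HalfLine.op α k)†.domain, HalfLine.WeakDiffOp α k g ((HalfLine.op α k)† g)) ∧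
    ContDiffOn ℝ ∞ (HalfLine.Phi α k) (Set.Ioi 0) ∧
    ContDiffOn ℝ ∞ (HalfLine.Psi α k) (Set.Ioi 0) ∧
    (∃ (hΦ : MemLp (fun x => (HalfLine.Phi α k x : ℂ)) 2 HalfLine.leb)
       (hΨ : MemLp (fun x => (HalfLine.Psi α k x : ℂ)) 2 HalfLine.leb),
      ((HalfLine.op α k)†.domain =
          (HalfLine.op α k).closure.domain ⊔ Submodule.span ℂ {hΨ.toLp} ⊔
            Submodule.span ℂ {hΦ.toLp} ∧
        iSupIndep ![(HalfLine.op α k).closure.domain, Submodule.span ℂ {hΨ.toLp},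
          Submodule.span ℂ {hΦ.toLp}]) ∧
      (LinearMap.ker (HalfLine.op α k)†.toFun).map (HalfLine.op α k)†.domain.subtype =
        Submodule.span ℂ {hΦ.toLp} ∧
      -- (iii) the Friedrichs extension: the operator domain as a direct sum
      ((HalfLine.opF hα0 k).domain =
          (HalfLine.op α k).closure.domain ⊔ Submodule.span ℂ {hΨ.toLp} ∧
        Disjoint (HalfLine.op α k).closure.domain (Submodule.span ℂ {hΨ.toLp}))) ∧
    -- (iii) the operator domain through the asymptotics at the origin
    ((HalfLine.opF hα0 k).domain : Set HalfLine.L2) =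
      {g | g ∈ (HalfLine.op α k)†.domain ∧
        ∃ g₁ : ℂ, HalfLine.AsympZero g fun x => g₁ * (x ^ (1 + α / 2) : ℝ)} ∧
    -- (iii) the form domain
    (∃ hF : (HalfLine.opF hα0 k).IsNonnegSymm,
      ((HalfLine.opF hα0 k).formDomain hF : Set HalfLine.L2) =
        HalfLine.sobolevZero 1 ∩
          HalfLine.weightedL2 (fun x => HalfLine.japaneseBracket (x ^ (2 * α)))) ∧
    -- (iii) it is the only self-adjoint extension with domain in the domain of `x⁻¹`
    (HalfLine.op α k ≤ HalfLine.opF hα0 k ∧ IsSelfAdjoint (HalfLine.opF hα0 k) ∧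
      ((HalfLine.opF hα0 k).domain : Set HalfLine.L2) ⊆ HalfLine.domInvX ∧
      ∀ B : HalfLine.L2 →ₗ.[ℂ] HalfLine.L2, HalfLine.op α k ≤ B → IsSelfAdjoint B →
        (B.domain : Set HalfLine.L2) ⊆ HalfLine.domInvX → B = HalfLine.opF hα0 k) ∧
    -- (iv) the self-adjoint extensions: `γ = ∞` is the Friedrichs extension
    (∀ B : HalfLine.L2 →ₗ.[ℂ] HalfLine.L2,
      (HalfLine.op α k ≤ B ∧ IsSelfAdjoint B) ↔
        B = HalfLine.opF hα0 k ∨ ∃ γ : ℝ, B = HalfLine.opBC α k γ) := by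
  have hp := HalfLine.isBoundaryPair hα0 hα1 hk
  have hcl := LinearPMap.isClosable_of_symm hp.dense hp.symm
  have hX := HalfLine.mem_closure_domain_iff hα0 hα1 hk
  obtain ⟨hr, -, hr1, -⟩ := HalfLine.exists_adjoint_Phi hα0 hα1 hk
  obtain ⟨hs, hs1, hs2⟩ := HalfLine.exists_adjoint_Psi hα0 hα1 hk
  have hsup := Submodule.eq_sup_span_sup_span_of_functionals hX hs1 hs2 hr1
  have hind := Submodule.iSupIndep_of_functionals hX hs1 hs2 hr1
  have hmem := Submodule.mem_sup_span_iff_of_functionals hX hs1 hs2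
  have hdis := Submodule.disjoint_span_of_functionals hX hs2
  refine ⟨hp.dense, hcl, Subset.antisymm (HalfLine.closure_domain_subset hα0 hα1 hk)
    (HalfLine.subset_closure_domain hα0 hα1 hk), ?_, ?_, HalfLine.contDiffOn_Phi hα0 hk,
    HalfLine.contDiffOn_Psi hα0 hα1 hk, ⟨HalfLine.memLp_Phi hα0 hα1 hk,
    HalfLine.memLp_Psi hα0 hα1 hk, ⟨hsup, hind⟩, HalfLine.ker_adjoint hα0 hα1 hk, ?_, hdis⟩, ?_, ?_,
    ⟨HalfLine.op_le_opF hα0 hα1 hk, HalfLine.isSelfAdjoint_opF hα0 hα1 hk,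
    HalfLine.opF_domain_subset_domInvX hα0 hk, ?_⟩, ?_⟩
  · ext g
    constructor
    · exact fun hg => ⟨_, (HalfLine.weakDiffOp_iff_isSol _ _).2 (HalfLine.isSol_adjoint ⟨g, hg⟩)⟩
    · rintro ⟨h, hh⟩
      exact HalfLine.mem_adjoint_domain_of_isSol ((HalfLine.weakDiffOp_iff_isSol _ _).1 hh)
  · exact fun g => (HalfLine.weakDiffOp_iff_isSol _ _).2 (HalfLine.isSol_adjoint g)
  · ext g
    rw [HalfLine.mem_opF_domain_iff hα0 hα1 hk]
    exact (hmem g).symm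
  · ext g
    constructor
    · intro hg
      obtain ⟨h, h'⟩ := (HalfLine.mem_opF_domain_iff hα0 hα1 hk g).1 hg
      exact ⟨h, (HalfLine.exists_asympZero_iff hα0 hα1 hk ⟨g, h⟩).2 h'⟩
    · rintro ⟨h, h'⟩
      exact (HalfLine.mem_opF_domain_iff hα0 hα1 hk g).2
        ⟨h, (HalfLine.exists_asympZero_iff hα0 hα1 hk ⟨g, h⟩).1 h'⟩
  · exact ⟨_, HalfLine.formDomain_opF hα0 hα1 hk (HalfLine.opF_isNonnegSymm hα0 hα1 hk)⟩
  · exact fun B hB hB' hBX => HalfLine.eq_opF_of_forall hα0 hα1 hk hB hB' fun f hf =>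
      HalfLine.coeffA_eq_zero_of_mem_domInvX hα0 hα1 hk f (hBX hf)
  · intro B
    constructor
    · rintro ⟨hB, hB'⟩
      rcases hp.boundary_condition_of_isSelfAdjoint hB hB' with h | ⟨t, h⟩
      · exact Or.inl (HalfLine.eq_opF_of_forall hα0 hα1 hk hB hB' h)
      · exact Or.inr ⟨_, HalfLine.eq_opBC_of_forall hα0 hα1 hk hB hB' t h⟩
    · rintro (rfl | ⟨γ, rfl⟩)
      · exact ⟨HalfLine.op_le_opF hα0 hα1 hk, HalfLine.isSelfAdjoint_opF hα0 hα1 hk⟩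
      · exact ⟨HalfLine.op_le_opBC hα0 hα1 hk γ, HalfLine.isSelfAdjoint_opBC hα0 hα1 hk γ⟩
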